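/- Let $K$ be a field of characteristic $0$ (for instance $\mathbb{C}$, or $\mathbb{C}(q)$ with $q$ an indeterminate), $q\in K$, $q\ne 0$, let $n\ge 1$ and $r=2n$. A link pattern of size $r$ is a pairing of the points $1,\dots,r$ of a line by non-intersecting arches in the upper half plane. For $1\le i\le r-1$ let $e_i$ be the Temperley--Lieb generator acting on the span of link patterns: $e_i\pi$ is obtained from $\pi$ by connecting to each other the arches that end at $i$ and $i+1$ and creating a little arch between $i$ and $i+1$; if $\pi$ already contains the arch $(i,i+1)$, then $e_i\pi=\beta\pi$ with $\beta=-(q+q^{-1})$. Let $$R_i(u)=\frac{(qu-q^{-1})+(u-1)e_i}{q-q^{-1}u}.$$ For a vector $\Psi=\sum_\pi\Psi_\pi\,\pi$ of polynomials $\Psi_\pi\in K[w_1,\dots,w_r]$ let $m_j$ be the degree of $\Psi$ in $w_j$ and let its total degree be the largest total degree of an entry. The level-one $B_r$ $q$KZ system is $$R_i(w_{i+1}/w_i)\Psi=\tau_i\Psi\quad(1\le i\le r-1),$$ $$w_r^{-m_r}\,\frac{q^{-1}w_r-q}{q^{-1}-qw_r}\,\Psi=\Psi(w_1,\dots,w_{r-1},1/w_r),$$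 $$(q^3w_1)^{-m_1}\,\frac{q^{-2}-q^2w_1}{qw_1-q^{-1}}\,\Psi=\Psi\Big(\frac1{q^6w_1},w_2,\dots,w_r\Big),$$ where $\tau_i$ interchanges $w_i$ and $w_{i+1}$. Let $\pi_0$ be the link pattern connecting $i\leftrightarrow 2n+1-i$ for all $i$. Then the system has a polynomial solution $\Psi$ with the following properties. 1. $\Psi$ has degree $r-1=2n-1$ in each $w_j$ (in particular $m_1=m_r=r-1$) and total degree $n(3n-1)$. 2. With $C=2^n\prod_{i=1}^{r}(qw_i-q^{-1})$, $$\Psi_{\pi_0}=C\prod_{1\le i<j\le n}(qw_i-q^{-1}w_j)(q^{-2}-q^2w_iw_j)\prod_{n+1\le i<j\le 2n}(qw_i-q^{-1}w_j)(qw_iw_j-q^{-1}),$$ and $C$ divides every entry of $\Psi$. 3. All other entries follow from $\Psi_{\pi_0}$ triangularly. Write $\sigma\prec\pi$ if $\sigma\neq\pi$ and, for every $k$, at least as many arches of $\sigma$ as of $\pi$ have their left end among the first $k$ points. For each $\pi\ne\pi_0$ there are $i$ and a link pattern $\sigma=e_i\pi$ such that $\sigma\prec\pi$, such that every $\pi'\neq\pi$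 with $e_i\pi'\in\{\sigma,\beta\sigma\}$ (as diagrams, up to a removed loop) satisfies $\pi'\prec\pi$, and such that $$\Psi_\pi=(qw_i-q^{-1}w_{i+1})\,\frac{\tau_i\Psi_\sigma-\Psi_\sigma}{w_{i+1}-w_i}-\sum_{\pi'}\Psi_{\pi'},$$ the sum being over the $\pi'\ne\pi,\sigma$ with $e_i\pi'=\sigma$ as diagrams. 4. (Minimality.) If $q^2\ne-1$, then every nonzero polynomial solution $\Phi$ of the system has degree at least $r-1$ in each $w_j$ and total degree at least $n(3n-1)$; and if either $\Phi$ has degree exactly $r-1$ in $w_1$ and in $w_r$, or $\Phi$ has total degree exactly $n(3n-1)$, then $\Phi$ is a scalar multiple of $\Psi$. -/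

import Mathlib

open MvPolynomial Finset

/-- Link patterns of size `N`: `N` points on a line, paired by non-intersecting arches drawn in the
upper half plane. A pattern is recorded by the map sending each point to the other end of its arch. -/
def LinkPattern (N : ℕ) : Type :=
  {p : Fin N → Fin N // (∀ j, p (p j) = j) ∧ (∀ j, p j ≠ j) ∧ ∀ a b, a < b → b < p a → p b < p a}

namespace LinkPattern

instance (N : ℕ) : DecidableEq (LinkPattern N) :=
  inferInstanceAs (DecidableEq {p : Fin N → Fin N //
    (∀ j, p (p j) = j) ∧ (∀ j, p j ≠ j) ∧ ∀ a b, a < b → b < p a → p b < p a})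

instance (N : ℕ) : Fintype (LinkPattern N) :=
  inferInstanceAs (Fintype {p : Fin N → Fin N //
    (∀ j, p (p j) = j) ∧ (∀ j, p j ≠ j) ∧ ∀ a b, a < b → b < p a → p b < p a})

/-- The map exchanging the partners of the points of `p` so that `x` and `y` become partners, as do
their former partners. -/
def connectFun {N : ℕ} (x y : Fin N) (p : Fin N → Fin N) (j : Fin N) : Fin N :=
  if j = x then y else if j = y then x
  else if j = p x then p y else if j = p y then p x else p j

theorem connectFun_spec {N : ℕ} (x y : Fin N) (hxy : (x : ℕ) + 1 = y) (p : Fin N → Fin N)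
    (h1 : ∀ j, p (p j) = j) (h2 : ∀ j, p j ≠ j) (h3 : ∀ a b, a < b → b < p a → p b < p a) :
    (∀ j, connectFun x y p (connectFun x y p j) = j) ∧ (∀ j, connectFun x y p j ≠ j) ∧
      ∀ a b, a < b → b < connectFun x y p a → connectFun x y p b < connectFun x y p a := by
  have hne : x ≠ y := fun h => by rw [h] at hxy; omega
  have hinj : ∀ a b, p a = p b → a = b := fun a b h => by rw [← h1 a, h, h1]
  refine ⟨fun j => ?_, fun j => ?_, ?_⟩
  · clear h3
    grind [connectFun]
  · clear h3
    grind [connectFun]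
  have h4 : ∀ a b, (a < b ∧ b < p a ↔ a < p b ∧ p b < p a) := by
    have h5 : ∀ a b, a < b → b < p a → a < p b ∧ p b < p a := by
      intro a b hab hba
      refine ⟨?_, h3 a b hab hba⟩
      rcases lt_trichotomy (p b) a with h | h | h
      · have := h3 (p b) a h (by rw [h1]; exact hab)
        rw [h1] at this
        exact absurd hba (not_lt.2 this.le)
      · exact absurd hba (by rw [← h, h1]; exact lt_irrefl _)
      · exact h
    intro a b
    refine ⟨fun h => h5 a b h.1 h.2, fun h => ?_⟩
    have := h5 a (p b) h.1 h.2
    rwa [h1] at this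
  have h6 : ∀ a b, (p a < b ∧ b < a ↔ p a < p b ∧ p b < a) := by
    intro a b
    have := h4 (p a) b
    rwa [h1] at this
  have key : ∀ b, b ≠ x → b ≠ y → b ≠ p x → b ≠ p y →
      (p x < b → b < p y → p b < p y) ∧ (p y < b → b < p x → p b < p x) ∧
      (b < p x → p x < p b → p y < p b) ∧ (b < p y → p y < p b → p x < p b) := by
    intro b b1 b2 b3 b4
    have e1 := h4 x b
    have e2 := h6 x b
    have e3 := h4 y b
    have e4 := h6 y b
    have e5 := h4 x y
    have e6 := h6 x y
    have e7 := h4 y x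
    have e8 := h6 y x
    have e9 := h4 b x
    have f1 := h4 b y
    have f2 : p b ≠ x := fun h => b3 (by rw [← h, h1])
    have f3 : p b ≠ y := fun h => b4 (by rw [← h, h1])
    have f4 : p b ≠ p x := fun h => b1 (hinj _ _ h)
    have f5 : p b ≠ p y := fun h => b2 (hinj _ _ h)
    have f6 := h2 x
    have f7 := h2 y
    have f8 := h2 b
    have f9 : p x ≠ p y := fun h => hne (hinj _ _ h)
    simp only [Fin.lt_def, Fin.ext_iff, ne_eq] at *
    clear h1 h2 h3 h4 h6 hinj
    generalize (p x).val = X at *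
    generalize (p y).val = Y at *
    generalize (p b).val = B at *
    refine ⟨?_, ?_, ?_, ?_⟩ <;> omega
  intro a b hab hbp
  have ka := key a
  have kb := key b
  have e1 := h3 a b hab
  have a1 := hinj a b
  have a2 := hinj x y
  have a3 : a = p x → p a = x := fun h => by rw [h, h1]
  have a4 : a = p y → p a = y := fun h => by rw [h, h1]
  have a5 : b = p x → p b = x := fun h => by rw [h, h1]
  have a6 : b = p y → p b = y := fun h => by rw [h, h1]
  have a7 : p a = x → a = p x := fun h => by rw [← h, h1]
  have a8 : p a = y → a = p y := fun h => by rw [← h, h1]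
  have c1 : b = p x → p b = x := fun h => by rw [h, h1]
  have c2 : p b = x → b = p x := fun h => by rw [← h, h1]
  have c3 : p b = y → b = p y := fun h => by rw [← h, h1]
  have c4 : p x = y → x = p y := fun h => by rw [← h, h1]
  have c5 : b = y → p b = p y := fun h => by rw [h]
  have c6 : b = x → p b = p x := fun h => by rw [h]
  have a9 := h2 x
  have b1 := h2 y
  clear h1 h2 h3 h4 h6 key hinj
  simp only [connectFun] at hbp ⊢
  simp only [Fin.lt_def, Fin.ext_iff, ne_eq] at *
  split_ifs at hbp ⊢ <;> grind

/-- The pattern obtained from `p` by connecting to each other the arches that end at the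
neighbouring points `i` and `i + 1`, and creating a little arch between these two points
(if `p` already has the little arch, the pattern does not change). -/
def connect {N : ℕ} (i : ℕ) (hi : i + 1 < N) (p : LinkPattern N) : LinkPattern N :=
  ⟨connectFun ⟨i, by omega⟩ ⟨i + 1, hi⟩ p.1,
    connectFun_spec _ _ rfl p.1 p.2.1 p.2.2.1 p.2.2.2⟩

/-- The pattern connecting the `j`-th point to the `j`-th point from the end (the points are
numbered from `0`, so that `j` is connected to `2 n - 1 - j`). -/
def rainbow (n : ℕ) : LinkPattern (2 * n) :=
  ⟨Fin.rev, Fin.rev_rev, by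
    intro j h
    have := congrArg Fin.val h
    rw [Fin.val_rev] at this
    omega, by
    intro a b h _
    exact Fin.rev_lt_rev.2 h⟩

/-- `openings p k` is the number of arches of `p` whose left end is among the first `k` points. -/
def openings {N : ℕ} (p : LinkPattern N) (k : ℕ) : ℕ :=
  #{j : Fin N | j.val < k ∧ j < p.1 j}

/-- The strict partial order on link patterns: `σ` precedes `π` if, for each `k`, at least as many
arches of `σ` as of `π` have been opened among the first `k` points, with strict inequality for some
`k` (the Dyck path of `σ` lies above that of `π`). -/
def Precedes {N : ℕ} (σ π : LinkPattern N) : Prop :=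
  (∀ k, openings π k ≤ openings σ k) ∧ ∃ k, openings π k < openings σ k

end LinkPattern

namespace BqKZ

noncomputable section

/-- Polynomials over `K` in the multiplicative spectral parameters `w_1, ..., w_N`
(numbered from `0` here). -/
abbrev Poly (K : Type*) [Field K] (N : ℕ) := MvPolynomial (Fin N) K

/-- The field of rational functions in the spectral parameters. -/
abbrev RatFun (K : Type*) [Field K] (N : ℕ) := FractionRing (Poly K N)

/-- The matrix of the Temperley--Lieb generator `e_i` acting on linear combinations of link patterns:
`e_i σ` is the pattern `connect i σ`, with weight `β` if a closed loop is formed. -/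
def tlMatrix {N : ℕ} {F : Type*} [Field F] (β : F) (i : ℕ) (hi : i + 1 < N) :
    Matrix (LinkPattern N) (LinkPattern N) F :=
  Matrix.of fun π σ =>
    if σ.connect i hi = π then
      (if σ.1 ⟨i, by omega⟩ = ⟨i + 1, hi⟩ then β else 1)
    else 0

/-- The trigonometric `R`-matrix
`R_i(u) = ((q u - q⁻¹) + (u - 1) e_i) / (q - q⁻¹ u)`, with loop weight `β = -(q + q⁻¹)`. -/
def RMatrix {N : ℕ} {F : Type*} [Field F] (q : F) (i : ℕ) (hi : i + 1 < N) (u : F) :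
    Matrix (LinkPattern N) (LinkPattern N) F :=
  (q - q⁻¹ * u)⁻¹ •
    ((q * u - q⁻¹) • (1 : Matrix (LinkPattern N) (LinkPattern N) F) +
      (u - 1) • tlMatrix (-(q + q⁻¹)) i hi)

/-- The scalar `x^{-m} (q⁻¹ x - q) / (q⁻¹ - q x)`. -/
def boundaryFactor {F : Type*} [Field F] (q : F) (m : ℕ) (x : F) : F :=
  (x ^ m)⁻¹ * ((q⁻¹ * x - q) / (q⁻¹ - q * x))

/-- The scalar `(q³ x)^{-m} (q⁻² - q² x) / (q x - q⁻¹)`. -/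
def affineFactor {F : Type*} [Field F] (q : F) (m : ℕ) (x : F) : F :=
  ((q ^ 3 * x) ^ m)⁻¹ * (((q ^ 2)⁻¹ - q ^ 2 * x) / (q * x - q⁻¹))

variable {K : Type*} [Field K]

/-- The spectral parameter `w_j` as a rational function. -/
def w {N : ℕ} (j : Fin N) : RatFun K N := algebraMap (Poly K N) (RatFun K N) (X j)

/-- Substitution of rational functions `x` for the spectral parameters in a vector of polynomials. -/
def subst {N : ℕ} (x : Fin N → RatFun K N) (Ψ : LinkPattern N → Poly K N) :
    LinkPattern N → RatFun K N :=
  fun π => aeval x (Ψ π)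

/-- The degree of a vector of polynomials in `w_j`: the largest degree of an entry. -/
def degreeIn {N : ℕ} (Ψ : LinkPattern N → Poly K N) (j : Fin N) : ℕ :=
  univ.sup fun π => degreeOf j (Ψ π)

/-- The total degree of a vector of polynomials: the largest total degree of an entry. -/
def totalDegree {N : ℕ} (Ψ : LinkPattern N → Poly K N) : ℕ :=
  univ.sup fun π => (Ψ π).totalDegree

/-- The level one `q`KZ system of type `B_r`. All equations are between vectors of rational
functions; `subst w Ψ` is `Ψ` itself. The exponents are the degrees of `Ψ` in `w_r` and `w_1`. -/
structure IsSolution {r : ℕ} (hr : 0 < r) (q : K) (Ψ : LinkPattern r → Poly K r) : Prop where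
  /-- `R_i(w_{i+1}/w_i) Ψ = τ_i Ψ`, where `τ_i` interchanges `w_i` and `w_{i+1}`. -/
  bulk : ∀ (i : ℕ) (hi : i + 1 < r),
    (RMatrix (algebraMap K (RatFun K r) q) i hi (w ⟨i + 1, hi⟩ / w ⟨i, by omega⟩)).mulVec (subst w Ψ) =
      subst (w ∘ Equiv.swap ⟨i, by omega⟩ ⟨i + 1, hi⟩) Ψ
  /-- `w_r^{-m_r} (q⁻¹ w_r - q) / (q⁻¹ - q w_r) Ψ = τ_r Ψ`, where `τ_r` sends `w_r` to `1 / w_r`. -/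
  boundary :
    boundaryFactor (algebraMap K (RatFun K r) q) (degreeIn Ψ ⟨r - 1, by omega⟩)
        (w ⟨r - 1, by omega⟩) • subst w Ψ =
      subst (Function.update w ⟨r - 1, by omega⟩ (w ⟨r - 1, by omega⟩)⁻¹) Ψ
  /-- `(q³ w_1)^{-m_1} (q⁻² - q² w_1) / (q w_1 - q⁻¹) Ψ(w_1, ...) = Ψ(1 / (q⁶ w_1), ...)`. -/
  affine :
    affineFactor (algebraMap K (RatFun K r) q) (degreeIn Ψ ⟨0, hr⟩) (w ⟨0, hr⟩) • subst w Ψ =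
      subst (Function.update w ⟨0, hr⟩ (algebraMap K (RatFun K r) q ^ 6 * w ⟨0, hr⟩)⁻¹) Ψ

/-- The common factor `2^n ∏_{i=1}^{2n} (q w_i - q⁻¹)`. -/
def commonFactor (n : ℕ) (q : K) : Poly K (2 * n) :=
  2 ^ n * ∏ i, (C q * X i - C q⁻¹)

/-- The factorized polynomial
`C ∏_{1 ≤ i < j ≤ n} (q w_i - q⁻¹ w_j) (q⁻² - q² w_i w_j)
   ∏_{n+1 ≤ i < j ≤ 2n} (q w_i - q⁻¹ w_j) (q w_i w_j - q⁻¹)`. -/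
def baseEntry (n : ℕ) (q : K) : Poly K (2 * n) :=
  commonFactor n q *
    (∏ p : Fin (2 * n) × Fin (2 * n) with p.1 < p.2 ∧ p.2.val < n,
      (C q * X p.1 - C q⁻¹ * X p.2) * (C (q ^ 2)⁻¹ - C (q ^ 2) * X p.1 * X p.2)) *
    ∏ p : Fin (2 * n) × Fin (2 * n) with p.1 < p.2 ∧ n ≤ p.1.val,
      (C q * X p.1 - C q⁻¹ * X p.2) * (C q * X p.1 * X p.2 - C q⁻¹)

/-- Every entry of `Ψ` except the base entry is given by the entries that precede it: for each
`π ≠ π_0` there are `i` and a pattern `σ = e_i π` preceding `π` such that all the patterns `π'` with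
`e_i π' ∝ σ` other than `π` precede `π`, and
`Ψ_π = (q w_i - q⁻¹ w_{i+1}) (τ_i Ψ_σ - Ψ_σ) / (w_{i+1} - w_i) - ∑_{π'} Ψ_{π'}`,
the sum being over such `π'` different from `σ` and `π`. -/
def IsTriangular {n : ℕ} (q : K) (Ψ : LinkPattern (2 * n) → Poly K (2 * n)) : Prop :=
  ∀ π, π ≠ LinkPattern.rainbow n → ∃ (i : ℕ) (hi : i + 1 < 2 * n) (σ : LinkPattern (2 * n)),
    π.connect i hi = σ ∧ σ.Precedes π ∧
    (∀ π' : LinkPattern (2 * n), π'.connect i hi = σ → π' ≠ π → π'.Precedes π) ∧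
    (X ⟨i + 1, hi⟩ - X ⟨i, by omega⟩) *
        (Ψ π + ∑ π' with LinkPattern.connect i hi π' = σ ∧ π' ≠ σ ∧ π' ≠ π, Ψ π') =
      (C q * X ⟨i, by omega⟩ - C q⁻¹ * X ⟨i + 1, hi⟩) *
        (rename (Equiv.swap ⟨i, by omega⟩ ⟨i + 1, hi⟩) (Ψ σ) - Ψ σ)

end

end BqKZ

/-!
The solution is constructed in the spin representation and then read in link patterns.

*Spin vectors.* Orienting the arches of a link pattern in all ways, with a weight `-q⁻¹` for each arch
oriented to the left, embeds the span of link patterns of size `2 n` in the span of spin configurations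
(`LinkPattern.iota`). The embedding carries `e_i` to the Temperley--Lieb action on spins
(`LinkPattern.iota_connect`), it is unitriangular on Dyck paths, and its image is annihilated by the
raising operator of quantum `sl₂`. In the spin basis the exchange relations say that `Ψ` intertwines two
actions of the Hecke algebra (`QKZ.IsSpin`). Hence all components are obtained from the one at the
configuration with `n` up steps followed by `n` down steps by Demazure--Lusztig operators; the braid
relations make this consistent as soon as that component has the expected exchange relations off the
middle (`QKZ.isSpin_spinVector`).

*The base component.* The product `QKZ.base` has these relations. The vector built from it is annihilated
by the raising operator: it is enough to look at one component, since the raising operator commutes with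
the Hecke action; up to common factors that component is a symmetrization over `n + 1` variables, which
after the substitution `y = q² x + q⁻² / x` is a divided difference of order `n` of a polynomial of degree
`n - 1`, and so vanishes (`QKZ.symmSum_quotFactor_eq_zero`). For an indeterminate `q` a vector annihilated
by the raising operator is determined by its components at Dyck paths, so the spin solution is a
combination of link patterns; the coefficients are polynomial in `q^{±1}`, and `q` can be specialized
(`QKZ.exists_isSpin`).

*The equations at the ends.* The components at Dyck paths start with an up step and end with a down step,
so they are obtained from the base component by operators that do not involve the first and the last
variable, and they inherit its reciprocity in these two variables (`QKZ.exists_isLoop`). Multiplication by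
the common factor, which is symmetric, gives exactly the scalars of the last two equations
(`QKZ.isSolution_of_isLoop`).

*Triangularity.* The Dyck path of a pattern other than the rainbow has a valley at some `i`. The exchange
relation at `i`, read at the component `e_i π`, is the triangular recursion (`QKZ.IsLoop.isTriangular`);
in particular a solution is determined by its rainbow component (`QKZ.eq_zero_of_isTriangular`).

*Minimality.* Let `Φ` be any solution and `f` its rainbow component. Evaluating the equations at suitable
points gives zeros, at the neighbouring or outermost variables, of `f`, and the remaining equations carry
them to the other variables, as long as no scalar vanishes on the way (`QKZ.ZeroRules`). At the generic zero
of a prime factor `g` of the base entry no scalar does, so that `f` vanishes there, that is, `g` divides `f`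
(`QKZ.primeFactor_dvd`). The prime factors are pairwise distinct, so the base entry divides `f`, and its
degrees bound those of `Φ`. The quotient is symmetric in the first and in the last `n` variables, so under
either hypothesis of extremality it is a constant `c`, and `Φ = c Ψ` (`QKZ.minimality`).
-/

/-! ### Spin configurations and their paths -/

namespace QKZ

/-- The transposition of the neighbouring points `i` and `i + 1`. -/
abbrev adj {N : ℕ} (i : ℕ) (hi : i + 1 < N) : Equiv.Perm (Fin N) :=
  Equiv.swap ⟨i, by omega⟩ ⟨i + 1, hi⟩

/-- A spin configuration; `true` stands for an up step (a left end of an arch). -/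
abbrev Config (N : ℕ) : Type := Fin N → Bool

/-- The height, after the first `k` steps, of the path with up steps where `S` is `true` and down
steps where `S` is `false`. -/
def ht {N : ℕ} (S : Config N) (k : ℕ) : ℤ :=
  ∑ j : Fin N, if j.val < k then (if S j then 1 else -1) else 0

variable {N : ℕ}

theorem ht_zero (S : Config N) : ht S 0 = 0 := by simp [ht]

theorem ht_succ (S : Config N) (j : Fin N) :
    ht S (j.val + 1) = ht S j.val + if S j then 1 else -1 := by
  have h : ∀ l : Fin N, (if l.val < j.val + 1 then (if S l then (1 : ℤ) else -1) else 0) =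
      (if l.val < j.val then (if S l then 1 else -1) else 0) +
        if l = j then (if S j then 1 else -1) else 0 := by
    intro l
    by_cases h : l = j
    · subst h; simp
    · have h' : l.val ≠ j.val := fun e => h (Fin.ext e)
      have : l.val < j.val + 1 ↔ l.val < j.val := by omega
      simp [h, this]
  rw [ht, Finset.sum_congr rfl fun l _ => h l, Finset.sum_add_distrib]
  simp [ht]

theorem adj_val_lt (i : ℕ) (hi : i + 1 < N) (k : ℕ) (hk : k ≠ i + 1) (j : Fin N) :
    (adj i hi j).val < k ↔ j.val < k := by
  rcases eq_or_ne j ⟨i, by omega⟩ with h | h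
  · subst h; simp only [Equiv.swap_apply_left]; omega
  · rcases eq_or_ne j ⟨i + 1, hi⟩ with h' | h'
    · subst h'; simp only [Equiv.swap_apply_right]; omega
    · rw [adj, Equiv.swap_apply_of_ne_of_ne h h']

theorem ht_comp_adj (S : Config N) (i : ℕ) (hi : i + 1 < N) (k : ℕ) (hk : k ≠ i + 1) :
    ht (S ∘ adj i hi) k = ht S k := by
  rw [ht, ht, ← Equiv.sum_comp (adj i hi)]
  refine Finset.sum_congr rfl fun j _ => ?_
  simp only [Function.comp]
  simp only [adj_val_lt i hi k hk, adj, Equiv.swap_apply_self]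

/-- The sum of the positions of the up steps; it decreases when an up step moves to the left. -/
def area (S : Config N) : ℕ := ∑ j : Fin N, if S j then j.val else 0

theorem area_comp_adj (S : Config N) (i : ℕ) (hi : i + 1 < N) (h0 : S ⟨i, by omega⟩ = false)
    (h1 : S ⟨i + 1, hi⟩ = true) : area (S ∘ adj i hi) < area S := by
  have h : ∀ j : Fin N, (if (S ∘ adj i hi) j then j.val else 0) +
      (if j = ⟨i + 1, hi⟩ then i + 1 else 0) =
      (if S j then j.val else 0) + (if j = ⟨i, by omega⟩ then i else 0) := by
    intro j
    rcases eq_or_ne j ⟨i, by omega⟩ with h | h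
    · subst h; simp [h0, h1]
    · rcases eq_or_ne j ⟨i + 1, hi⟩ with h' | h'
      · subst h'; simp [h0, h1]
      · simp [h, h', adj, Equiv.swap_apply_of_ne_of_ne h h']
  have := Finset.sum_congr rfl fun j (_ : j ∈ univ) => h j
  rw [Finset.sum_add_distrib, Finset.sum_add_distrib] at this
  simp only [Finset.sum_ite_eq', mem_univ, if_true] at this
  simp only [area]
  omega

/-- The configuration whose `m` up steps come first. -/
def initial (N m : ℕ) : Config N := fun j => decide (j.val < m)

theorem ht_eq (S : Config N) : ht S N = 2 * #{j | S j} - N := by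
  have h : ∀ j : Fin N, (if j.val < N then (if S j then (1 : ℤ) else -1) else 0) =
      2 * (if S j then 1 else 0) - 1 := by
    intro j
    simp only [j.2, if_true]
    split_ifs <;> norm_num
  rw [ht, Finset.sum_congr rfl fun l _ => h l, Finset.sum_sub_distrib, ← Finset.mul_sum]
  simp

/-- A configuration in which no up step follows a down step is an initial configuration. -/
theorem eq_initial (S : Config N)
    (h : ∀ i (hi : i + 1 < N), S ⟨i, by omega⟩ = false → S ⟨i + 1, hi⟩ = false) :
    S = initial N #{j | S j} := by
  have h' : ∀ d : ℕ, ∀ i (hi : i + d < N), S ⟨i, by omega⟩ = false → S ⟨i + d, hi⟩ = false := by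
    intro d
    induction d with
    | zero => intro i hi h0; exact h0
    | succ d ih => intro i hi h0; exact h (i + d) hi (ih i (by omega) h0)
  have h2 : ∀ a b : Fin N, a ≤ b → S b = true → S a = true := by
    intro a b hab hb
    by_contra ha
    have e := h' (b.val - a.val) a.val (by have := b.2; have := Fin.le_def.1 hab; omega) (by simpa using ha)
    have e2 : (⟨a.val + (b.val - a.val), by have := b.2; have := Fin.le_def.1 hab; omega⟩ : Fin N) = b :=
      Fin.ext (by have := Fin.le_def.1 hab; simp; omega)
    rw [e2, hb] at e
    exact absurd e (by simp)
  funext j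
  by_cases hj : S j = true
  · have : Finset.Iic j ⊆ ({j | S j} : Finset (Fin N)) := by
      intro a ha
      simp only [mem_filter, mem_univ, true_and]
      exact h2 a j (Finset.mem_Iic.1 ha) hj
    have := Finset.card_le_card this
    rw [Fin.card_Iic] at this
    simp only [initial, hj]
    symm
    simpa using this
  · have : ({j | S j} : Finset (Fin N)) ⊆ Finset.Iio j := by
      intro a ha
      simp only [mem_filter, mem_univ, true_and] at ha
      rw [Finset.mem_Iio]
      by_contra hc
      exact hj (h2 j a (not_lt.1 hc) ha)
    have := Finset.card_le_card this
    rw [Fin.card_Iio] at this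
    simp only [initial]
    rw [decide_eq_false (by omega)]
    simpa using hj

/-- Induction along the moves of up steps to the right, starting from an initial configuration. -/
theorem config_induction {m : ℕ} (P : Config N → Prop) (h0 : P (initial N m))
    (hs : ∀ (S : Config N) (i : ℕ) (hi : i + 1 < N), ht S N = 2 * m - N → S ⟨i, by omega⟩ = false →
      S ⟨i + 1, hi⟩ = true → P (S ∘ adj i hi) → P S) :
    ∀ S : Config N, ht S N = 2 * m - N → P S := by
  intro S
  induction hA : area S using Nat.strong_induction_on generalizing S with
  | _ A ih =>
    intro hS
    by_cases hd : ∃ (i : ℕ) (hi : i + 1 < N), S ⟨i, by omega⟩ = false ∧ S ⟨i + 1, hi⟩ = true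
    · obtain ⟨i, hi, a, b⟩ := hd
      refine hs S i hi hS a b (ih _ ?_ _ rfl ?_)
      · rw [← hA]; exact area_comp_adj S i hi a b
      · rw [ht_comp_adj S i hi N (by omega), hS]
    · have e := eq_initial S fun i hi a => by
        by_contra hb
        exact hd ⟨i, hi, a, by simpa using hb⟩
      have e2 : #{j | S j} = m := by
        have := ht_eq S
        omega
      rw [e, e2]
      exact h0

end QKZ

/-! ### Link patterns and their Dyck paths -/

namespace LinkPattern

variable {N : ℕ} (p : LinkPattern N)

theorem invol (j : Fin N) : p.1 (p.1 j) = j := p.2.1 j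

theorem apply_ne (j : Fin N) : p.1 j ≠ j := p.2.2.1 j

theorem inj {a b : Fin N} (h : p.1 a = p.1 b) : a = b := by rw [← p.invol a, h, p.invol]

theorem nested {a b : Fin N} (h1 : a < b) (h2 : b < p.1 a) : a < p.1 b ∧ p.1 b < p.1 a := by
  refine ⟨?_, p.2.2.2 a b h1 h2⟩
  rcases lt_trichotomy (p.1 b) a with h | h | h
  · have := p.2.2.2 (p.1 b) a h (by rw [p.invol]; exact h1)
    rw [p.invol] at this
    exact absurd h2 (not_lt.2 this.le)
  · exact absurd h2 (by rw [← h, p.invol]; exact lt_irrefl _)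
  · exact h

/-- The Dyck path of a link pattern: the up steps are the left ends of the arches. -/
def up : QKZ.Config N := fun j => decide (j < p.1 j)

theorem up_eq_true {j : Fin N} : p.up j = true ↔ j < p.1 j := by simp [up]

theorem up_eq_false {j : Fin N} : p.up j = false ↔ p.1 j < j := by
  have := p.apply_ne j
  simp only [up, decide_eq_false_iff_not, not_lt]
  exact ⟨fun h => lt_of_le_of_ne h this, le_of_lt⟩

/-- A configuration is compatible with a link pattern if each arch has exactly one end in it. -/
def Compatible (S : QKZ.Config N) : Prop := ∀ j, S (p.1 j) = !S j

theorem compatible_up : p.Compatible p.up := by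
  intro j
  rcases lt_or_gt_of_ne (p.apply_ne j) with h | h
  · rw [p.up_eq_false.2 h, Bool.not_false, p.up_eq_true, p.invol]; exact h
  · rw [p.up_eq_true.2 h, Bool.not_true, p.up_eq_false, p.invol]; exact h

variable {p}

/-- The steps of a compatible configuration on a union of arches cancel. -/
theorem Compatible.sum_eq_zero {S : QKZ.Config N} (hS : p.Compatible S) (A : Fin N → Prop)
    [DecidablePred A] (hA : ∀ j, A (p.1 j) ↔ A j) :
    ∑ j, (if A j then (if S j then (1 : ℤ) else -1) else 0) = 0 := by
  let e : Equiv.Perm (Fin N) := ⟨p.1, p.1, p.invol, p.invol⟩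
  have h := Equiv.sum_comp e fun j => if A j then (if S j then (1 : ℤ) else -1) else 0
  have h2 : ∀ j, (if A (e j) then (if S (e j) then (1 : ℤ) else -1) else 0) =
      - if A j then (if S j then (1 : ℤ) else -1) else 0 := by
    intro j
    change (if A (p.1 j) then (if S (p.1 j) then (1 : ℤ) else -1) else 0) = _
    rw [hS j]
    simp only [hA]
    cases S j <;> split_ifs <;> simp_all
  rw [Finset.sum_congr rfl fun j _ => h2 j, Finset.sum_neg_distrib] at h
  linarith

theorem Compatible.ht_eq_zero {S : QKZ.Config N} (hS : p.Compatible S) : QKZ.ht S N = 0 := by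
  rw [QKZ.ht]
  exact hS.sum_eq_zero (fun j => j.val < N) fun j => by simp

theorem Compatible.card_le_openings {S : QKZ.Config N} (hS : p.Compatible S) (k : ℕ) :
    #{j : Fin N | j.val < k ∧ S j} ≤ openings p k := by
  refine Finset.card_le_card_of_injOn (fun j => min j (p.1 j)) ?_ ?_
  · intro j hj
    simp only [coe_filter, mem_univ, true_and, Set.mem_ofPred_eq] at hj ⊢
    rcases lt_or_gt_of_ne (p.apply_ne j) with h | h
    · rw [min_eq_right h.le, p.invol]; exact ⟨lt_trans h hj.1, h⟩
    · rw [min_eq_left h.le]; exact ⟨hj.1, h⟩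
  · intro a ha b hb hab
    simp only [coe_filter, mem_univ, true_and, Set.mem_ofPred_eq] at ha hb hab
    have h1 := hS a
    have h2 := hS b
    rcases lt_or_gt_of_ne (p.apply_ne a) with h | h <;>
      rcases lt_or_gt_of_ne (p.apply_ne b) with h' | h'
    · rw [min_eq_right h.le, min_eq_right h'.le] at hab; exact p.inj hab
    · rw [min_eq_right h.le, min_eq_left h'.le] at hab
      rw [hab, ha.2, hb.2] at h1; exact absurd h1 (by simp)
    · rw [min_eq_left h.le, min_eq_right h'.le] at hab
      rw [← hab, ha.2, hb.2] at h2; exact absurd h2 (by simp)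
    · rwa [min_eq_left h.le, min_eq_left h'.le] at hab

variable (p)

theorem openings_eq (k : ℕ) : openings p k = #{j : Fin N | j.val < k ∧ p.up j} := by
  simp [openings, up]

theorem openings_succ (j : Fin N) :
    openings p (j.val + 1) = openings p j.val + if p.up j then 1 else 0 := by
  rw [openings_eq, openings_eq]
  split_ifs with h
  · rw [← Finset.card_insert_of_notMem (a := j) (by simp)]
    congr 1
    ext l
    simp only [mem_filter, mem_univ, true_and, mem_insert]
    rcases eq_or_ne l j with rfl | hl
    · simp [h]
    · have : l.val ≠ j.val := fun e => hl (Fin.ext e)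
      simp only [hl, false_or]
      refine and_congr_left fun _ => by omega
  · rw [add_zero]
    congr 1
    ext l
    simp only [mem_filter, mem_univ, true_and]
    rcases eq_or_ne l j with rfl | hl
    · simp [h]
    · have : l.val ≠ j.val := fun e => hl (Fin.ext e)
      refine and_congr_left fun _ => by omega

variable {p}

/-- A link pattern is determined by the left ends of its arches. -/
theorem eq_of_up_eq {p s : LinkPattern N} (h : p.up = s.up) : p = s := by
  have key : ∀ d : ℕ, ∀ a : Fin N, a < p.1 a → (p.1 a).val - a.val = d → s.1 a = p.1 a := by
    intro d
    induction d using Nat.strong_induction_on with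
    | _ d ih =>
      intro a ha hd
      by_contra hne
      have inside : ∀ c, a < c → c < p.1 a → s.1 c = p.1 c := by
        intro c h1 h2
        obtain ⟨h3, h4⟩ := p.nested h1 h2
        rcases lt_or_gt_of_ne (p.apply_ne c) with h5 | h5
        · have := ih (c.val - (p.1 c).val) (by rw [Fin.lt_def] at *; omega) (p.1 c)
            (by rw [p.invol]; exact h5) (by rw [p.invol])
          rw [p.invol] at this
          conv_lhs => rw [← this]
          rw [s.invol]
        · exact ih ((p.1 c).val - c.val) (by rw [Fin.lt_def] at *; omega) c h5 rfl
      have hb : s.1 (p.1 a) < p.1 a := by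
        rw [← s.up_eq_false, ← h, p.up_eq_false, p.invol]; exact ha
      have ha' : a < s.1 a := by rw [← s.up_eq_true, ← h, p.up_eq_true]; exact ha
      have h1 : ¬ s.1 a < p.1 a := by
        intro hlt
        have e := inside _ ha' hlt
        rw [s.invol] at e
        have := p.invol (s.1 a)
        rw [← e] at this
        exact hne this.symm
      have h2 : ¬ a ≤ s.1 (p.1 a) := by
        intro hle
        rcases hle.eq_or_lt with e | hlt
        · exact hne (by conv_lhs => rw [e]
                        rw [s.invol])
        · have e := inside _ hlt hb
          rw [s.invol] at e
          have := p.inj e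
          exact absurd hlt (by rw [← this]; exact lt_irrefl _)
      have h3 : p.1 a < s.1 a := lt_of_le_of_ne (not_lt.1 h1) fun e => hne e.symm
      have := (s.nested ha h3).1
      exact h2 this.le
  apply Subtype.ext
  funext j
  rcases lt_or_gt_of_ne (p.apply_ne j) with h5 | h5
  · have := key _ (p.1 j) (by rw [p.invol]; exact h5) rfl
    rw [p.invol] at this
    rw [← this, s.invol, this]
  · exact (key _ j h5 rfl).symm

theorem eq_of_openings_eq {p s : LinkPattern N} (h : ∀ k, openings p k = openings s k) : p = s := by
  apply eq_of_up_eq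
  funext j
  have h1 := openings_succ p j
  rw [h, h, openings_succ s j] at h1
  by_cases hp : p.up j = true <;> by_cases hs : s.up j = true <;> simp_all

theorem connect_left (i : ℕ) (hi : i + 1 < N) : (p.connect i hi).1 ⟨i, by omega⟩ = ⟨i + 1, hi⟩ := by
  simp [connect, connectFun]

theorem connect_right (i : ℕ) (hi : i + 1 < N) :
    (p.connect i hi).1 ⟨i + 1, hi⟩ = ⟨i, by omega⟩ := by
  rw [← connect_left (p := p) i hi, invol]

theorem rainbow_up (n : ℕ) : (rainbow n).up = QKZ.initial (2 * n) n := by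
  funext j
  have : (j < Fin.rev j) ↔ j.val < n := by rw [Fin.lt_def, Fin.val_rev]; omega
  simp [up, rainbow, QKZ.initial, this]

/-- A pattern other than the rainbow has a right end followed by a left end. -/
theorem exists_valley {n : ℕ} (p : LinkPattern (2 * n)) (hp : p ≠ rainbow n) :
    ∃ (i : ℕ) (hi : i + 1 < 2 * n), p.up ⟨i, by omega⟩ = false ∧ p.up ⟨i + 1, hi⟩ = true := by
  by_contra hc
  have e := QKZ.eq_initial p.up fun i hi a => by
    by_contra hb
    exact hc ⟨i, hi, a, by simpa using hb⟩
  have h1 := QKZ.ht_eq p.up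
  rw [p.compatible_up.ht_eq_zero] at h1
  have h2 : #{j | p.up j} = n := by push_cast at h1; omega
  rw [h2] at e
  exact hp (eq_of_up_eq (by rw [e, rainbow_up]))

/-- The map exchanging the partners of `a` and `y`, where `x` is the partner of `y`. -/
def splitFun (a x y : Fin N) (p : Fin N → Fin N) (j : Fin N) : Fin N :=
  if j = a then x else if j = x then a else if j = p a then y else if j = y then p a else p j

/-- If the arch from `a` is the closest one that encloses the little arch from `x` to `y`, both can
be replaced by the arches from `a` to `x` and from `y` to the former partner of `a`. -/
theorem splitFun_spec (p : Fin N → Fin N) (h1 : ∀ j, p (p j) = j) (h2 : ∀ j, p j ≠ j)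
    (h3 : ∀ a b, a < b → b < p a → p b < p a) {a x y : Fin N} (ha : a < x)
    (hxy : x.val + 1 = y.val) (hp : p x = y) (hb : y < p a)
    (hmax : ∀ c, a < c → c < x → ¬ y < p c) :
    (∀ j, splitFun a x y p (splitFun a x y p j) = j) ∧ (∀ j, splitFun a x y p j ≠ j) ∧
      ∀ c d, c < d → d < splitFun a x y p c → splitFun a x y p d < splitFun a x y p c := by
  have hpy : p y = x := by rw [← hp, h1]
  have hinj : ∀ a b, p a = p b → a = b := fun a b h => by rw [← h1 a, h, h1]
  have n1 : x ≠ y := fun e => by rw [e] at hxy; omega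
  have n2 : a ≠ y := fun e => by rw [Fin.lt_def] at ha; rw [e] at ha; omega
  have n3 : p a ≠ x := fun e => by rw [Fin.lt_def, e] at hb; omega
  refine ⟨fun j => ?_, fun j => ?_, ?_⟩
  · clear h2 h3 hmax
    grind [splitFun]
  · clear h3 hmax
    grind [splitFun]
  intro c d hcd hd
  have k1 : ∀ a b, a < b → b < p a → a < p b := by
    intro a b hab hba
    rcases lt_trichotomy (p b) a with h | h | h
    · have := h3 (p b) a h (by rw [h1]; exact hab)
      rw [h1] at this
      exact absurd hba (not_lt.2 this.le)
    · exact absurd hba (by rw [← h, h1]; exact lt_irrefl _)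
    · exact h
  have a1 := h3 c d hcd
  have a2 := k1 c d hcd
  have a3 := h3 a d
  have a4 := k1 a d
  have a5 := h3 c a
  have a6 := h3 c x
  have a7 := hmax c
  have a8 := hmax d
  have b1 : p d = x → d = y := fun e => by rw [← e, h1] at hp; exact hp
  have b2 : p d = y → d = x := fun e => hinj _ _ (by rw [e, hp])
  have b3 : d = x → p d = y := fun e => by rw [e, hp]
  have b4 : d = p a → p d = a := fun e => by rw [e, h1]
  have b5 : c = x → p c = y := fun e => by rw [e, hp]
  have b6 : c = p a → p c = a := fun e => by rw [e, h1]
  have b7 : p c = x → c = y := fun e => by rw [← e, h1] at hp; exact hp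
  have b8 : p c = y → c = x := fun e => hinj _ _ (by rw [e, hp])
  have b9 : p c = a → c = p a := fun e => by rw [← e, h1]
  clear h1 h2 h3 hmax k1 hinj
  simp only [splitFun] at hd ⊢
  simp only [Fin.lt_def, Fin.ext_iff, ne_eq] at *
  split_ifs at hd ⊢ <;> omega

/-- Every path that ends at height zero and never goes below zero is the path of a link pattern. -/
theorem exists_up_eq {n : ℕ} (S : QKZ.Config (2 * n)) (h0 : QKZ.ht S (2 * n) = 0)
    (hS : ∀ k ≤ 2 * n, 0 ≤ QKZ.ht S k) : ∃ p : LinkPattern (2 * n), p.up = S := by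
  have main := QKZ.config_induction (N := 2 * n) (m := n)
    (P := fun S => (∀ k ≤ 2 * n, 0 ≤ QKZ.ht S k) → ∃ p : LinkPattern (2 * n), p.up = S)
    (fun _ => ⟨rainbow n, rainbow_up n⟩) ?_ S (by rw [h0]; push_cast; ring)
  · exact main hS
  intro S i hi _ s0 s1 ih hS
  obtain ⟨r, hr⟩ := ih fun k hk => by
    by_cases hki : k = i + 1
    · subst hki
      have e1 := QKZ.ht_succ (S ∘ QKZ.adj i hi) ⟨i, by omega⟩
      simp only [Function.comp, Equiv.swap_apply_left, s1, if_true] at e1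
      have e2 := QKZ.ht_comp_adj S i hi i (by omega)
      have e3 := hS i (by omega)
      rw [e2] at e1
      change 0 ≤ QKZ.ht (S ∘ QKZ.adj i hi) (i + 1)
      change QKZ.ht (S ∘ QKZ.adj i hi) (i + 1) = _ at e1
      omega
    · rw [QKZ.ht_comp_adj S i hi k hki]; exact hS k hk
  set x : Fin (2 * n) := ⟨i, by omega⟩ with hx
  set y : Fin (2 * n) := ⟨i + 1, hi⟩ with hy
  have rx : x < r.1 x := by
    rw [← r.up_eq_true, hr]
    simpa only [Function.comp, QKZ.adj, hx, Equiv.swap_apply_left] using s1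
  have ry : r.1 y < y := by
    rw [← r.up_eq_false, hr]
    simpa only [Function.comp, QKZ.adj, hy, Equiv.swap_apply_right] using s0
  have rxy : r.1 x = y := by
    by_contra hne
    have h1 : y < r.1 x := by
      rw [Fin.lt_def] at *; have : (r.1 x).val ≠ y.val := fun e => hne (Fin.ext e)
      simp only [hx, hy] at *; omega
    have h2 := r.nested (a := x) (b := y) (by rw [Fin.lt_def]; simp [hx, hy]) h1
    rw [Fin.lt_def] at *; simp only [hx, hy] at *; omega
  have ryx : r.1 y = x := by rw [← rxy, r.invol]
  have hpos : 1 ≤ QKZ.ht S i := by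
    have e1 := QKZ.ht_succ S x
    have := hS (i + 1) (by omega)
    rw [s0] at e1
    simp only [hx, Bool.false_eq_true, if_false] at e1
    omega
  -- The arch closest to the little arch among those that enclose it.
  have hex : ∃ a, a < x ∧ y < r.1 a := by
    by_contra hc
    push Not at hc
    have e := r.compatible_up.sum_eq_zero (fun j => j.val < i) ?_
    · have : QKZ.ht r.up i = 0 := e
      rw [hr, QKZ.ht_comp_adj S i hi i (by omega)] at this
      omega
    · have : ∀ j : Fin (2 * n), j.val < i → (r.1 j).val < i := by
        intro j hj
        have h1 := hc j (by rw [Fin.lt_def]; exact hj)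
        have h2 : r.1 j ≠ x := fun e => by
          rw [← ryx] at e; have := r.inj e; rw [this] at hj; simp [hy] at hj
        have h3 : r.1 j ≠ y := fun e => by
          rw [← rxy] at e; have := r.inj e; rw [this] at hj; simp [hx] at hj
        rw [Fin.le_def] at h1
        have h2' : (r.1 j).val ≠ i := fun e => h2 (Fin.ext e)
        have h3' : (r.1 j).val ≠ i + 1 := fun e => h3 (Fin.ext e)
        simp only [hy] at h1
        omega
      intro j
      exact ⟨fun h => by have := this _ h; rwa [r.invol] at this, this j⟩
  obtain ⟨a, ⟨ha1, ha2⟩, hmax⟩ : ∃ a, (a < x ∧ y < r.1 a) ∧ ∀ c, a < c → c < x → ¬ y < r.1 c := by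
    let T : Finset (Fin (2 * n)) := {a | a < x ∧ y < r.1 a}
    have hT : T.Nonempty := by obtain ⟨a, ha⟩ := hex; exact ⟨a, by simpa [T] using ha⟩
    refine ⟨T.max' hT, by simpa [T] using T.max'_mem hT, fun c h1 h2 h3 => ?_⟩
    exact absurd (T.le_max' c (by simp [T, h2, h3])) (not_le.2 h1)
  have hxy : x.val + 1 = y.val := by simp [hx, hy]
  obtain ⟨g1, g2, g3⟩ := splitFun_spec r.1 r.2.1 r.2.2.1 r.2.2.2 ha1 hxy rxy ha2 hmax
  refine ⟨⟨splitFun a x y r.1, g1, g2, g3⟩, ?_⟩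
  have hS' : ∀ j, S j = r.up (QKZ.adj i hi j) := by
    intro j; rw [hr]; simp [QKZ.adj]
  have hfar : ∀ j, j ≠ x → j ≠ y → S j = r.up j := by
    intro j h1 h2
    rw [hS', QKZ.adj, Equiv.swap_apply_of_ne_of_ne h1 h2]
  funext j
  change decide (j < splitFun a x y r.1 j) = S j
  simp only [splitFun]
  split_ifs with h1 h2 h3 h4
  · rw [hfar j (by rw [h1]; exact ha1.ne) (by rw [h1, Fin.ne_iff_vne]; rw [Fin.lt_def] at ha1; omega),
      h1, r.up_eq_true.2 (lt_trans (lt_trans ha1 (by rw [Fin.lt_def]; omega)) ha2)]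
    simpa using ha1
  · rw [h2, s0]; simp [ha1.le]
  · rw [hfar j (by rw [h3]; exact (lt_trans (by rw [Fin.lt_def]; omega) ha2).ne')
        (by rw [h3]; exact ha2.ne'), h3, r.up_eq_false.2]
    · simp [ha2.le]
    · rw [r.invol]; exact lt_trans (lt_trans ha1 (by rw [Fin.lt_def]; omega)) ha2
  · rw [h4, s1]; simpa using ha2
  · rw [hfar j h2 h4]; rfl

end LinkPattern

/-! ### Link patterns as spin vectors -/

namespace LinkPattern

variable {N : ℕ} {R : Type*} [CommRing R]

/-- The coefficient at the spin configuration `S` of the spin vector of the link pattern `p`: the sum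
over the orientations of the arches, an arch with its up step on the right having weight `-x`. -/
def iota (x : R) (p : LinkPattern N) (S : QKZ.Config N) : R :=
  ∏ j, if S (p.1 j) = S j then 0 else if S j = true ∧ p.1 j < j then -x else 1

variable {x : R} {p : LinkPattern N} {S : QKZ.Config N}

theorem compatible_of_iota_ne_zero (h : iota x p S ≠ 0) : p.Compatible S := by
  intro j
  by_contra hj
  refine h (Finset.prod_eq_zero (mem_univ j) ?_)
  rw [if_pos]
  cases h1 : S (p.1 j) <;> cases h2 : S j <;> simp_all

theorem iota_up (x : R) (p : LinkPattern N) : iota x p p.up = 1 := by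
  refine Finset.prod_eq_one fun j _ => ?_
  rw [p.compatible_up j]
  have : ¬ (p.up j = true ∧ p.1 j < j) := by
    rintro ⟨h1, h2⟩
    rw [p.up_eq_true] at h1
    exact absurd h1 (not_lt.2 h2.le)
  rw [if_neg (by simp), if_neg this]

theorem map_iota {R' : Type*} [CommRing R'] (f : R →+* R') : f (iota x p S) = iota (f x) p S := by
  simp only [iota, map_prod]
  refine Finset.prod_congr rfl fun j _ => ?_
  split_ifs <;> simp

/-- The rank of a link pattern: the number of boxes below its Dyck path, up to normalization. -/
def rank (p : LinkPattern N) : ℕ := ∑ k ∈ range (N + 1), openings p k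

/-- The spin vectors of link patterns are unitriangular with respect to the rank. -/
theorem rank_lt_of_iota_ne_zero {s : LinkPattern N} (h : iota x p s.up ≠ 0) (hne : p ≠ s) :
    rank s < rank p := by
  have h1 : ∀ k, openings s k ≤ openings p k := by
    intro k
    rw [openings_eq s]
    exact (compatible_of_iota_ne_zero h).card_le_openings k
  refine Finset.sum_lt_sum (fun k _ => h1 k) ?_
  by_contra hc
  push Not at hc
  refine hne (eq_of_openings_eq fun k => ?_)
  have h2 : ∀ k ≤ N, openings p k = openings s k := fun k hk =>
    le_antisymm (hc k (by simpa using Nat.lt_succ_of_le hk)) (h1 k)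
  rcases le_or_gt k N with hk | hk
  · exact h2 k hk
  · have h3 : ∀ p : LinkPattern N, openings p k = openings p N := by
      intro p
      simp only [openings]
      congr 1
      ext j
      have := j.2
      simp only [mem_filter, mem_univ, true_and]
      refine and_congr_left fun _ => by omega
    rw [h3, h3, h2 N le_rfl]

/-- The effect of reversing the orientation of an arch. -/
theorem iota_flip {S' : QKZ.Config N} {a b : Fin N} (hab : a < b) (hp : p.1 a = b)
    (h0 : S a = true) (h1 : S b = false) (e0 : S' a = false) (e1 : S' b = true)
    (hS : ∀ j, j ≠ a → j ≠ b → S' j = S j) : iota x p S' = -x * iota x p S := by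
  have hpb : p.1 b = a := by rw [← hp, invol]
  simp only [iota]
  rw [← Finset.mul_prod_erase univ _ (mem_univ a), ← Finset.mul_prod_erase univ _ (mem_univ a),
    ← Finset.mul_prod_erase (univ.erase a) _ (show b ∈ univ.erase a by simp [hab.ne']),
    ← Finset.mul_prod_erase (univ.erase a) _ (show b ∈ univ.erase a by simp [hab.ne'])]
  rw [hp, hpb, h0, h1, e0, e1]
  simp only [reduceCtorEq, if_false, false_and, hab, hab.not_gt, and_self, and_false, if_true, one_mul]
  congr 1
  refine Finset.prod_congr rfl fun j hj => ?_
  simp only [mem_erase, mem_univ, and_true] at hj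
  rw [hS j hj.2 hj.1, hS (p.1 j)]
  · intro e; exact hj.1 (p.inj (e.trans hpb.symm))
  · intro e; exact hj.2 (p.inj (e.trans hp.symm))

theorem iota_comp_adj_of_arch (i : ℕ) (hi : i + 1 < N) (hp : p.1 ⟨i, by omega⟩ = ⟨i + 1, hi⟩)
    (h0 : S ⟨i, by omega⟩ = true) (h1 : S ⟨i + 1, hi⟩ = false) :
    iota x p (S ∘ QKZ.adj i hi) = -x * iota x p S := by
  refine iota_flip (by rw [Fin.lt_def]; simp) hp h0 h1 (by simpa using h1) (by simpa using h0) ?_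
  intro j h1 h2
  simp only [Function.comp, QKZ.adj]
  rw [Equiv.swap_apply_of_ne_of_ne h1 h2]

theorem connect_of_arch {p : LinkPattern N} (i : ℕ) (hi : i + 1 < N) (hp : p.1 ⟨i, by omega⟩ = ⟨i + 1, hi⟩) :
    p.connect i hi = p := by
  apply Subtype.ext
  funext j
  change connectFun _ _ p.1 j = _
  have h2 : p.1 ⟨i + 1, hi⟩ = ⟨i, by omega⟩ := by rw [← hp, p.invol]
  rw [connectFun, hp, h2]
  split_ifs with h3 h4
  · rw [h3, hp]
  · rw [h4, h2]
  · rfl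

/-- Joining two arches by the Temperley--Lieb generator, at a configuration that orients the new
little arch to the left. -/
theorem iota_connect_of_not_arch {y : R} (hxy : y * x = 1) (i : ℕ) (hi : i + 1 < N)
    (hp : p.1 ⟨i, by omega⟩ ≠ ⟨i + 1, hi⟩)
    (h0 : S ⟨i, by omega⟩ = true) (h1 : S ⟨i + 1, hi⟩ = false) :
    iota x (p.connect i hi) S = -y * iota x p S + iota x p (S ∘ QKZ.adj i hi) := by
  set u : Fin N := ⟨i, by omega⟩ with hu
  set v : Fin N := ⟨i + 1, hi⟩ with hv
  have huv' : u.val + 1 = v.val := by simp [hu, hv]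
  have huv : u < v := by rw [Fin.lt_def]; omega
  obtain ⟨a, ha⟩ : ∃ a, p.1 u = a := ⟨_, rfl⟩
  obtain ⟨b, hb⟩ : ∃ b, p.1 v = b := ⟨_, rfl⟩
  have ha' : p.1 a = u := by rw [← ha, invol]
  have hb' : p.1 b = v := by rw [← hb, invol]
  have n1 : a ≠ u := fun e => p.apply_ne u (by rw [ha, e])
  have n2 : b ≠ v := fun e => p.apply_ne v (by rw [hb, e])
  have n3 : a ≠ v := fun e => hp (by rw [ha, e])
  have n4 : b ≠ u := fun e => by rw [e, ha] at hb'; exact n3 hb'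
  have n5 : a ≠ b := fun e => by rw [e, hb'] at ha'; exact huv.ne' ha'
  have c1 : (p.connect i hi).1 u = v := connect_left i hi
  have c2 : (p.connect i hi).1 v = u := connect_right i hi
  have c3 : (p.connect i hi).1 a = b := by
    change connectFun u v p.1 a = b
    simp [connectFun, n1, n3, ha, hb]
  have c4 : (p.connect i hi).1 b = a := by rw [← c3, invol]
  have c5 : ∀ j, j ≠ u → j ≠ v → j ≠ a → j ≠ b → (p.connect i hi).1 j = p.1 j := by
    intro j j1 j2 j3 j4
    change connectFun u v p.1 j = _
    simp [connectFun, j1, j2, ha, hb, j3, j4]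
  have hS : ∀ j, j ≠ u → j ≠ v → (S ∘ QKZ.adj i hi) j = S j := by
    intro j h1 h2
    simp only [Function.comp, QKZ.adj]
    rw [Equiv.swap_apply_of_ne_of_ne h1 h2]
  have e0 : (S ∘ QKZ.adj i hi) u = false := by
    simp only [Function.comp, QKZ.adj, hu, Equiv.swap_apply_left]; exact h1
  have e1 : (S ∘ QKZ.adj i hi) v = true := by
    simp only [Function.comp, QKZ.adj, hv, Equiv.swap_apply_right]; exact h0
  generalize S ∘ QKZ.adj i hi = S' at *
  generalize p.connect i hi = r at *
  have hsplit : ∀ f : Fin N → R, ∏ j, f j =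
      f u * (f v * (f a * (f b * ∏ j ∈ (((univ.erase u).erase v).erase a).erase b, f j))) := by
    intro f
    rw [← Finset.mul_prod_erase univ f (mem_univ u),
      ← Finset.mul_prod_erase (univ.erase u) f (a := v) (by simp [huv.ne']),
      ← Finset.mul_prod_erase ((univ.erase u).erase v) f (a := a) (by simp [n1, n3]),
      ← Finset.mul_prod_erase (((univ.erase u).erase v).erase a) f (a := b) (by simp [n2, n4, n5.symm])]
  have hrest : ∀ (p' : LinkPattern N) (T : QKZ.Config N),
      (∀ j, j ≠ u → j ≠ v → j ≠ a → j ≠ b → p'.1 j = p.1 j) →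
      (∀ j, j ≠ u → j ≠ v → T j = S j) →
      ∏ j ∈ (((univ.erase u).erase v).erase a).erase b,
        (if T (p'.1 j) = T j then 0 else if T j = true ∧ p'.1 j < j then -x else 1) =
      ∏ j ∈ (((univ.erase u).erase v).erase a).erase b,
        (if S (p.1 j) = S j then 0 else if S j = true ∧ p.1 j < j then -x else 1) := by
    intro p' T g1 g2
    refine Finset.prod_congr rfl fun j hj => ?_
    simp only [mem_erase, mem_univ, and_true] at hj
    obtain ⟨j4, j3, j2, j1⟩ := hj
    rw [g1 j j1 j2 j3 j4, g2 j j1 j2, g2 (p.1 j)]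
    · intro e; exact j3 (p.inj (e.trans ha'.symm))
    · intro e; exact j4 (p.inj (e.trans hb'.symm))
  simp only [iota]
  rw [hsplit, hsplit (fun j => if S (p.1 j) = S j then 0 else if S j = true ∧ p.1 j < j then -x else 1),
    hsplit (fun j => if S' (p.1 j) = S' j then 0 else if S' j = true ∧ p.1 j < j then -x else 1),
    hrest r S c5 (fun _ _ _ => rfl), hrest p S' (fun _ _ _ _ _ => rfl) hS]
  generalize ∏ j ∈ (((univ.erase u).erase v).erase a).erase b,
        (if S (p.1 j) = S j then 0 else if S j = true ∧ p.1 j < j then -x else 1) = Q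
  rw [c1, c2, c3, c4, ha, hb, ha', hb', h0, h1, e0, e1, hS a n1 n3, hS b n4 n2]
  have q1 := p.nested (a := u) (b := v) huv
  have q2 := p.nested (a := b) (b := u)
  have q3 := p.nested (a := a) (b := v)
  rw [ha, hb] at q1
  rw [ha, hb'] at q2
  rw [hb, ha'] at q3
  have hcases : (a < u ∧ v < b) ∨ (v < b ∧ b < a) ∨ (b < a ∧ a < u) := by
    simp only [Fin.lt_def, Fin.ext_iff, ne_eq] at *
    omega
  have hx : y * x * x = x := by rw [hxy, one_mul]
  rcases hcases with ⟨o1, o2⟩ | ⟨o1, o2⟩ | ⟨o1, o2⟩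
  · have o3 : b > u := huv.trans o2
    have o4 : a < v := o1.trans huv
    have o5 : a < b := o1.trans o3
    cases S a <;> cases S b <;>
      simp [huv, huv.not_gt, o1, o2, o5, o1.not_gt, o2.not_gt, o5.not_gt]
    linear_combination (- x * Q) * hxy
  · have o3 : u < b := huv.trans o1
    have o4 : v < a := o1.trans o2
    have o5 : u < a := huv.trans o4
    cases S a <;> cases S b <;>
      simp [huv, huv.not_gt, o1, o2, o5, o1.not_gt, o2.not_gt, o5.not_gt]
    linear_combination (- Q) * hxy
  · have o3 : b < u := o1.trans o2
    have o4 : b < v := o3.trans huv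
    have o5 : a < v := o2.trans huv
    cases S a <;> cases S b <;>
      simp [huv, huv.not_gt, o1, o2, o4, o1.not_gt, o2.not_gt, o4.not_gt]
    linear_combination (- Q) * hxy

/-- The image of the spin vector of `p` under the Temperley--Lieb generator `e_i`, at a configuration
with an up step at `i` and a down step at `i + 1`. -/
theorem iota_connect {y : R} (hxy : y * x = 1) (i : ℕ) (hi : i + 1 < N)
    (h0 : S ⟨i, by omega⟩ = true) (h1 : S ⟨i + 1, hi⟩ = false) :
    (if p.1 ⟨i, by omega⟩ = ⟨i + 1, hi⟩ then -(y + x) else 1) * iota x (p.connect i hi) S =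
      -y * iota x p S + iota x p (S ∘ QKZ.adj i hi) := by
  split_ifs with hp
  · rw [connect_of_arch i hi hp, iota_comp_adj_of_arch i hi hp h0 h1]
    ring
  · rw [one_mul, iota_connect_of_not_arch hxy i hi hp h0 h1]

/-- The same at a configuration with a down step at `i` and an up step at `i + 1`. -/
theorem iota_connect' {y : R} (hxy : y * x = 1) (i : ℕ) (hi : i + 1 < N)
    (h0 : S ⟨i, by omega⟩ = false) (h1 : S ⟨i + 1, hi⟩ = true) :
    (if p.1 ⟨i, by omega⟩ = ⟨i + 1, hi⟩ then -(y + x) else 1) * iota x (p.connect i hi) S =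
      iota x p (S ∘ QKZ.adj i hi) - x * iota x p S := by
  have hSS : (S ∘ QKZ.adj i hi) ∘ QKZ.adj i hi = S := by
    funext j; simp [QKZ.adj]
  have g0 : (S ∘ QKZ.adj i hi) ⟨i, by omega⟩ = true := by simpa using h1
  have g1 : (S ∘ QKZ.adj i hi) ⟨i + 1, hi⟩ = false := by simpa using h0
  have e := iota_connect (p := p) hxy i hi g0 g1
  have e2 := iota_comp_adj_of_arch (x := x) (p := p.connect i hi) i hi (connect_left i hi) g0 g1
  rw [hSS] at e e2
  rw [e2]
  linear_combination (-x) * e + iota x p (S ∘ QKZ.adj i hi) * hxy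

/-- The same at a configuration with equal steps at `i` and `i + 1`. -/
theorem iota_connect_of_eq (i : ℕ) (hi : i + 1 < N) (h : S ⟨i, by omega⟩ = S ⟨i + 1, hi⟩) :
    iota x (p.connect i hi) S = 0 := by
  by_contra hc
  have := compatible_of_iota_ne_zero hc ⟨i, by omega⟩
  rw [connect_left, ← h] at this
  exact absurd this (by simp)

/-- The sum `∑ₚ c p • iota x p s.up` determines the coefficients `c`, linearly. -/
theorem coeff_mem {M : Type*} [AddCommGroup M] [Module R M] (W : Submodule R M)
    (c : LinkPattern N → M) (h : ∀ s : LinkPattern N, ∑ p, iota x p s.up • c p ∈ W) :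
    ∀ s, c s ∈ W := by
  obtain ⟨B, hB⟩ : ∃ B, ∀ s : LinkPattern N, rank s ≤ B :=
    ⟨univ.sup rank, fun s => Finset.le_sup (mem_univ s)⟩
  intro s
  induction hk : B - rank s using Nat.strong_induction_on generalizing s with
  | _ k ih =>
    have h1 := h s
    rw [← Finset.add_sum_erase univ _ (mem_univ s), iota_up, one_smul] at h1
    refine (W.add_mem_iff_left (W.sum_mem fun r hr => ?_)).1 h1
    by_cases h0 : iota x r s.up = 0
    · rw [h0, zero_smul]; exact W.zero_mem
    · have := rank_lt_of_iota_ne_zero h0 (by simpa using hr)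
      have := hB r
      exact W.smul_mem _ (ih (B - rank r) (by omega) r rfl)

/-- Prescribed values on the Dyck paths are those of a linear combination of link patterns. -/
theorem exists_coeff (x : R) {M : Type*} [AddCommGroup M] [Module R M] (u : LinkPattern N → M) :
    ∃ c : LinkPattern N → M, ∀ s : LinkPattern N, ∑ p, iota x p s.up • c p = u s := by
  obtain ⟨B, hB⟩ : ∃ B, ∀ s : LinkPattern N, rank s ≤ B :=
    ⟨univ.sup rank, fun s => Finset.le_sup (mem_univ s)⟩
  have main : ∀ k : ℕ, ∃ c : LinkPattern N → M, ∀ s : LinkPattern N, B - rank s < k →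
      ∑ p, iota x p s.up • c p = u s := by
    intro k
    induction k with
    | zero => exact ⟨0, fun s hs => absurd hs (by omega)⟩
    | succ k ih =>
      obtain ⟨c, hc⟩ := ih
      refine ⟨fun r => if B - rank r = k then c r + (u r - ∑ p, iota x p r.up • c p) else c r,
        fun s hs => ?_⟩
      rcases Nat.lt_succ_iff_lt_or_eq.1 hs with hs | hs
      · rw [← hc s hs]
        refine Finset.sum_congr rfl fun r _ => ?_
        dsimp only
        split_ifs with hr
        · have : iota x r s.up = 0 := by
            by_contra h0
            have := rank_lt_of_iota_ne_zero h0 (by rintro rfl; omega)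
            omega
          rw [this, zero_smul, zero_smul]
        · rfl
      · rw [← Finset.add_sum_erase univ _ (mem_univ s), iota_up, one_smul]
        dsimp only
        rw [if_pos hs]
        have : ∑ r ∈ univ.erase s, iota x r s.up •
            (if B - rank r = k then c r + (u r - ∑ p, iota x p r.up • c p) else c r) =
            ∑ r ∈ univ.erase s, iota x r s.up • c r := by
          refine Finset.sum_congr rfl fun r hr => ?_
          by_cases h0 : iota x r s.up = 0
          · rw [h0, zero_smul, zero_smul]
          · have h1 := rank_lt_of_iota_ne_zero h0 (by simpa using hr)
            have h2 := hB r
            rw [if_neg (by omega)]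
        rw [this, ← Finset.add_sum_erase univ (fun p => iota x p s.up • c p) (mem_univ s), iota_up,
          one_smul]
        abel
  obtain ⟨c, hc⟩ := main (B + 1)
  exact ⟨c, fun s => hc s (by omega)⟩

end LinkPattern

namespace QKZ

variable {N : ℕ} {R : Type*} [CommRing R] {M : Type*} [AddCommGroup M] [Module R M]

/-- The raising operator of quantum `sl₂`: the component at `S` is a weighted sum of the components at
the configurations obtained from `S` by turning an up step into a down step. -/
def raising (q : Rˣ) (v : Config N → M) (S : Config N) : M :=
  ∑ j : Fin N, if S j then ((q ^ (-ht S j) : Rˣ) : R) • v (Function.update S j false) else 0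

theorem ht_eq_add_of_arch {p : LinkPattern N} {S S' : Config N} (hS' : p.Compatible S') {a b : Fin N}
    (hab : a < b) (hp : p.1 a = b) (ha : S a = true) (hS : ∀ j, j ≠ a → j ≠ b → S' j = S j) :
    ht S b.val = ht S a.val + 1 := by
  have hpb : p.1 b = a := by rw [← hp, p.invol]
  have h1 := hS'.sum_eq_zero (fun j => a < j ∧ j < b) ?_
  · have h2 : ∀ j : Fin N, (if j.val < b.val then (if S j then (1 : ℤ) else -1) else 0) =
        (if j.val < a.val then (if S j then (1 : ℤ) else -1) else 0) + (if j = a then 1 else 0) +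
        (if a < j ∧ j < b then (if S' j then (1 : ℤ) else -1) else 0) := by
      intro j
      rcases lt_trichotomy j a with h | h | h
      · have := h.trans hab
        simp [Fin.lt_def.1 h, Fin.lt_def.1 this, h.ne, h.not_gt]
      · subst h; simp [ha, hab]
      · by_cases hjb : j < b
        · simp [h.not_gt, h.ne', h, hjb, hS j h.ne' hjb.ne]
        · simp [h.not_gt, h.ne', hjb]
    rw [ht, Finset.sum_congr rfl fun j _ => h2 j, Finset.sum_add_distrib, Finset.sum_add_distrib, h1]
    simp [ht]
  · have : ∀ j, a < j ∧ j < b → a < p.1 j ∧ p.1 j < b := by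
      rintro j ⟨g1, g2⟩
      have := p.nested g1 (by rw [hp]; exact g2)
      rwa [hp] at this
    intro j
    exact ⟨fun h => by have := this _ h; rwa [p.invol] at this, this j⟩

/-- The spin vectors of link patterns are annihilated by the raising operator. -/
theorem raising_iota (q : Rˣ) (p : LinkPattern N) (S : Config N) :
    raising q (LinkPattern.iota ((q⁻¹ : Rˣ) : R) p) S = 0 := by
  by_cases hex : ∃ j, S j = true ∧ p.Compatible (Function.update S j false)
  · have hex' : ∃ a b, a < b ∧ p.1 a = b ∧ S a = true ∧ S b = true ∧
        p.Compatible (Function.update S b false) ∧ p.Compatible (Function.update S a false) := by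
      obtain ⟨j, hj, hc⟩ := hex
      have h1 : S (p.1 j) = true := by
        have := hc j
        rw [Function.update_of_ne (p.apply_ne j), Function.update_self] at this
        exact this
      have hc' : p.Compatible (Function.update S (p.1 j) false) := by
        intro l
        rcases eq_or_ne l j with rfl | hlj
        · rw [Function.update_self, Function.update_of_ne (p.apply_ne l).symm, hj]; rfl
        · rcases eq_or_ne l (p.1 j) with rfl | hlp
          · rw [p.invol, Function.update_self, Function.update_of_ne (p.apply_ne j).symm, hj]; rfl
          · have := hc l
            rw [Function.update_of_ne hlj, Function.update_of_ne] at this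
            · rw [Function.update_of_ne hlp, Function.update_of_ne, this]
              exact fun e => hlj (p.inj e)
            · intro e; exact hlp (by rw [← e, p.invol])
      rcases lt_or_gt_of_ne (p.apply_ne j) with h | h
      · exact ⟨p.1 j, j, h, p.invol j, h1, hj, hc, hc'⟩
      · exact ⟨j, p.1 j, h, rfl, hj, h1, hc', hc⟩
    obtain ⟨a, b, hab, hp, ha, hb, hcb, hca⟩ := hex'
    have hpb : p.1 b = a := by rw [← hp, p.invol]
    have hflip : LinkPattern.iota ((q⁻¹ : Rˣ) : R) p (Function.update S a false) =
        -((q⁻¹ : Rˣ) : R) * LinkPattern.iota ((q⁻¹ : Rˣ) : R) p (Function.update S b false) :=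
      LinkPattern.iota_flip hab hp (by rw [Function.update_of_ne hab.ne, ha]) (by simp) (by simp)
        (by rw [Function.update_of_ne hab.ne', hb])
        (fun j h1 h2 => by rw [Function.update_of_ne h1, Function.update_of_ne h2])
    have hht := ht_eq_add_of_arch (S := S) hcb hab hp ha fun j h1 h2 => by
      rw [Function.update_of_ne h2]
    rw [raising, ← Finset.add_sum_erase univ _ (mem_univ a),
      ← Finset.add_sum_erase (univ.erase a) _ (show b ∈ univ.erase a by simp [hab.ne']),
      Finset.sum_eq_zero, if_pos ha, if_pos hb, hflip, hht, add_zero]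
    · rw [neg_add, zpow_add, zpow_neg_one]
      simp only [smul_eq_mul, Units.val_mul]
      ring
    · intro j hj
      simp only [mem_erase, mem_univ, and_true] at hj
      split_ifs
      · by_contra h0
        have h1 := LinkPattern.compatible_of_iota_ne_zero (right_ne_zero_of_mul h0) a
        rw [hp, Function.update_of_ne (Ne.symm hj.1), Function.update_of_ne (Ne.symm hj.2), ha, hb] at h1
        exact absurd h1 (by simp)
      · rfl
  · refine Finset.sum_eq_zero fun j _ => ?_
    split_ifs with hj
    · by_contra h0
      exact hex ⟨j, hj, LinkPattern.compatible_of_iota_ne_zero (right_ne_zero_of_mul h0)⟩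
    · rfl

end QKZ

/-! ### Vectors annihilated by the raising operator, for an indeterminate `q` -/

namespace QKZ

variable {N : ℕ}

theorem ht_update (S : Config N) (j : Fin N) (b : Bool) (k : ℕ) :
    ht (Function.update S j b) k = ht S k + if j.val < k then
      (if b then 1 else -1) - (if S j then 1 else -1) else 0 := by
  have h : ∀ l : Fin N, (if l.val < k then (if Function.update S j b l then (1 : ℤ) else -1) else 0) =
      (if l.val < k then (if S l then 1 else -1) else 0) + if l = j then (if j.val < k then
      (if b then 1 else -1) - (if S j then 1 else -1) else 0) else 0 := by
    intro l
    rcases eq_or_ne l j with rfl | h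
    · rw [Function.update_self, if_pos rfl]; split_ifs <;> simp
    · rw [Function.update_of_ne h, if_neg h, add_zero]
  rw [ht, Finset.sum_congr rfl fun l _ => h l, Finset.sum_add_distrib]
  simp [ht]

theorem neg_le_ht (S : Config N) (k : ℕ) : -(N : ℤ) ≤ ht S k := by
  have : ∑ _j : Fin N, (-1 : ℤ) ≤ ht S k := by
    refine Finset.sum_le_sum fun j _ => ?_
    split_ifs <;> norm_num
  simpa using this

/-- A function on the paths that end at height zero vanishes if it does on the Dyck paths and if, for
each path ending at height two, the sum of its values at the paths obtained by turning around one of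
the lowest up steps is zero. -/
theorem eq_zero_of_lowest {n : ℕ} {M : Type*} [AddCommGroup M] (v : Config (2 * n) → M)
    (hv : ∀ (S : Config (2 * n)) (m : ℤ), ht S (2 * n) = 2 → (∀ j : Fin (2 * n), S j → m ≤ ht S j) →
      ∑ j : Fin (2 * n), (if S j ∧ ht S j = m then v (Function.update S j false) else 0) = 0)
    (hd : ∀ p : LinkPattern (2 * n), v p.up = 0) :
    ∀ S, ht S (2 * n) = 0 → v S = 0 := by
  have main : ∀ e : ℕ, e ≤ 2 * n → ∀ S : Config (2 * n), ht S (2 * n) = 0 →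
      (∃ l ≤ 2 * n, ht S l ≤ e - ((2 * n : ℕ) : ℤ) - 1) → v S = 0 := by
    intro e
    induction e with
    | zero =>
      rintro - S - ⟨l, -, h⟩
      have := neg_le_ht S l
      omega
    | succ e ih =>
      rintro he S hS ⟨l0, hl0, hl⟩
      by_cases hdeep : ∃ l ≤ 2 * n, ht S l ≤ e - ((2 * n : ℕ) : ℤ) - 1
      · exact ih (by omega) S hS hdeep
      push Not at hdeep
      -- The first time at which the path reaches its minimum.
      have hex : ∃ l, l ≤ 2 * n ∧ ht S l ≤ (e + 1 : ℕ) - ((2 * n : ℕ) : ℤ) - 1 := ⟨l0, hl0, hl⟩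
      obtain ⟨k, ⟨hk1, hk2⟩, hkmin⟩ : ∃ k, (k ≤ 2 * n ∧ ht S k ≤ (e + 1 : ℕ) - ((2 * n : ℕ) : ℤ) - 1) ∧
          ∀ l < k, ¬ (l ≤ 2 * n ∧ ht S l ≤ (e + 1 : ℕ) - ((2 * n : ℕ) : ℤ) - 1) :=
        ⟨Nat.find hex, Nat.find_spec hex, fun l => Nat.find_min hex⟩
      have hkpos : k ≠ 0 := by
        rintro rfl
        rw [ht_zero] at hk2
        push_cast at hk2
        omega
      obtain ⟨j', rfl⟩ := Nat.exists_eq_succ_of_ne_zero hkpos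
      set j : Fin (2 * n) := ⟨j', by omega⟩ with hj
      have hsucc := ht_succ S j
      have hprev := hkmin j' (Nat.lt_succ_self _)
      have hSj : S j = false := by
        by_contra h
        rw [if_pos (by simpa using h)] at hsucc
        have : ht S (j' + 1) = ht S j' + 1 := hsucc
        simp only [Nat.succ_eq_add_one] at hk2
        omega
      rw [hSj] at hsucc
      replace hsucc : ht S (j' + 1) = ht S j' - 1 := by simpa [hj, sub_eq_add_neg] using hsucc
      have hge := hdeep (j' + 1) hk1
      simp only [Nat.succ_eq_add_one] at hk2
      have hj0 : ht S j' = e - ((2 * n : ℕ) : ℤ) + 1 := by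
        have : ¬ ht S j' ≤ (e + 1 : ℕ) - ((2 * n : ℕ) : ℤ) - 1 := fun h => hprev ⟨by omega, h⟩
        push_cast at *
        omega
      have hup : ∀ k, ht (Function.update S j true) k = ht S k + if j' < k then 2 else 0 := by
        intro k
        rw [ht_update, hSj]
        simp [hj]
      have hrel := hv (Function.update S j true) (e - ((2 * n : ℕ) : ℤ) + 1)
        (by rw [hup, hS, if_pos (by omega)]; norm_num) ?_
      · rw [← Finset.add_sum_erase univ _ (mem_univ j), Finset.sum_eq_zero, add_zero, if_pos] at hrel
        · rw [Function.update_idem] at hrel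
          rwa [show Function.update S j false = S from by rw [← hSj, Function.update_eq_self]] at hrel
        · rw [hup]
          simp [hj, hj0]
        · intro l hl
          have hlj : l ≠ j := by simpa using hl
          have hlj' : l.val ≠ j' := fun e => hlj (Fin.ext e)
          split_ifs with hc
          · rw [Function.update_of_ne hlj, hup] at hc
            obtain ⟨hc1, hc2⟩ := hc
            -- Turning around an earlier up step at the same height lowers the minimum.
            have hlt : l.val < j' := by
              by_contra hlt
              rw [if_pos (by omega)] at hc2
              have := hdeep l.val l.2.le
              omega
            have hht : ∀ k, ht (Function.update (Function.update S j true) l false) k =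
                (ht S k + if j' < k then 2 else 0) + if l.val < k then -2 else 0 := by
              intro k
              rw [ht_update, hup, Function.update_of_ne hlj, hc1]
              simp
            refine ih (by omega) _ ?_ ⟨j', by omega, ?_⟩
            · rw [hht, hS, if_pos (by omega), if_pos l.2]; norm_num
            · rw [hht, if_neg (by omega), if_pos hlt, hj0]; omega
          · rfl
      · intro l hl
        rw [hup]
        rcases eq_or_ne l j with rfl | hlj
        · simp [hj, hj0]
        · have hlj' : l.val ≠ j' := fun e => hlj (Fin.ext e)
          rcases Nat.lt_or_ge l.val j' with h | h
          · have : ¬ ht S l ≤ (e + 1 : ℕ) - ((2 * n : ℕ) : ℤ) - 1 :=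
              fun h' => hkmin l.val (by omega) ⟨by omega, h'⟩
            rw [if_neg (by omega)]
            push_cast at this
            omega
          · rw [if_pos (by omega)]
            have := hdeep l.val l.2.le
            omega
  intro S hS
  by_cases hneg : ∃ l ≤ 2 * n, ht S l < 0
  · obtain ⟨l, h1, h2⟩ := hneg
    exact main (2 * n) le_rfl S hS ⟨l, h1, by omega⟩
  · push Not at hneg
    obtain ⟨p, rfl⟩ := LinkPattern.exists_up_eq S hS hneg
    exact hd p

/-- The indeterminate of the ring of Laurent polynomials, as a unit. -/
noncomputable def unitT (K : Type*) [CommRing K] : (LaurentPolynomial K)ˣ :=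
  ⟨LaurentPolynomial.T 1, LaurentPolynomial.T (-1), by
    rw [← LaurentPolynomial.T_add, add_neg_cancel, LaurentPolynomial.T_zero], by
    rw [← LaurentPolynomial.T_add, neg_add_cancel, LaurentPolynomial.T_zero]⟩

theorem coe_unitT_zpow (K : Type*) [CommRing K] (m : ℤ) :
    ((unitT K ^ m : (LaurentPolynomial K)ˣ) : LaurentPolynomial K) = LaurentPolynomial.T m := by
  have hn : ∀ m : ℕ, ((unitT K ^ m : (LaurentPolynomial K)ˣ) : LaurentPolynomial K) =
      LaurentPolynomial.T m := by
    intro m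
    rw [Units.val_pow_eq_pow_val]
    simp [unitT, LaurentPolynomial.T_pow]
  have hn' : ∀ m : ℕ, (((unitT K)⁻¹ ^ m : (LaurentPolynomial K)ˣ) : LaurentPolynomial K) =
      LaurentPolynomial.T (-m) := by
    intro m
    rw [Units.val_pow_eq_pow_val]
    simp [unitT, LaurentPolynomial.T_pow]
  cases m with
  | ofNat m => simpa using hn m
  | negSucc m => rw [zpow_negSucc, ← inv_pow, hn']; rfl

theorem coeff_T_mul {K : Type*} [CommRing K] (m d : ℤ) (f : LaurentPolynomial K) :
    (LaurentPolynomial.T m * f).coeff d = f.coeff (d - m) := by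
  rw [LaurentPolynomial.T, AddMonoidAlgebra.coeff_single_mul_apply, one_mul]
  congr 1
  ring

/-- For an indeterminate `q`, a vector annihilated by the raising operator is determined by its
components at the Dyck paths. The components of highest degree satisfy `eq_zero_of_lowest`. -/
theorem eq_zero_of_raising_eq_zero {n : ℕ} {K : Type*} [CommRing K]
    (v : Config (2 * n) → LaurentPolynomial K)
    (hv : ∀ S, ht S (2 * n) = 2 → raising (unitT K) v S = 0)
    (hd : ∀ p : LinkPattern (2 * n), v p.up = 0) :
    ∀ S, ht S (2 * n) = 0 → v S = 0 := by
  by_contra hne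
  push Not at hne
  obtain ⟨S0, hS0, hS0'⟩ := hne
  let D : Finset ℤ := ({S : Config (2 * n) | ht S (2 * n) = 0} : Finset _).biUnion
    fun S => (v S).coeff.support
  have hmem : ∀ d, d ∈ D ↔ ∃ S, ht S (2 * n) = 0 ∧ (v S).coeff d ≠ 0 := by
    intro d; simp [D]
  have hD : D.Nonempty := by
    by_contra hD
    rw [Finset.not_nonempty_iff_eq_empty] at hD
    refine hS0' (LaurentPolynomial.ext fun d => ?_)
    by_contra hc
    have := (hmem d).2 ⟨S0, hS0, hc⟩
    rw [hD] at this
    exact absurd this (by simp)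
  obtain ⟨S1, h1, h1'⟩ := (hmem _).1 (D.max'_mem hD)
  have hbig : ∀ d, D.max' hD < d → ∀ S, ht S (2 * n) = 0 → (v S).coeff d = 0 := by
    intro d hd S hS
    by_contra hc
    exact absurd (D.le_max' d ((hmem d).2 ⟨S, hS, hc⟩)) (not_le.2 hd)
  generalize D.max' hD = d at *
  refine h1' (eq_zero_of_lowest (fun S => (v S).coeff d) ?_ (fun p => by simp [hd p]) S1 h1)
  intro S m hS hm
  have h := congrArg (fun f => f.coeff (d - m)) (hv S hS)
  simp only [raising, coe_unitT_zpow, AddMonoidAlgebra.coeff_sum, Finsupp.coe_finsetSum,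
    Finset.sum_apply, AddMonoidAlgebra.coeff_zero, Finsupp.coe_zero, Pi.zero_apply] at h
  refine Eq.trans ?_ h
  refine Finset.sum_congr rfl fun j _ => ?_
  by_cases hj : S j = true
  · rw [if_pos hj, smul_eq_mul, coeff_T_mul]
    split_ifs with hc
    · rw [hc.2]; congr 1; ring
    · have hlt : m < ht S j := lt_of_le_of_ne (hm j hj) fun e => hc ⟨hj, e.symm⟩
      rw [hbig _ (by omega)]
      rw [ht_update, hS, hj]
      simp
  · simp [hj]

end QKZ

/-! ### Demazure--Lusztig operators and the spin solution of the exchange relations -/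

namespace QKZ

variable {N : ℕ} {R : Type*} [CommRing R]

/-- The points at which the operators below are evaluated: the coordinates of the generic point. -/
noncomputable def gen (N : ℕ) (R : Type*) [CommRing R] (j : Fin N) :
    FractionRing (MvPolynomial (Fin N) R) :=
  algebraMap (MvPolynomial (Fin N) R) _ (X j)

theorem aeval_gen (f : MvPolynomial (Fin N) R) :
    aeval (gen N R) f = algebraMap _ (FractionRing (MvPolynomial (Fin N) R)) f := by
  have : (aeval (gen N R) : MvPolynomial (Fin N) R →ₐ[R] _) =
      IsScalarTower.toAlgHom R (MvPolynomial (Fin N) R) (FractionRing (MvPolynomial (Fin N) R)) := by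
    ext j; simp [gen]
  rw [this]; rfl

theorem eq_of_aeval_gen {f g : MvPolynomial (Fin N) R} (h : aeval (gen N R) f = aeval (gen N R) g) :
    f = g := by
  rw [aeval_gen, aeval_gen] at h
  exact IsFractionRing.injective _ _ h

theorem gen_injective [Nontrivial R] : Function.Injective (gen N R) := fun _ _ h =>
  X_injective (IsFractionRing.injective _ _ h)

theorem X_sub_X_dvd_rename_sub (i : ℕ) (hi : i + 1 < N) (f : MvPolynomial (Fin N) R) :
    (X ⟨i + 1, hi⟩ - X ⟨i, by omega⟩ : MvPolynomial (Fin N) R) ∣ rename (adj i hi) f - f := by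
  induction f using MvPolynomial.induction_on with
  | C a => simp
  | add f g hf hg =>
    rw [map_add, add_sub_add_comm]; exact dvd_add hf hg
  | mul_X f j hf =>
    have : rename (adj i hi) (f * X j) - f * X j =
        (rename (adj i hi) f - f) * X (adj i hi j) + f * (X (adj i hi j) - X j) := by
      rw [map_mul, rename_X]; ring
    rw [this]
    refine dvd_add (dvd_mul_of_dvd_left hf _) (dvd_mul_of_dvd_right ?_ _)
    rcases eq_or_ne j ⟨i, by omega⟩ with h | h
    · rw [h, Equiv.swap_apply_left]
    · rcases eq_or_ne j ⟨i + 1, hi⟩ with h' | h'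
      · rw [h', Equiv.swap_apply_right, dvd_sub_comm]
      · rw [adj, Equiv.swap_apply_of_ne_of_ne h h', sub_self]; exact dvd_zero _

theorem exists_demazure (q : Rˣ) (i : ℕ) (hi : i + 1 < N) (f : MvPolynomial (Fin N) R) :
    ∃ g, (X ⟨i + 1, hi⟩ - X ⟨i, by omega⟩) * g =
      (C (q : R) * X ⟨i, by omega⟩ - C ((q⁻¹ : Rˣ) : R) * X ⟨i + 1, hi⟩) * rename (adj i hi) f +
        (C ((q⁻¹ : Rˣ) : R) - C (q : R)) * X ⟨i, by omega⟩ * f := by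
  obtain ⟨g, hg⟩ := X_sub_X_dvd_rename_sub i hi f
  refine ⟨(C (q : R) * X ⟨i, by omega⟩ - C ((q⁻¹ : Rˣ) : R) * X ⟨i + 1, hi⟩) * g -
    C ((q⁻¹ : Rˣ) : R) * f, ?_⟩
  have : rename (adj i hi) f = f + (X ⟨i + 1, hi⟩ - X ⟨i, by omega⟩) * g := by
    linear_combination hg
  rw [this]; ring

/-- The Demazure--Lusztig operator
`f ↦ ((q w_i - q⁻¹ w_{i+1}) τ_i f + (q⁻¹ - q) w_i f) / (w_{i+1} - w_i)` on polynomials; these operators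
satisfy the relations of the Hecke algebra of type `A` with eigenvalues `q` and `-q⁻¹`. -/
noncomputable def demazure (q : Rˣ) (i : ℕ) (hi : i + 1 < N) (f : MvPolynomial (Fin N) R) :
    MvPolynomial (Fin N) R :=
  (exists_demazure q i hi f).choose

theorem demazure_spec (q : Rˣ) (i : ℕ) (hi : i + 1 < N) (f : MvPolynomial (Fin N) R) :
    (X ⟨i + 1, hi⟩ - X ⟨i, by omega⟩) * demazure q i hi f =
      (C (q : R) * X ⟨i, by omega⟩ - C ((q⁻¹ : Rˣ) : R) * X ⟨i + 1, hi⟩) * rename (adj i hi) f +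
        (C ((q⁻¹ : Rˣ) : R) - C (q : R)) * X ⟨i, by omega⟩ * f :=
  (exists_demazure q i hi f).choose_spec

theorem X_sub_X_ne_zero [Nontrivial R] (i : ℕ) (hi : i + 1 < N) :
    (X ⟨i + 1, hi⟩ - X ⟨i, by omega⟩ : MvPolynomial (Fin N) R) ≠ 0 := by
  rw [sub_ne_zero]
  intro h
  have := X_injective h
  simp at this

section Field

variable {F : Type*} [Field F] [Algebra R F]

theorem aeval_demazure (q : Rˣ) (i : ℕ) (hi : i + 1 < N) (f : MvPolynomial (Fin N) R)
    (x : Fin N → F) (hx : x ⟨i, by omega⟩ ≠ x ⟨i + 1, hi⟩) :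
    aeval x (demazure q i hi f) =
      ((algebraMap R F q * x ⟨i, by omega⟩ - algebraMap R F (q⁻¹ : Rˣ) * x ⟨i + 1, hi⟩) *
        aeval (x ∘ adj i hi) f +
      (algebraMap R F (q⁻¹ : Rˣ) - algebraMap R F q) * x ⟨i, by omega⟩ * aeval x f) /
        (x ⟨i + 1, hi⟩ - x ⟨i, by omega⟩) := by
  rw [eq_div_iff (sub_ne_zero.2 hx.symm), mul_comm]
  have := congrArg (aeval x) (demazure_spec q i hi f)
  simpa [aeval_rename] using this

end Field

variable [IsDomain R]

theorem demazure_eq_iff (q : Rˣ) (i : ℕ) (hi : i + 1 < N) (f g : MvPolynomial (Fin N) R) :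
    demazure q i hi f = g ↔ (X ⟨i + 1, hi⟩ - X ⟨i, by omega⟩) * g =
      (C (q : R) * X ⟨i, by omega⟩ - C ((q⁻¹ : Rˣ) : R) * X ⟨i + 1, hi⟩) * rename (adj i hi) f +
        (C ((q⁻¹ : Rˣ) : R) - C (q : R)) * X ⟨i, by omega⟩ * f := by
  rw [← demazure_spec]
  constructor
  · rintro rfl; rfl
  · intro h; exact (mul_left_cancel₀ (X_sub_X_ne_zero i hi) h).symm

theorem demazure_eq_q_iff (q : Rˣ) (i : ℕ) (hi : i + 1 < N) (f : MvPolynomial (Fin N) R) :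
    demazure q i hi f = C (q : R) * f ↔
      (C (q : R) * X ⟨i, by omega⟩ - C ((q⁻¹ : Rˣ) : R) * X ⟨i + 1, hi⟩) * rename (adj i hi) f =
      (C (q : R) * X ⟨i + 1, hi⟩ - C ((q⁻¹ : Rˣ) : R) * X ⟨i, by omega⟩) * f := by
  rw [demazure_eq_iff]
  constructor
  · intro h; linear_combination -h
  · intro h; linear_combination -h

theorem demazure_C_mul (q : Rˣ) (i : ℕ) (hi : i + 1 < N) (a : R) (f : MvPolynomial (Fin N) R) :
    demazure q i hi (C a * f) = C a * demazure q i hi f := by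
  rw [demazure_eq_iff, map_mul, rename_C]
  linear_combination C a * demazure_spec q i hi f

theorem demazure_zero (q : Rˣ) (i : ℕ) (hi : i + 1 < N) :
    demazure q i hi (0 : MvPolynomial (Fin N) R) = 0 := by
  rw [demazure_eq_iff]; simp

theorem adj_apply_mk (i : ℕ) (hi : i + 1 < N) (k : ℕ) (hk : k < N) :
    adj i hi ⟨k, hk⟩ = if k = i then ⟨i + 1, hi⟩ else if k = i + 1 then ⟨i, by omega⟩ else ⟨k, hk⟩ := by
  simp [adj, Equiv.swap_apply_def, Fin.ext_iff]

theorem demazure_comm (q : Rˣ) (i j : ℕ) (hi : i + 1 < N) (hj : j + 1 < N) (hij : i + 1 < j)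
    (f : MvPolynomial (Fin N) R) :
    demazure q i hi (demazure q j hj f) = demazure q j hj (demazure q i hi f) := by
  apply eq_of_aeval_gen
  have hx : Function.Injective (gen N R) := gen_injective
  generalize gen N R = x at *
  have ne : ∀ a b : Fin N, a ≠ b → x a ≠ x b := fun a b h e => h (hx e)
  have e1 : (x ∘ adj i hi) ∘ adj j hj = (x ∘ adj j hj) ∘ adj i hi := by
    funext ⟨k, hk⟩
    simp only [Function.comp, adj_apply_mk]
    congr 1
    split_ifs <;> simp only [adj_apply_mk] <;> split_ifs <;>
      simp only [Fin.mk.injEq] <;> omega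
  have d1 : x ⟨i, by omega⟩ ≠ x ⟨i + 1, hi⟩ := ne _ _ (by simp)
  have d2 : x ⟨j, by omega⟩ ≠ x ⟨j + 1, hj⟩ := ne _ _ (by simp)
  have v1 : (x ∘ adj i hi) ⟨j, by omega⟩ = x ⟨j, by omega⟩ := by
    simp only [Function.comp, adj_apply_mk]
    rw [if_neg (by omega), if_neg (by omega)]
  have v2 : (x ∘ adj i hi) ⟨j + 1, hj⟩ = x ⟨j + 1, hj⟩ := by
    simp only [Function.comp, adj_apply_mk]
    rw [if_neg (by omega), if_neg (by omega)]
  have v3 : (x ∘ adj j hj) ⟨i, by omega⟩ = x ⟨i, by omega⟩ := by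
    simp only [Function.comp, adj_apply_mk]
    rw [if_neg (by omega), if_neg (by omega)]
  have v4 : (x ∘ adj j hj) ⟨i + 1, hi⟩ = x ⟨i + 1, hi⟩ := by
    simp only [Function.comp, adj_apply_mk]
    rw [if_neg (by omega), if_neg (by omega)]
  rw [aeval_demazure q i hi _ x d1, aeval_demazure q j hj _ x d2, aeval_demazure q j hj _ x d2,
    aeval_demazure q i hi _ x d1, aeval_demazure q j hj _ _ (by rwa [v1, v2]),
    aeval_demazure q i hi _ _ (by rwa [v3, v4]), e1, v1, v2, v3, v4]
  generalize aeval ((x ∘ adj j hj) ∘ adj i hi) f = f1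
  generalize aeval (x ∘ adj j hj) f = f2
  generalize aeval (x ∘ adj i hi) f = f3
  generalize aeval x f = f4
  ring

theorem demazure_braid (q : Rˣ) (i : ℕ) (hi : i + 1 < N) (hj : i + 1 + 1 < N)
    (f : MvPolynomial (Fin N) R) :
    demazure q i hi (demazure q (i + 1) hj (demazure q i hi f)) =
      demazure q (i + 1) hj (demazure q i hi (demazure q (i + 1) hj f)) := by
  apply eq_of_aeval_gen
  have hx : Function.Injective (gen N R) := gen_injective
  generalize gen N R = x at *
  have ne : ∀ a b : Fin N, a ≠ b → x a ≠ x b := fun a b h e => h (hx e)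
  have d1 : x ⟨i, by omega⟩ ≠ x ⟨i + 1, hi⟩ := ne _ _ (by simp)
  have d2 : x ⟨i + 1, by omega⟩ ≠ x ⟨i + 1 + 1, hj⟩ := ne _ _ (by simp)
  have d3 : x ⟨i, by omega⟩ ≠ x ⟨i + 1 + 1, hj⟩ := ne _ _ (by simp; omega)
  have m1 : ¬ i = i + 1 + 1 := by omega
  have m2 : ¬ i + 1 + 1 = i := by omega
  have u1 : ∀ y : Fin N → FractionRing (MvPolynomial (Fin N) R),
      (y ∘ adj i hi) ⟨i, by omega⟩ = y ⟨i + 1, hi⟩ := by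
    intro y; simp only [Function.comp, Equiv.swap_apply_left]
  have u2 : ∀ y : Fin N → FractionRing (MvPolynomial (Fin N) R),
      (y ∘ adj i hi) ⟨i + 1, hi⟩ = y ⟨i, by omega⟩ := by
    intro y; simp only [Function.comp, Equiv.swap_apply_right]
  have u3 : ∀ y : Fin N → FractionRing (MvPolynomial (Fin N) R),
      (y ∘ adj i hi) ⟨i + 1 + 1, hj⟩ = y ⟨i + 1 + 1, hj⟩ := by
    intro y; simp [adj_apply_mk, m2]
  have u4 : ∀ y : Fin N → FractionRing (MvPolynomial (Fin N) R),
      (y ∘ adj (i + 1) hj) ⟨i + 1, hi⟩ = y ⟨i + 1 + 1, hj⟩ := by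
    intro y; simp only [Function.comp, Equiv.swap_apply_left]
  have u5 : ∀ y : Fin N → FractionRing (MvPolynomial (Fin N) R),
      (y ∘ adj (i + 1) hj) ⟨i + 1 + 1, hj⟩ = y ⟨i + 1, hi⟩ := by
    intro y; simp only [Function.comp, Equiv.swap_apply_right]
  have u6 : ∀ y : Fin N → FractionRing (MvPolynomial (Fin N) R),
      (y ∘ adj (i + 1) hj) ⟨i, by omega⟩ = y ⟨i, by omega⟩ := by
    intro y; simp [adj_apply_mk, m1]
  have e1 : ((x ∘ adj i hi) ∘ adj (i + 1) hj) ∘ adj i hi =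
      ((x ∘ adj (i + 1) hj) ∘ adj i hi) ∘ adj (i + 1) hj := by
    funext ⟨k, hk⟩
    simp only [Function.comp, adj_apply_mk]
    congr 1
    rcases eq_or_ne k i with rfl | h1
    · simp [adj_apply_mk, m1, m2]
    · rcases eq_or_ne k (i + 1) with rfl | h2
      · simp [adj_apply_mk, m1, m2]
      · rcases eq_or_ne k (i + 1 + 1) with rfl | h3
        · simp [adj_apply_mk, m1, m2]
        · simp [adj_apply_mk, h1, h2, h3]
  have e2 : ∀ y : Fin N → FractionRing (MvPolynomial (Fin N) R), (y ∘ adj i hi) ∘ adj i hi = y := by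
    intro y; funext j; simp [adj]
  have e3 : ∀ y : Fin N → FractionRing (MvPolynomial (Fin N) R),
      (y ∘ adj (i + 1) hj) ∘ adj (i + 1) hj = y := by
    intro y; funext j; simp [adj]
  have A := fun (y : Fin N → FractionRing (MvPolynomial (Fin N) R)) g => aeval_demazure q i hi g y
  have B := fun (y : Fin N → FractionRing (MvPolynomial (Fin N) R)) g =>
    aeval_demazure q (i + 1) hj g y
  have hqq : algebraMap R (FractionRing (MvPolynomial (Fin N) R)) q *
      algebraMap R (FractionRing (MvPolynomial (Fin N) R)) (q⁻¹ : Rˣ) = 1 := by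
    rw [← map_mul, Units.mul_inv, map_one]
  -- Evaluate both sides at the generic point, in terms of the values at its six permutations.
  rw [A x _ d1, B x _ d2, A x _ d1, B (x ∘ adj i hi) _ (by rw [u2, u3]; exact d3),
    A (x ∘ adj i hi) _ (by rw [u1, u2]; exact d1.symm),
    A (x ∘ adj (i + 1) hj) _ (by rw [u6, u4]; exact d3),
    A ((x ∘ adj i hi) ∘ adj (i + 1) hj) _ (by rw [u6, u4, u1, u3]; exact d2),
    B x _ d2, A x _ d1, B x _ d2,
    A (x ∘ adj (i + 1) hj) _ (by rw [u6, u4]; exact d3),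
    B (x ∘ adj (i + 1) hj) _ (by rw [u4, u5]; exact d2.symm),
    B (x ∘ adj i hi) _ (by rw [u2, u3]; exact d3),
    B ((x ∘ adj (i + 1) hj) ∘ adj i hi) _ (by rw [u2, u3, u6, u5]; exact d1)]
  simp only [e1, e2, e3, u1, u2, u3, u4, u5, u6]
  generalize aeval (((x ∘ adj (i + 1) hj) ∘ adj i hi) ∘ adj (i + 1) hj) f = f1
  generalize aeval ((x ∘ adj (i + 1) hj) ∘ adj i hi) f = f2
  generalize aeval ((x ∘ adj i hi) ∘ adj (i + 1) hj) f = f3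
  generalize aeval (x ∘ adj (i + 1) hj) f = f4
  generalize aeval (x ∘ adj i hi) f = f5
  generalize aeval x f = f6
  generalize algebraMap R (FractionRing (MvPolynomial (Fin N) R)) q = Q at *
  generalize algebraMap R (FractionRing (MvPolynomial (Fin N) R)) (q⁻¹ : Rˣ) = Q' at *
  generalize x ⟨i, _⟩ = a at *
  generalize x ⟨i + 1, _⟩ = b at *
  generalize x ⟨i + 1 + 1, _⟩ = c at *
  have g1 : b - a ≠ 0 := sub_ne_zero.2 d1.symm
  have g2 : c - b ≠ 0 := sub_ne_zero.2 d2.symm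
  have g3 : c - a ≠ 0 := sub_ne_zero.2 d3.symm
  have g4 : a - b ≠ 0 := sub_ne_zero.2 d1
  have g5 : b - c ≠ 0 := sub_ne_zero.2 d2
  have g6 : a - c ≠ 0 := sub_ne_zero.2 d3
  rw [show a - b = -(b - a) by ring, show b - c = -(c - b) by ring]
  field_simp
  ring

end QKZ

namespace QKZ

variable {N : ℕ} {R : Type*} [CommRing R]

/-- The exchange relations in the spin basis: `Ψ` intertwines the action of the Hecke algebra on spin
configurations with the one on polynomials. -/
structure IsSpin (q : Rˣ) (Ψ : Config N → MvPolynomial (Fin N) R) : Prop where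
  eq : ∀ (S : Config N) (i : ℕ) (hi : i + 1 < N), S ⟨i, by omega⟩ = S ⟨i + 1, hi⟩ →
    (C (q : R) * X ⟨i, by omega⟩ - C ((q⁻¹ : Rˣ) : R) * X ⟨i + 1, hi⟩) *
        rename (adj i hi) (Ψ S) =
      (C (q : R) * X ⟨i + 1, hi⟩ - C ((q⁻¹ : Rˣ) : R) * X ⟨i, by omega⟩) * Ψ S
  move : ∀ (S : Config N) (i : ℕ) (hi : i + 1 < N), S ⟨i, by omega⟩ = true →
    S ⟨i + 1, hi⟩ = false →
    (X ⟨i + 1, hi⟩ - X ⟨i, by omega⟩) * Ψ (S ∘ adj i hi) =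
      (C (q : R) * X ⟨i, by omega⟩ - C ((q⁻¹ : Rˣ) : R) * X ⟨i + 1, hi⟩) *
        rename (adj i hi) (Ψ S) + (C ((q⁻¹ : Rˣ) : R) - C (q : R)) * X ⟨i, by omega⟩ * Ψ S

theorem comp_adj_comp_adj {α : Type*} (S : Fin N → α) (i : ℕ) (hi : i + 1 < N) :
    (S ∘ adj i hi) ∘ adj i hi = S := by
  funext j; simp [adj]

theorem adj_of_ne {i k : ℕ} (hi : i + 1 < N) (hk : k < N) (h1 : k ≠ i) (h2 : k ≠ i + 1) :
    adj i hi ⟨k, hk⟩ = ⟨k, hk⟩ := by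
  rw [adj_apply_mk, if_neg h1, if_neg h2]

theorem adj_comm_of_lt {α : Type*} (S : Fin N → α) {i j : ℕ} (hi : i + 1 < N) (hj : j + 1 < N)
    (hij : i + 1 < j) : (S ∘ adj i hi) ∘ adj j hj = (S ∘ adj j hj) ∘ adj i hi := by
  funext ⟨k, hk⟩
  simp only [Function.comp, adj_apply_mk]
  congr 1
  split_ifs <;> simp only [adj_apply_mk] <;> split_ifs <;>
    simp only [Fin.mk.injEq] <;> omega

open Classical in
/-- The vector obtained from an initial component `f` by the Demazure--Lusztig operators that move
the up steps to the right; its components at paths that do not end at height zero are `0`. -/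
noncomputable def spinVector (q : Rˣ) (f : MvPolynomial (Fin N) R) (S : Config N) :
    MvPolynomial (Fin N) R :=
  if h : ∃ i, ∃ hi : i + 1 < N, S ⟨i, by omega⟩ = false ∧ S ⟨i + 1, hi⟩ = true then
    demazure q h.choose h.choose_spec.choose
      (spinVector q f (S ∘ adj h.choose h.choose_spec.choose))
  else if ht S N = 0 then f else 0
termination_by area S
decreasing_by
  exact area_comp_adj S _ _ h.choose_spec.choose_spec.1 h.choose_spec.choose_spec.2

theorem spinVector_of_descent (q : Rˣ) (f : MvPolynomial (Fin N) R) (S : Config N)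
    (h : ∃ i, ∃ hi : i + 1 < N, S ⟨i, by omega⟩ = false ∧ S ⟨i + 1, hi⟩ = true) :
    ∃ i, ∃ hi : i + 1 < N, (S ⟨i, by omega⟩ = false ∧ S ⟨i + 1, hi⟩ = true) ∧
      spinVector q f S = demazure q i hi (spinVector q f (S ∘ adj i hi)) := by
  refine ⟨h.choose, h.choose_spec.choose, h.choose_spec.choose_spec, ?_⟩
  rw [spinVector, dif_pos h]

theorem spinVector_of_not_descent (q : Rˣ) (f : MvPolynomial (Fin N) R) (S : Config N)
    (h : ¬ ∃ i, ∃ hi : i + 1 < N, S ⟨i, by omega⟩ = false ∧ S ⟨i + 1, hi⟩ = true) :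
    spinVector q f S = if ht S N = 0 then f else 0 := by
  rw [spinVector, dif_neg h]

theorem spinVector_initial {n : ℕ} (q : Rˣ) (f : MvPolynomial (Fin (2 * n)) R) :
    spinVector q f (initial (2 * n) n) = f := by
  rw [spinVector_of_not_descent, if_pos]
  · have := LinkPattern.compatible_up (LinkPattern.rainbow n)
    rw [LinkPattern.rainbow_up] at this
    exact this.ht_eq_zero
  · rintro ⟨i, hi, h1, h2⟩
    simp only [initial, decide_eq_false_iff_not, decide_eq_true_eq] at h1 h2
    omega

variable [IsDomain R]

/-- By induction on the area: two different last moves are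
compared by the commutation or the braid relation. -/
theorem spinVector_relations {n : ℕ} (q : Rˣ) (f : MvPolynomial (Fin (2 * n)) R)
    (hf : ∀ (i : ℕ) (hi : i + 1 < 2 * n), i + 1 ≠ n → demazure q i hi f = C (q : R) * f) :
    ∀ S : Config (2 * n),
      (∀ (i : ℕ) (hi : i + 1 < 2 * n), S ⟨i, by omega⟩ = false → S ⟨i + 1, hi⟩ = true →
        spinVector q f S = demazure q i hi (spinVector q f (S ∘ adj i hi))) ∧
      ∀ (i : ℕ) (hi : i + 1 < 2 * n), S ⟨i, by omega⟩ = S ⟨i + 1, hi⟩ →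
        demazure q i hi (spinVector q f S) = C (q : R) * spinVector q f S := by
  intro S
  induction hA : area S using Nat.strong_induction_on generalizing S with
  | _ A ih =>
    subst hA
    by_cases hd : ∃ i, ∃ hi : i + 1 < 2 * n, S ⟨i, by omega⟩ = false ∧ S ⟨i + 1, hi⟩ = true
    · obtain ⟨j, hj, ⟨j0, j1⟩, hS⟩ := spinVector_of_descent q f S hd
      have hAj := area_comp_adj S j hj j0 j1
      have ihj := ih _ hAj _ rfl
      have w0 : (S ∘ adj j hj) ⟨j, by omega⟩ = true := by
        simp only [Function.comp, Equiv.swap_apply_left]; exact j1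
      have w1 : (S ∘ adj j hj) ⟨j + 1, hj⟩ = false := by
        simp only [Function.comp, Equiv.swap_apply_right]; exact j0
      have w2 : ∀ k (hk : k < 2 * n), k ≠ j → k ≠ j + 1 → (S ∘ adj j hj) ⟨k, hk⟩ = S ⟨k, hk⟩ := by
        intro k hk h1 h2
        simp only [Function.comp]; rw [adj_of_ne hj hk h1 h2]
      refine ⟨fun i hi i0 i1 => ?_, fun i hi hii => ?_⟩
      · rcases eq_or_ne i j with rfl | hij
        · exact hS
        have n1 : i ≠ j + 1 := by rintro rfl; rw [j1] at i0; exact absurd i0 (by simp)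
        have n2 : j ≠ i + 1 := by rintro rfl; rw [i1] at j0; exact absurd j0 (by simp)
        have e1 := ihj.1 i hi (by rw [w2 _ _ hij n1, i0])
          (by rw [w2 _ _ (by omega) (by omega), i1])
        have hAi := area_comp_adj S i hi i0 i1
        have e2 := (ih _ hAi _ rfl).1 j hj
          (by simp only [Function.comp]; rw [adj_of_ne hi _ (by omega) (by omega), j0])
          (by simp only [Function.comp]; rw [adj_of_ne hi _ (by omega) (by omega), j1])
        rw [hS, e1, e2]
        rcases Nat.lt_or_gt_of_ne hij with h | h
        · rw [demazure_comm q i j hi hj (by omega), adj_comm_of_lt S hi hj (by omega)]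
        · rw [demazure_comm q j i hj hi (by omega), adj_comm_of_lt S hj hi (by omega)]
      · have hij : i ≠ j := by
          rintro rfl; rw [j0, j1] at hii; exact absurd hii (by simp)
        rcases eq_or_ne i (j + 1) with rfl | n1
        · -- The steps at `j`, `j + 1`, `j + 2` are down, up, up: use the braid relation.
          have i2 : S ⟨j + 1 + 1, hi⟩ = true := by rw [← hii]; exact j1
          have a0 := w2 (j + 1 + 1) hi (by omega) (by omega)
          have e1 := ihj.1 (j + 1) hi w1 (by rw [a0, i2])
          have hAX := area_comp_adj (S ∘ adj j hj) (j + 1) hi w1 (by rw [a0, i2])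
          have e2 := (ih _ (hAX.trans hAj) _ rfl).2 j hj (by
            rw [Function.comp_apply (f := S ∘ adj j hj), Function.comp_apply (f := S ∘ adj j hj),
              adj_of_ne hi _ (by omega) (by omega), Equiv.swap_apply_left, a0, i2, w0])
          rw [hS, e1, ← demazure_braid, e2, demazure_C_mul, demazure_C_mul]
        rcases eq_or_ne j (i + 1) with rfl | n2
        · -- The steps at `i`, `i + 1`, `i + 2` are down, down, up.
          have i0 : S ⟨i, by omega⟩ = false := by rw [hii]; exact j0
          have a0 := w2 i (by omega) (by omega) (by omega)
          have e1 := ihj.1 i hi (by rw [a0, i0]) w0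
          have hAX := area_comp_adj (S ∘ adj (i + 1) hj) i hi (by rw [a0, i0]) w0
          have e2 := (ih _ (hAX.trans hAj) _ rfl).2 (i + 1) hj (by
            rw [Function.comp_apply (f := S ∘ adj (i + 1) hj),
              Function.comp_apply (f := S ∘ adj (i + 1) hj),
              adj_of_ne (k := i + 1 + 1) hi hj (by omega) (by omega),
              Equiv.swap_apply_right, a0, i0, w1])
          rw [hS, e1, demazure_braid, e2, demazure_C_mul, demazure_C_mul]
        · have e1 := ihj.2 i hi (by
            rw [w2 _ _ hij n1, w2 _ _ (by omega) (by omega), hii])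
          rw [hS]
          rcases Nat.lt_or_gt_of_ne hij with h | h
          · rw [demazure_comm q i j hi hj (by omega), e1, demazure_C_mul]
          · rw [← demazure_comm q j i hj hi (by omega), e1, demazure_C_mul]
    · refine ⟨fun i hi i0 i1 => absurd ⟨i, hi, i0, i1⟩ hd, fun i hi hii => ?_⟩
      rw [spinVector_of_not_descent q f S hd]
      split_ifs with h0
      · refine hf i hi fun hin => ?_
        have e := eq_initial S fun i hi a => by
          by_contra hb
          exact hd ⟨i, hi, a, by simpa using hb⟩
        have h1 := ht_eq S
        rw [h0] at h1
        have h2 : #{j | S j} = n := by push_cast at h1; omega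
        rw [e, h2] at hii
        simp only [initial] at hii
        rw [decide_eq_true (by omega), decide_eq_false (by omega)] at hii
        exact absurd hii (by simp)
      · rw [demazure_zero, mul_zero]

/-- An initial component with the exchange relations that do not move up steps extends to a spin
solution. -/
theorem isSpin_spinVector {n : ℕ} (q : Rˣ) (f : MvPolynomial (Fin (2 * n)) R)
    (hf : ∀ (i : ℕ) (hi : i + 1 < 2 * n), i + 1 ≠ n → demazure q i hi f = C (q : R) * f) :
    IsSpin q (spinVector q f) where
  eq S i hi h := (demazure_eq_q_iff q i hi _).1 ((spinVector_relations q f hf S).2 i hi h)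
  move S i hi h0 h1 := by
    have := (spinVector_relations q f hf (S ∘ adj i hi)).1 i hi (by simpa using h1)
      (by simpa using h0)
    rw [comp_adj_comp_adj] at this
    rw [this, demazure_spec]

end QKZ

namespace QKZ

variable {N : ℕ} {R : Type*} [CommRing R]

theorem sum_eq_add_add_sum_ne {α M : Type*} [Fintype α] [DecidableEq α] [AddCommMonoid M] {a b : α}
    (hab : a ≠ b) (f : α → M) : ∑ j, f j = f a + f b + ∑ j with j ≠ a ∧ j ≠ b, f j := by
  rw [← Finset.sum_pair hab, ← Finset.sum_filter_add_sum_filter_not univ (fun j => j = a ∨ j = b)]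
  congr 1
  · congr 1; ext j; simp
  · congr 1; ext j; simp

theorem update_comp_adj (S : Config N) (i : ℕ) (hi : i + 1 < N) (j : Fin N) (b : Bool) :
    Function.update (S ∘ adj i hi) (adj i hi j) b = Function.update S j b ∘ adj i hi := by
  funext k
  simp only [Function.update_apply, Function.comp]
  by_cases h : k = adj i hi j
  · subst h; simp [adj]
  · have : adj i hi k ≠ j := by rintro rfl; simp [adj] at h
    rw [if_neg h, if_neg this]

variable [IsDomain R]

/-- The raising operator commutes with the Hecke action on configurations, hence it preserves the
solutions of the exchange relations. -/
theorem IsSpin.raising {q : Rˣ} {Ψ : Config N → MvPolynomial (Fin N) R} (h : IsSpin q Ψ) :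
    IsSpin q (raising q Ψ) where
  eq S i hi hS := by
    have hne : (⟨i, by omega⟩ : Fin N) ≠ ⟨i + 1, hi⟩ := by simp
    simp only [QKZ.raising]
    rw [sum_eq_add_add_sum_ne hne]
    simp only [map_add, map_sum, mul_add, Finset.mul_sum]
    congr 1
    · cases h0 : S ⟨i, by omega⟩
      · rw [← hS, h0]; simp
      rw [← hS, h0]
      have h1 : S ⟨i + 1, hi⟩ = true := by rw [← hS, h0]
      simp only [if_true, smul_eq_C_mul]
      have hh : ht S (i + 1) = ht S i + 1 := by
        rw [ht_succ S ⟨i, by omega⟩, if_pos h0]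
      rw [hh, neg_add, zpow_add, zpow_neg_one, Units.val_mul, C_mul]
      have hm := h.move (Function.update S ⟨i + 1, hi⟩ false) i hi
        (by rw [Function.update_of_ne hne, h0]) (by rw [Function.update_self])
      have he : Function.update S ⟨i + 1, hi⟩ false ∘ adj i hi = Function.update S ⟨i, by omega⟩ false := by
        rw [← update_comp_adj, Equiv.swap_apply_right]
        congr 1
        funext k
        simp only [Function.comp]
        rcases eq_or_ne k ⟨i, by omega⟩ with rfl | h2
        · rw [Equiv.swap_apply_left, ← hS]
        rcases eq_or_ne k ⟨i + 1, hi⟩ with rfl | h3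
        · rw [Equiv.swap_apply_right, ← hS]
        · rw [Equiv.swap_apply_of_ne_of_ne h2 h3]
      rw [he] at hm
      have hm' := congrArg (rename (adj i hi)) hm
      have hinv : ∀ g : MvPolynomial (Fin N) R, rename (adj i hi) (rename (adj i hi) g) = g := by
        intro g
        rw [rename_rename]
        have : (adj i hi ∘ adj i hi : Fin N → Fin N) = id := by funext k; simp [adj]
        rw [this, rename_id_apply]
      simp only [map_mul, map_sub, map_add, rename_X, rename_C, Equiv.swap_apply_left,
        Equiv.swap_apply_right, hinv] at hm'
      apply mul_left_cancel₀ (X_sub_X_ne_zero (R := R) i hi)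
      simp only [map_mul, rename_C]
      generalize rename (adj i hi) (Ψ (Function.update S ⟨i, by omega⟩ false)) = A' at *
      generalize rename (adj i hi) (Ψ (Function.update S ⟨i + 1, hi⟩ false)) = B' at *
      generalize Ψ (Function.update S ⟨i, by omega⟩ false) = A at *
      generalize Ψ (Function.update S ⟨i + 1, hi⟩ false) = B at *
      generalize (C ((q ^ (-ht S i) : Rˣ) : R) : MvPolynomial (Fin N) R) = u at *
      generalize (C (q : R) : MvPolynomial (Fin N) R) = Q at *
      generalize (C ((q⁻¹ : Rˣ) : R) : MvPolynomial (Fin N) R) = Q' at *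
      generalize (X ⟨i, _⟩ : MvPolynomial (Fin N) R) = a at *
      generalize (X ⟨i + 1, _⟩ : MvPolynomial (Fin N) R) = b at *
      linear_combination -(Q * a - Q' * b) * u * hm' - (Q * b - Q' * a) * u * hm
    · refine Finset.sum_congr rfl fun j hj => ?_
      simp only [mem_filter, mem_univ, true_and] at hj
      split_ifs with h1
      · have := h.eq (Function.update S j false) i hi (by
          rw [Function.update_of_ne hj.1.symm, Function.update_of_ne hj.2.symm, hS])
        rw [map_smul, mul_smul_comm, mul_smul_comm, this]
      · simp
  move S i hi h0 h1 := by
    have hne : (⟨i, by omega⟩ : Fin N) ≠ ⟨i + 1, hi⟩ := by simp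
    simp only [QKZ.raising]
    rw [sum_eq_add_add_sum_ne hne, sum_eq_add_add_sum_ne hne]
    have v0 : (S ∘ adj i hi) ⟨i, by omega⟩ = false := by simpa using h1
    have v1 : (S ∘ adj i hi) ⟨i + 1, hi⟩ = true := by simpa using h0
    rw [v0, v1, h0, h1]
    simp only [if_true, Bool.false_eq_true, if_false, zero_add, add_zero, map_add, map_sum, mul_add,
      Finset.mul_sum]
    have key : ∀ j, j ≠ (⟨i, by omega⟩ : Fin N) → j ≠ ⟨i + 1, hi⟩ → adj i hi j = j := fun j a b =>
      Equiv.swap_apply_of_ne_of_ne a b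
    rw [add_add_add_comm, ← Finset.sum_add_distrib]
    congr 1
    · have e1 : Function.update (S ∘ adj i hi) ⟨i + 1, hi⟩ false = Function.update S ⟨i, by omega⟩ false := by
        have := update_comp_adj S i hi ⟨i, by omega⟩ false
        rw [Equiv.swap_apply_left] at this
        rw [this]
        funext k
        simp only [Function.comp]
        rcases eq_or_ne k ⟨i, by omega⟩ with rfl | h2
        · rw [Equiv.swap_apply_left, Function.update_self, Function.update_of_ne hne.symm, h1]
        rcases eq_or_ne k ⟨i + 1, hi⟩ with rfl | h3
        · rw [Equiv.swap_apply_right, Function.update_self, Function.update_of_ne hne.symm, h1]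
        · rw [Equiv.swap_apply_of_ne_of_ne h2 h3]
      have hh : ht (S ∘ adj i hi) (i + 1) = ht S i - 1 := by
        rw [ht_succ (S ∘ adj i hi) ⟨i, by omega⟩, v0, if_neg (by simp), ht_comp_adj _ _ _ _ (by simp)]
        rfl
      have hz := h.eq (Function.update S ⟨i, by omega⟩ false) i hi (by
        rw [Function.update_self, Function.update_of_ne hne.symm, h1])
      rw [e1, hh, show -(ht S i - 1) = -ht S i + 1 by ring, zpow_add, zpow_one, Units.val_mul]
      simp only [smul_eq_C_mul, map_mul, rename_C]
      linear_combination -(C ((q ^ (-ht S i) : Rˣ) : R)) * hz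
    · refine Finset.sum_congr rfl fun j hj => ?_
      simp only [mem_filter, mem_univ, true_and] at hj
      have kj := key j hj.1 hj.2
      simp only [Function.comp_apply, kj]
      split_ifs with hs
      · have hm := h.move (Function.update S j false) i hi (by
          rw [Function.update_of_ne hj.1.symm, h0]) (by rw [Function.update_of_ne hj.2.symm, h1])
        have e1 := update_comp_adj S i hi j false
        rw [kj] at e1
        rw [e1, ht_comp_adj _ _ _ _ (fun e => hj.2 (Fin.ext e)), map_smul, mul_smul_comm, hm, smul_add,
          mul_smul_comm, mul_smul_comm]
      · simp
end QKZ

/-! ### The factorized component -/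

namespace QKZ

variable {N : ℕ} {R : Type*} [CommRing R]

/-- The product of `f i j` over the pairs `i < j` of elements of a subset of `Fin N`. -/
def pairProd {M : Type*} [CommMonoid M] (P : Fin N → Prop) [DecidablePred P]
    (f : Fin N → Fin N → M) : M :=
  ∏ p : Fin N × Fin N with p.1 < p.2 ∧ P p.1 ∧ P p.2, f p.1 p.2

section pairProd

variable {M : Type*} [CommMonoid M] (P : Fin N → Prop) [DecidablePred P]

theorem map_pairProd {M' : Type*} [CommMonoid M'] {G : Type*} [FunLike G M M'] [MonoidHomClass G M M']
    (φ : G) (f : Fin N → Fin N → M) : φ (pairProd P f) = pairProd P fun i j => φ (f i j) :=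
  map_prod φ _ _

theorem adj_lt_adj {i : ℕ} (hi : i + 1 < N) {a b : Fin N} (h : a < b)
    (hne : ¬ (a = ⟨i, by omega⟩ ∧ b = ⟨i + 1, hi⟩)) : adj i hi a < adj i hi b := by
  obtain ⟨a, ha⟩ := a
  obtain ⟨b, hb⟩ := b
  simp only [adj_apply_mk, Fin.mk.injEq, Fin.mk_lt_mk] at *
  split_ifs <;> simp only [Fin.mk_lt_mk] <;> omega

/-- Exchanging two neighbours in a product over pairs only affects the factor at these two. -/
theorem exists_pairProd_adj (f : Fin N → Fin N → M) (i : ℕ) (hi : i + 1 < N)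
    (h0 : P ⟨i, by omega⟩) (h1 : P ⟨i + 1, hi⟩) :
    ∃ c, pairProd P f = f ⟨i, by omega⟩ ⟨i + 1, hi⟩ * c ∧
      pairProd P (fun a b => f (adj i hi a) (adj i hi b)) = f ⟨i + 1, hi⟩ ⟨i, by omega⟩ * c := by
  have hm : ((⟨i, by omega⟩, ⟨i + 1, hi⟩) : Fin N × Fin N) ∈
      ({p : Fin N × Fin N | p.1 < p.2 ∧ P p.1 ∧ P p.2} : Finset _) := by
    simp [h0, h1]
  have hP : ∀ a, P a → P (adj i hi a) := by
    intro a ha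
    rcases eq_or_ne a ⟨i, by omega⟩ with rfl | h2
    · rwa [Equiv.swap_apply_left]
    rcases eq_or_ne a ⟨i + 1, hi⟩ with rfl | h3
    · rwa [Equiv.swap_apply_right]
    · rwa [Equiv.swap_apply_of_ne_of_ne h2 h3]
  have hinv : ∀ a, adj i hi (adj i hi a) = a := fun a => Equiv.swap_apply_self _ _ _
  have hl : adj i hi ⟨i, by omega⟩ = ⟨i + 1, hi⟩ := Equiv.swap_apply_left _ _
  have hr : adj i hi ⟨i + 1, hi⟩ = ⟨i, by omega⟩ := Equiv.swap_apply_right _ _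
  refine ⟨_, (Finset.mul_prod_erase _ _ hm).symm, ?_⟩
  rw [pairProd, ← Finset.mul_prod_erase _ _ hm, hl, hr]
  congr 1
  have hmem : ∀ p ∈ ({p : Fin N × Fin N | p.1 < p.2 ∧ P p.1 ∧ P p.2} : Finset _).erase
      (⟨i, by omega⟩, ⟨i + 1, hi⟩), (adj i hi p.1, adj i hi p.2) ∈
      ({p : Fin N × Fin N | p.1 < p.2 ∧ P p.1 ∧ P p.2} : Finset _).erase
      (⟨i, by omega⟩, ⟨i + 1, hi⟩) := by
    rintro ⟨a, b⟩ hab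
    simp only [mem_erase, mem_filter, mem_univ, true_and, ne_eq, Prod.mk.injEq] at hab ⊢
    refine ⟨?_, adj_lt_adj hi hab.2.1 hab.1, hP _ hab.2.2.1, hP _ hab.2.2.2⟩
    rintro ⟨e1, e2⟩
    have e1' := congrArg (adj i hi) e1
    have e2' := congrArg (adj i hi) e2
    rw [hinv, hl] at e1'
    rw [hinv, hr] at e2'
    have := hab.2.1
    rw [e1', e2', Fin.mk_lt_mk] at this
    omega
  refine Finset.prod_bij' (fun p _ => (adj i hi p.1, adj i hi p.2))
    (fun p _ => (adj i hi p.1, adj i hi p.2)) hmem hmem ?_ ?_ ?_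
  · intro p _; simp only [hinv]
  · intro p _; simp only [hinv]
  · intro p _; rfl

theorem pairProd_adj_of_not (f : Fin N → Fin N → M) (i : ℕ) (hi : i + 1 < N)
    (h0 : ¬ P ⟨i, by omega⟩) (h1 : ¬ P ⟨i + 1, hi⟩) :
    pairProd P (fun a b => f (adj i hi a) (adj i hi b)) = pairProd P f := by
  have h : ∀ a, P a → adj i hi a = a := fun a ha =>
    Equiv.swap_apply_of_ne_of_ne (fun e => h0 (e ▸ ha)) (fun e => h1 (e ▸ ha))
  refine Finset.prod_congr rfl fun p hp => ?_
  simp only [mem_filter] at hp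
  simp only [h _ hp.2.2.1, h _ hp.2.2.2]

theorem pairProd_insert_right (P' : Fin N → Prop) [DecidablePred P'] (f : Fin N → Fin N → M)
    (a : Fin N) (ha : ∀ j, P j → j < a) (h : ∀ j, P' j ↔ P j ∨ j = a) :
    pairProd P' f = pairProd P f * ∏ j with P j, f j a := by
  rw [pairProd, ← Finset.prod_filter_mul_prod_filter_not _ (fun p => p.2 ≠ a)]
  congr 1
  · refine Finset.prod_congr ?_ fun _ _ => rfl
    ext ⟨c, d⟩
    simp only [mem_filter, mem_univ, true_and, h]
    have := ha d
    constructor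
    · rintro ⟨⟨h1, h2, h3⟩, h4⟩
      have h3 := h3.resolve_right h4
      exact ⟨h1, h2.resolve_right fun e => absurd h1 (not_lt.2 (by rw [e]; exact (ha d h3).le)), h3⟩
    · rintro ⟨h1, h2, h3⟩
      exact ⟨⟨h1, Or.inl h2, Or.inl h3⟩, (ha d h3).ne⟩
  · refine Finset.prod_bij' (fun p _ => p.1) (fun c _ => (c, a)) ?_ ?_ ?_ ?_ ?_
    · rintro ⟨c, d⟩
      simp only [mem_filter, mem_univ, true_and, h, not_not]
      rintro ⟨⟨h1, h2, h3⟩, rfl⟩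
      exact h2.resolve_right h1.ne
    · intro c
      simp only [mem_filter, mem_univ, true_and, h, not_not]
      intro hc
      exact ⟨⟨ha c hc, Or.inl hc, Or.inr trivial⟩, trivial⟩
    · rintro ⟨c, d⟩
      simp only [mem_filter, mem_univ, true_and, not_not]
      rintro ⟨_, rfl⟩; rfl
    · intro c _; rfl
    · rintro ⟨c, d⟩
      simp only [mem_filter, mem_univ, true_and, not_not]
      rintro ⟨_, rfl⟩; rfl

theorem pairProd_insert_left (P' : Fin N → Prop) [DecidablePred P'] (f : Fin N → Fin N → M)
    (a : Fin N) (ha : ∀ j, P j → a < j) (h : ∀ j, P' j ↔ P j ∨ j = a) :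
    pairProd P' f = pairProd P f * ∏ j with P j, f a j := by
  rw [pairProd, ← Finset.prod_filter_mul_prod_filter_not _ (fun p => p.1 ≠ a)]
  congr 1
  · refine Finset.prod_congr ?_ fun _ _ => rfl
    ext ⟨c, d⟩
    simp only [mem_filter, mem_univ, true_and, h]
    constructor
    · rintro ⟨⟨h1, h2, h3⟩, h4⟩
      have h2 := h2.resolve_right h4
      exact ⟨h1, h2, h3.resolve_right fun e => absurd h1 (not_lt.2 (by rw [e]; exact (ha c h2).le))⟩
    · rintro ⟨h1, h2, h3⟩
      exact ⟨⟨h1, Or.inl h2, Or.inl h3⟩, (ha c h2).ne'⟩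
  · refine Finset.prod_bij' (fun p _ => p.2) (fun c _ => (a, c)) ?_ ?_ ?_ ?_ ?_
    · rintro ⟨c, d⟩
      simp only [mem_filter, mem_univ, true_and, h, not_not]
      rintro ⟨⟨h1, h2, h3⟩, rfl⟩
      exact h3.resolve_right h1.ne'
    · intro c
      simp only [mem_filter, mem_univ, true_and, h, not_not]
      intro hc
      exact ⟨⟨ha c hc, Or.inr trivial, Or.inl hc⟩, trivial⟩
    · rintro ⟨c, d⟩
      simp only [mem_filter, mem_univ, true_and, not_not]
      rintro ⟨_, rfl⟩; rfl
    · intro c _; rfl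
    · rintro ⟨c, d⟩
      simp only [mem_filter, mem_univ, true_and, not_not]
      rintro ⟨_, rfl⟩; rfl

end pairProd

/-- The factor attached to a pair of the first kind, as a function of the point `x`. -/
def leftPair {F : Type*} [CommRing F] (Q Q' : F) (x : Fin N → F) (i j : Fin N) : F :=
  (Q * x i - Q' * x j) * (Q' ^ 2 - Q ^ 2 * x i * x j)

/-- The factor attached to a pair of the second kind, as a function of the point `x`. -/
def rightPair {F : Type*} [CommRing F] (Q Q' : F) (x : Fin N → F) (i j : Fin N) : F :=
  (Q * x i - Q' * x j) * (Q * x i * x j - Q')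

/-- The factorized polynomial
`∏_{i < j < m} (q w_i - q⁻¹ w_j) (q⁻² - q² w_i w_j) ∏_{l ≤ i < j} (q w_i - q⁻¹ w_j) (q w_i w_j - q⁻¹)`
evaluated at `x`. -/
def cutProd {F : Type*} [CommRing F] (Q Q' : F) (m l : ℕ) (x : Fin N → F) : F :=
  pairProd (fun i => i.val < m) (leftPair Q Q' x) * pairProd (fun i => l ≤ i.val) (rightPair Q Q' x)

theorem cutProd_comp_adj {F : Type*} [CommRing F] (Q Q' : F) (m l : ℕ) (hml : m ≤ l) (x : Fin N → F)
    (i : ℕ) (hi : i + 1 < N) (h : i + 1 < m ∨ l ≤ i) :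
    (Q * x ⟨i, by omega⟩ - Q' * x ⟨i + 1, hi⟩) * cutProd Q Q' m l (x ∘ adj i hi) =
      (Q * x ⟨i + 1, hi⟩ - Q' * x ⟨i, by omega⟩) * cutProd Q Q' m l x := by
  have e1 : leftPair Q Q' (x ∘ adj i hi) =
    fun a b => leftPair Q Q' x (adj i hi a) (adj i hi b) := rfl
  have e2 : rightPair Q Q' (x ∘ adj i hi) =
    fun a b => rightPair Q Q' x (adj i hi a) (adj i hi b) := rfl
  rw [cutProd, cutProd, e1, e2]
  rcases h with h | h
  · obtain ⟨c, h1, h2⟩ := exists_pairProd_adj (fun j : Fin N => j.val < m) (leftPair Q Q' x) i hi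
      (by simp only; omega) h
    rw [h1, h2, pairProd_adj_of_not (fun j : Fin N => l ≤ j.val) _ i hi (by simp only; omega)
      (by simp only; omega)]
    simp only [leftPair]; ring
  · obtain ⟨c, h1, h2⟩ := exists_pairProd_adj (fun j : Fin N => l ≤ j.val) (rightPair Q Q' x) i hi
      h (by simp only; omega)
    rw [h1, h2, pairProd_adj_of_not (fun j : Fin N => j.val < m) _ i hi (by simp only; omega)
      (by simp only; omega)]
    simp only [rightPair]; ring

/-- The base component of the solution, without the common factor. -/
noncomputable def base (n : ℕ) (q : Rˣ) : MvPolynomial (Fin (2 * n)) R :=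
  cutProd (C (q : R)) (C ((q⁻¹ : Rˣ) : R)) n n X

theorem map_cutProd {F F' : Type*} [CommRing F] [CommRing F'] (φ : F →+* F') (Q Q' : F) (m l : ℕ)
    (x : Fin N → F) : φ (cutProd Q Q' m l x) = cutProd (φ Q) (φ Q') m l (φ ∘ x) := by
  simp [cutProd, map_pairProd, leftPair, rightPair, map_mul]
  rfl

theorem aeval_base {F : Type*} [CommRing F] [Algebra R F] (n : ℕ) (q : Rˣ) (x : Fin (2 * n) → F) :
    aeval x (base n q) =
      cutProd (algebraMap R F q) (algebraMap R F (q⁻¹ : Rˣ)) n n x := by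
  have := map_cutProd (aeval x : MvPolynomial (Fin (2 * n)) R →ₐ[R] F).toRingHom (C (q : R))
    (C ((q⁻¹ : Rˣ) : R)) n n X
  simp only [AlgHom.toRingHom_eq_coe, RingHom.coe_coe, algHom_C] at this
  rw [base, this]
  congr 1
  funext j; simp

theorem demazure_base [IsDomain R] (n : ℕ) (q : Rˣ) (i : ℕ) (hi : i + 1 < 2 * n) (hin : i + 1 ≠ n) :
    demazure q i hi (base n q) = C (q : R) * base n q := by
  rw [demazure_eq_q_iff]
  have e : rename (adj i hi) (base n q) =
      cutProd (C (q : R)) (C ((q⁻¹ : Rˣ) : R)) n n (X ∘ adj i hi) := by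
    have := map_cutProd (rename (adj i hi) : MvPolynomial (Fin (2 * n)) R →ₐ[R] _).toRingHom (C (q : R))
      (C ((q⁻¹ : Rˣ) : R)) n n X
    simp only [AlgHom.toRingHom_eq_coe, RingHom.coe_coe, rename_C] at this
    rw [base, this]
    congr 1
    funext j; simp
  rw [e]
  exact cutProd_comp_adj _ _ n n le_rfl X i hi (by omega)

end QKZ

/-! ### The base component is annihilated by the raising operator -/

namespace QKZ

variable {N : ℕ}

section Field

variable {F : Type*} [Field F]

/-- The sum over `l ∈ s` of `h l` times the product of `(q x_i - q⁻¹ x_l) / (x_i - x_l)` over the other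
elements `i` of `s`: the closed form of a Hecke symmetrization. -/
def symmSum (Q Q' : F) (x h : Fin N → F) (s : Finset (Fin N)) : F :=
  ∑ l ∈ s, h l * ∏ i ∈ s.erase l, (Q * x i - Q' * x l) / (x i - x l)

theorem symmSum_comp (Q Q' : F) (x h : Fin N → F) (s : Finset (Fin N)) (σ : Equiv.Perm (Fin N)) :
    symmSum Q Q' (x ∘ σ) (h ∘ σ) s = symmSum Q Q' x h (s.map σ.toEmbedding) := by
  rw [symmSum, symmSum, Finset.sum_map]
  refine Finset.sum_congr rfl fun l _ => ?_
  rw [← Finset.map_erase, Finset.prod_map]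
  rfl

theorem symmSum_congr (Q Q' : F) (x h h' : Fin N → F) (s : Finset (Fin N)) (hh : ∀ l ∈ s, h l = h' l) :
    symmSum Q Q' x h s = symmSum Q Q' x h' s :=
  Finset.sum_congr rfl fun l hl => by rw [hh l hl]

/-- The three-term recurrence that adds one more variable to a Hecke symmetrization. -/
theorem symmSum_insert_insert {Q Q' : F} (hQ : Q * Q' = 1) (x h : Fin N → F) {a b : Fin N} {J : Finset (Fin N)}
    (hx : Function.Injective x) (hab : a ≠ b) (ha : a ∉ J) (hb : b ∉ J) :
    symmSum Q Q' x h (insert a (insert b J)) = Q' * symmSum Q Q' x h (insert b J) +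
      ((Q * x b - Q' * x a) * symmSum Q Q' x h (insert a J) +
        (Q' - Q) * x a * symmSum Q Q' x h (insert b J)) / (x b - x a) - symmSum Q Q' x h J := by
  have hba : x b - x a ≠ 0 := sub_ne_zero.2 fun e => hab (hx e).symm
  have hab' : x a - x b ≠ 0 := sub_ne_zero.2 fun e => hab (hx e)
  have ha' : a ∉ insert b J := by simp [hab, ha]
  have e1 : ∀ c, c ∉ J → symmSum Q Q' x h (insert c J) =
      h c * (∏ i ∈ J, (Q * x i - Q' * x c) / (x i - x c)) + ∑ l ∈ J, h l *
        ((Q * x c - Q' * x l) / (x c - x l) *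
          ∏ i ∈ J.erase l, (Q * x i - Q' * x l) / (x i - x l)) := by
    intro c hc
    rw [symmSum, Finset.sum_insert hc, Finset.erase_insert hc]
    congr 1
    refine Finset.sum_congr rfl fun l hl => ?_
    have : c ≠ l := by rintro rfl; exact hc hl
    rw [Finset.erase_insert_of_ne this, Finset.prod_insert (fun e => hc (Finset.mem_of_mem_erase e))]
  have e2 : symmSum Q Q' x h (insert a (insert b J)) =
      h a * ((Q * x b - Q' * x a) / (x b - x a) * ∏ i ∈ J, (Q * x i - Q' * x a) / (x i - x a)) +
      (h b * ((Q * x a - Q' * x b) / (x a - x b) * ∏ i ∈ J, (Q * x i - Q' * x b) / (x i - x b)) +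
      ∑ l ∈ J, h l * ((Q * x a - Q' * x l) / (x a - x l) * ((Q * x b - Q' * x l) / (x b - x l) *
          ∏ i ∈ J.erase l, (Q * x i - Q' * x l) / (x i - x l)))) := by
    rw [symmSum, Finset.sum_insert ha', Finset.erase_insert ha', Finset.prod_insert hb,
      Finset.sum_insert hb, Finset.erase_insert_of_ne hab, Finset.erase_insert hb,
      Finset.prod_insert ha]
    congr 2
    refine Finset.sum_congr rfl fun l hl => ?_
    have h1 : a ≠ l := by rintro rfl; exact ha hl
    have h2 : b ≠ l := by rintro rfl; exact hb hl
    rw [Finset.erase_insert_of_ne h1, Finset.erase_insert_of_ne h2, Finset.prod_insert, Finset.prod_insert]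
    · exact fun e => hb (Finset.mem_of_mem_erase e)
    · simp [hab, ha]
  have e3 : ∑ l ∈ J, h l * ((Q * x a - Q' * x l) / (x a - x l) * ((Q * x b - Q' * x l) / (x b - x l) *
          ∏ i ∈ J.erase l, (Q * x i - Q' * x l) / (x i - x l))) =
      Q' * ∑ l ∈ J, h l * ((Q * x b - Q' * x l) / (x b - x l) *
          ∏ i ∈ J.erase l, (Q * x i - Q' * x l) / (x i - x l)) +
      ((Q * x b - Q' * x a) * (∑ l ∈ J, h l * ((Q * x a - Q' * x l) / (x a - x l) *
          ∏ i ∈ J.erase l, (Q * x i - Q' * x l) / (x i - x l))) +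
        (Q' - Q) * x a * (∑ l ∈ J, h l * ((Q * x b - Q' * x l) / (x b - x l) *
          ∏ i ∈ J.erase l, (Q * x i - Q' * x l) / (x i - x l)))) / (x b - x a) -
      ∑ l ∈ J, h l * ∏ i ∈ J.erase l, (Q * x i - Q' * x l) / (x i - x l) := by
    rw [eq_sub_iff_add_eq, Finset.mul_sum, Finset.mul_sum, Finset.mul_sum, ← Finset.sum_add_distrib,
      ← Finset.sum_add_distrib, Finset.sum_div, ← Finset.sum_add_distrib]
    refine Finset.sum_congr rfl fun l hl => ?_
    have h1 : x a - x l ≠ 0 := sub_ne_zero.2 fun e => ha (hx e ▸ hl)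
    have h2 : x b - x l ≠ 0 := sub_ne_zero.2 fun e => hb (hx e ▸ hl)
    generalize ∏ i ∈ J.erase l, (Q * x i - Q' * x l) / (x i - x l) = p
    field_simp
    linear_combination (h l * p) * (x a - x b) * (x a - x l) * (x b - x l) * hQ
  rw [e2, e3, e1 a ha, e1 b hb, symmSum]
  generalize ∏ i ∈ J, (Q * x i - Q' * x a) / (x i - x a) = pa
  generalize ∏ i ∈ J, (Q * x i - Q' * x b) / (x i - x b) = pb
  have h3 : (Q * x a - Q' * x b) / (x a - x b) = Q' + (Q' - Q) * x a / (x b - x a) := by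
    field_simp; ring
  rw [h3]
  field_simp
  ring

/-- A point at which none of the factors occurring in the denominators vanishes. -/
structure Generic (Q Q' : F) (x : Fin N → F) : Prop where
  inj : Function.Injective x
  ne_zero (i) : x i ≠ 0
  sub_ne (i j) : i ≠ j → Q * x i - Q' * x j ≠ 0
  mul_ne (i j) : i ≠ j → Q' ^ 2 - Q ^ 2 * x i * x j ≠ 0

theorem Generic.comp {Q Q' : F} {x : Fin N → F} (h : Generic Q Q' x) (σ : Equiv.Perm (Fin N)) :
    Generic Q Q' (x ∘ σ) where
  inj := h.inj.comp σ.injective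
  ne_zero _ := h.ne_zero _
  sub_ne _ _ hij := h.sub_ne _ _ (σ.injective.ne hij)
  mul_ne _ _ hij := h.mul_ne _ _ (σ.injective.ne hij)

/-- The quotient by the factors common to all of them of the images of the base component under the
transpositions `(l m)`, `l ≤ m`. -/
def quotFactor (Q Q' : F) (m : ℕ) (x : Fin N → F) (l : Fin N) : F :=
  (∏ j : Fin N with m < j.val, (Q * x l - Q' * x j) * (Q * x l * x j - Q')) /
    ∏ i ∈ ({i : Fin N | i.val ≤ m} : Finset _).erase l,
      (Q * x i - Q' * x l) * (Q' ^ 2 - Q ^ 2 * x i * x l)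

theorem map_adj_filter (P : Fin N → Prop) [DecidablePred P] {i : ℕ} (hi : i + 1 < N)
    (h : P ⟨i, by omega⟩ ↔ P ⟨i + 1, hi⟩) :
    ({j : Fin N | P j} : Finset _).map (adj i hi).toEmbedding = ({j : Fin N | P j} : Finset _) := by
  have h' : ∀ j, P (adj i hi j) ↔ P j := by
    intro j
    rcases eq_or_ne j ⟨i, by omega⟩ with rfl | h2
    · rw [Equiv.swap_apply_left, h]
    rcases eq_or_ne j ⟨i + 1, hi⟩ with rfl | h3
    · rw [Equiv.swap_apply_right, h]
    · rw [adj, Equiv.swap_apply_of_ne_of_ne h2 h3]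
  ext j
  simp only [Finset.mem_map_equiv, mem_filter, mem_univ, true_and]
  rw [show (adj i hi).symm = adj i hi from Equiv.symm_swap _ _, h']

theorem quotFactor_comp_adj (Q Q' : F) (m : ℕ) (x : Fin N → F) (l : Fin N) {i : ℕ} (hi : i + 1 < N)
    (him : i + 1 ≤ m) :
    quotFactor Q Q' m (x ∘ adj i hi) l = quotFactor Q Q' m x (adj i hi l) := by
  rw [quotFactor, quotFactor]
  congr 1
  · conv_rhs => rw [← map_adj_filter (fun j : Fin N => m < j.val) hi (by simp only; omega), Finset.prod_map]
    rfl
  · conv_rhs => rw [← map_adj_filter (fun j : Fin N => j.val ≤ m) hi (by simp only; omega)]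
    have : (adj i hi) l = (adj i hi).toEmbedding l := rfl
    rw [this, ← Finset.map_erase, Finset.prod_map]
    rfl

theorem cutProd_eq_mul_quotFactor {Q Q' : F} (m : ℕ) (hm : m < N) {x : Fin N → F} (hx : Generic Q Q' x) :
    cutProd Q Q' m m x = cutProd Q Q' (m + 1) (m + 1) x * quotFactor Q Q' m x ⟨m, hm⟩ := by
  have h1 := pairProd_insert_right (fun i : Fin N => i.val < m) (fun i : Fin N => i.val < m + 1)
    (leftPair Q Q' x) ⟨m, hm⟩ (fun j hj => hj) (fun j => by rw [Fin.ext_iff]; dsimp only; omega)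
  have h2 := pairProd_insert_left (fun i : Fin N => m + 1 ≤ i.val) (fun i : Fin N => m ≤ i.val)
    (rightPair Q Q' x) ⟨m, hm⟩ (fun j hj => hj) (fun j => by rw [Fin.ext_iff]; dsimp only; omega)
  have h3 : ({i : Fin N | i.val ≤ m} : Finset _).erase ⟨m, hm⟩ = ({i : Fin N | i.val < m} : Finset _) := by
    ext j; simp only [mem_erase, mem_filter, mem_univ, true_and, ne_eq, Fin.ext_iff]; omega
  have h4 : ∏ j : Fin N with j.val < m, leftPair Q Q' x j ⟨m, hm⟩ ≠ 0 := by
    rw [Finset.prod_ne_zero_iff]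
    intro j hj
    have : j ≠ ⟨m, hm⟩ := by rintro rfl; simp at hj
    exact mul_ne_zero (hx.sub_ne _ _ this) (hx.mul_ne _ _ this)
  rw [cutProd, cutProd, h1, h2, quotFactor, h3]
  rw [show (∏ j : Fin N with m < j.val, (Q * x ⟨m, hm⟩ - Q' * x j) * (Q * x ⟨m, hm⟩ * x j - Q')) =
    ∏ j : Fin N with m + 1 ≤ j.val, rightPair Q Q' x ⟨m, hm⟩ j from rfl]
  rw [show (∏ i : Fin N with i.val < m, (Q * x i - Q' * x ⟨m, hm⟩) *
    (Q' ^ 2 - Q ^ 2 * x i * x ⟨m, hm⟩)) = ∏ j : Fin N with j.val < m, leftPair Q Q' x j ⟨m, hm⟩ from rfl]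
  field_simp

/-- The complete symmetrization vanishes: after the substitution `y = q² x + q⁻² / x` it is a divided
difference, with `n + 1` nodes, of a polynomial of degree `n - 1`. -/
theorem symmSum_quotFactor_eq_zero {n : ℕ} (hn : 0 < n) {Q Q' : F} (hQ : Q * Q' = 1) {x : Fin (2 * n) → F}
    (hx : Generic Q Q' x) :
    symmSum Q Q' x (quotFactor Q Q' n x) {i : Fin (2 * n) | i.val ≤ n} = 0 := by
  set A : Finset (Fin (2 * n)) := {i : Fin (2 * n) | i.val ≤ n} with hA
  set B : Finset (Fin (2 * n)) := {i : Fin (2 * n) | n < i.val} with hB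
  have hcA : #A = n + 1 := by
    have : A = Finset.univ.filter fun i : Fin (2 * n) => i.val < n + 1 := by
      rw [hA]; ext i; simp only [mem_filter, mem_univ, true_and]; omega
    rw [this, Fin.card_filter_val_lt]; omega
  have hcB : #B = n - 1 := by
    have h := Finset.card_filter_add_card_filter_not (s := (univ : Finset (Fin (2 * n)))) (fun i => i.val ≤ n)
    simp only [not_le, card_univ, Fintype.card_fin] at h
    change #A + #B = _ at h
    omega
  let y : Fin (2 * n) → F := fun i => Q ^ 2 * x i + Q' ^ 2 / x i
  have hy : ∀ i l, (x i - x l) * (Q' ^ 2 - Q ^ 2 * x i * x l) = x i * x l * (y l - y i) := by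
    intro i l
    have h1 := hx.ne_zero i
    have h2 := hx.ne_zero l
    simp only [y]; field_simp; ring
  have hz : ∀ l j, (Q * x l - Q' * x j) * (Q * x l * x j - Q') = x l * x j * (y l - (x j + (x j)⁻¹)) := by
    intro l j
    have h1 := hx.ne_zero j
    have h2 := hx.ne_zero l
    simp only [y]; field_simp
    linear_combination -(x l * (1 + x j ^ 2)) * hQ
  have hyinj : Set.InjOn y A := by
    intro i _ l _ h
    by_contra hne
    have := hy i l
    rw [h, sub_self, mul_zero] at this
    exact mul_ne_zero (sub_ne_zero.2 (hx.inj.ne hne)) (hx.mul_ne _ _ hne) this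
  let P : Polynomial F := ∏ j ∈ B, (Polynomial.X - Polynomial.C (x j + (x j)⁻¹))
  have hPd : P.natDegree = n - 1 := by
    rw [Polynomial.natDegree_finsetProd_X_sub_C_eq_card, hcB]
  have hL := Lagrange.coeff_eq_sum (s := A) (v := y) hyinj (P := P) (by
    rw [hcA]
    refine lt_of_le_of_lt Polynomial.degree_le_natDegree ?_
    rw [hPd]; exact_mod_cast (by omega : n - 1 < n + 1))
  rw [hcA, Nat.add_sub_cancel, Polynomial.coeff_eq_zero_of_natDegree_lt (by omega)] at hL
  suffices h : symmSum Q Q' x (quotFactor Q Q' n x) A =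
      ((∏ j ∈ B, x j) / ∏ i ∈ A, x i) * ∑ i ∈ A, Polynomial.eval (y i) P / ∏ j ∈ A.erase i, (y i - y j) by
    rw [h, ← hL, mul_zero]
  rw [symmSum, Finset.mul_sum]
  refine Finset.sum_congr rfl fun l hl => ?_
  have n1 : ∏ i ∈ A.erase l, (x i - x l) ≠ 0 := by
    rw [Finset.prod_ne_zero_iff]; intro i hi
    exact sub_ne_zero.2 (hx.inj.ne (Finset.ne_of_mem_erase hi))
  have n2 : ∏ i ∈ A.erase l, (Q * x i - Q' * x l) ≠ 0 := by
    rw [Finset.prod_ne_zero_iff]; intro i hi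
    exact hx.sub_ne _ _ (Finset.ne_of_mem_erase hi)
  have n3 : ∏ i ∈ A.erase l, (Q' ^ 2 - Q ^ 2 * x i * x l) ≠ 0 := by
    rw [Finset.prod_ne_zero_iff]; intro i hi
    exact hx.mul_ne _ _ (Finset.ne_of_mem_erase hi)
  have n4 : ∏ i ∈ A.erase l, (y l - y i) ≠ 0 := by
    rw [Finset.prod_ne_zero_iff]; intro i hi e
    exact (Finset.ne_of_mem_erase hi) (hyinj (Finset.mem_of_mem_erase hi) hl (sub_eq_zero.1 e).symm)
  have n5 : ∏ i ∈ A, x i ≠ 0 := by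
    rw [Finset.prod_ne_zero_iff]; intro i _; exact hx.ne_zero i
  have n6 := hx.ne_zero l
  have hprod : (∏ i ∈ A.erase l, (x i - x l)) * ∏ i ∈ A.erase l, (Q' ^ 2 - Q ^ 2 * x i * x l) =
      x l ^ (n - 1) * (∏ i ∈ A, x i) * ∏ i ∈ A.erase l, (y l - y i) := by
    rw [← Finset.prod_mul_distrib, Finset.prod_congr rfl fun i _ => hy i l, Finset.prod_mul_distrib,
      Finset.prod_mul_distrib, Finset.prod_const, Finset.card_erase_of_mem hl, hcA,
      ← Finset.mul_prod_erase A x hl, Nat.add_sub_cancel]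
    obtain ⟨m, rfl⟩ : ∃ m, n = m + 1 := ⟨n - 1, by omega⟩
    rw [Nat.add_sub_cancel, pow_succ]; ring
  rw [quotFactor, Finset.prod_div_distrib, Finset.prod_congr rfl fun j _ => hz l j,
    Finset.prod_mul_distrib, Finset.prod_mul_distrib, Finset.prod_const, Polynomial.eval_prod]
  rw [show (#(univ.filter fun j : Fin (2 * n) => n < j.val)) = n - 1 from hcB]
  rw [Finset.prod_mul_distrib]
  simp only [Polynomial.eval_sub, Polynomial.eval_X, Polynomial.eval_C]
  change (x l ^ (n - 1) * (∏ j ∈ B, x j) * ∏ j ∈ B, (y l - (x j + (x j)⁻¹))) /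
    ((∏ i ∈ A.erase l, (Q * x i - Q' * x l)) * ∏ i ∈ A.erase l, (Q' ^ 2 - Q ^ 2 * x i * x l)) *
    ((∏ i ∈ A.erase l, (Q * x i - Q' * x l)) / ∏ i ∈ A.erase l, (x i - x l)) = _
  generalize ∏ j ∈ B, (y l - (x j + (x j)⁻¹)) = p1 at *
  generalize ∏ j ∈ B, x j = p2 at *
  generalize ∏ i ∈ A, x i = p3 at *
  generalize ∏ i ∈ A.erase l, (Q * x i - Q' * x l) = p4 at *
  generalize ∏ i ∈ A.erase l, (x i - x l) = p5 at *
  generalize ∏ i ∈ A.erase l, (Q' ^ 2 - Q ^ 2 * x i * x l) = p6 at *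
  generalize ∏ i ∈ A.erase l, (y l - y i) = p7 at *
  have n7 : x l ^ (n - 1) ≠ 0 := pow_ne_zero _ n6
  generalize x l ^ (n - 1) = p8 at *
  field_simp
  linear_combination -(p1 * p2) * hprod

end Field

end QKZ

namespace QKZ

variable {R : Type*} [CommRing R]

theorem generic_gen [IsDomain R] {N : ℕ} (q : Rˣ) :
    Generic (algebraMap R (FractionRing (MvPolynomial (Fin N) R)) q)
      (algebraMap R (FractionRing (MvPolynomial (Fin N) R)) (q⁻¹ : Rˣ)) (gen N R) := by
  have key : ∀ (f : MvPolynomial (Fin N) R) (y : Fin N → R), aeval y f ≠ 0 → aeval (gen N R) f ≠ 0 := by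
    intro f y hf h
    rw [aeval_gen] at h
    apply hf
    rw [(IsFractionRing.injective (MvPolynomial (Fin N) R) (FractionRing (MvPolynomial (Fin N) R)))
      (h.trans (map_zero _).symm), map_zero]
  refine ⟨gen_injective, fun i => ?_, fun i j hij => ?_, fun i j hij => ?_⟩
  · have := key (X i) 1 (by simp)
    simpa using this
  · have := key (C (q : R) * X i - C ((q⁻¹ : Rˣ) : R) * X j) (Pi.single i 1) (by
      simp [Pi.single_eq_of_ne hij.symm])
    simpa using this
  · have := key (C ((q⁻¹ : Rˣ) : R) ^ 2 - C (q : R) ^ 2 * X i * X j) 0 (by simp)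
    simpa using this

section

variable {N : ℕ}

/-- The configuration with up steps at the first `m + 1` positions except `k`. -/
def gap (N m k : ℕ) : Config N := fun j => decide (j.val ≤ m ∧ j.val ≠ k)

/-- The part of the component at `initial (m + 1)` of the raised vector that comes from lowering the
steps at or after `k`. -/
noncomputable def tailSum (q : Rˣ) (Ψ : Config N → MvPolynomial (Fin N) R) (m k : ℕ) :
    MvPolynomial (Fin N) R :=
  ∑ j ∈ Finset.Icc k m, C ((q⁻¹ : Rˣ) : R) ^ j * Ψ (gap N m j)

theorem tailSum_eq_add (q : Rˣ) (Ψ : Config N → MvPolynomial (Fin N) R) {m k : ℕ} (h : k ≤ m) :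
    tailSum q Ψ m k = C ((q⁻¹ : Rˣ) : R) ^ k * Ψ (gap N m k) + tailSum q Ψ m (k + 1) := by
  rw [tailSum, ← Finset.insert_Icc_succ_left_eq_Icc h, Finset.sum_insert (by simp)]
  rfl

/-- Lowering the start of the sum by one amounts to one more Demazure--Lusztig operator. -/
theorem IsSpin.tailSum {q : Rˣ} {Ψ : Config N → MvPolynomial (Fin N) R} (h : IsSpin q Ψ) {m k : ℕ}
    (hm : m < N) (hk : k + 1 ≤ m) :
    (X ⟨k + 1, by omega⟩ - X ⟨k, by omega⟩) * tailSum q Ψ m k =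
      (X ⟨k + 1, by omega⟩ - X ⟨k, by omega⟩) * tailSum q Ψ m (k + 1) +
      C (q : R) * ((C (q : R) * X ⟨k, by omega⟩ - C ((q⁻¹ : Rˣ) : R) * X ⟨k + 1, by omega⟩) *
        rename (adj k (by omega)) (tailSum q Ψ m (k + 1)) +
        (C ((q⁻¹ : Rˣ) : R) - C (q : R)) * X ⟨k, by omega⟩ * tailSum q Ψ m (k + 1)) -
      C (q : R) ^ 2 * (X ⟨k + 1, by omega⟩ - X ⟨k, by omega⟩) * tailSum q Ψ m (k + 2) := by
  have hi : k + 1 < N := by omega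
  have e1 := h.move (gap N m (k + 1)) k hi (by simp [gap]; omega) (by simp [gap])
  have e2 : gap N m (k + 1) ∘ adj k hi = gap N m k := by
    funext ⟨j, hj⟩
    simp only [Function.comp, adj_apply_mk, gap]
    rcases eq_or_ne j k with rfl | h1
    · simp
    rcases eq_or_ne j (k + 1) with rfl | h2
    · simp; omega
    · simp [h1, h2]
  rw [e2] at e1
  have e3 : (C (q : R) * X ⟨k, by omega⟩ - C ((q⁻¹ : Rˣ) : R) * X ⟨k + 1, hi⟩) *
      rename (adj k hi) (QKZ.tailSum q Ψ m (k + 2)) =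
      (C (q : R) * X ⟨k + 1, hi⟩ - C ((q⁻¹ : Rˣ) : R) * X ⟨k, by omega⟩) *
        QKZ.tailSum q Ψ m (k + 2) := by
    rw [QKZ.tailSum, map_sum, Finset.mul_sum, Finset.mul_sum]
    refine Finset.sum_congr rfl fun j hj => ?_
    rw [Finset.mem_Icc] at hj
    have := h.eq (gap N m j) k hi (by simp only [gap]; congr 1; simp; omega)
    rw [map_mul, map_pow, rename_C]
    linear_combination C ((q⁻¹ : Rˣ) : R) ^ j * this
  have hq : (C (q : R) * C ((q⁻¹ : Rˣ) : R) : MvPolynomial (Fin N) R) = 1 := by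
    rw [← C_mul, Units.mul_inv, C_1]
  rw [tailSum_eq_add q Ψ (show k ≤ m by omega), tailSum_eq_add q Ψ hk, map_add, map_mul, map_pow, rename_C]
  rw [pow_succ]
  linear_combination (C ((q⁻¹ : Rˣ) : R) ^ k) * e1 - C (q : R) * e3 -
    C ((q⁻¹ : Rˣ) : R) ^ k * ((C (q : R) * X ⟨k, by omega⟩ - C ((q⁻¹ : Rˣ) : R) * X ⟨k + 1, hi⟩) *
        rename (adj k hi) (Ψ (gap N m (k + 1))) + 
        (C ((q⁻¹ : Rˣ) : R) - C (q : R)) * X ⟨k, by omega⟩ * Ψ (gap N m (k + 1))) * hq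

end

/-- The set of positions from `k` to `m`. -/
def window (N k m : ℕ) : Finset (Fin N) := {i | k ≤ i.val ∧ i.val ≤ m}

variable {n : ℕ} {F : Type*} [Field F] [Algebra R F]

/-- The partial sums of the raised component are Hecke symmetrizations over windows of variables, by
descending induction on the start of the window. -/
theorem aeval_tailSum (hn : 0 < n) {q : Rˣ} {Ψ : Config (2 * n) → MvPolynomial (Fin (2 * n)) R} (h : IsSpin q Ψ)
    (h0 : Ψ (initial (2 * n) n) = base n q) (k : ℕ) (hk : k ≤ n) :
    (∀ x : Fin (2 * n) → F, Generic (algebraMap R F q) (algebraMap R F (q⁻¹ : Rˣ)) x →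
      aeval x (tailSum q Ψ n (k + 1)) =
        cutProd (algebraMap R F q) (algebraMap R F (q⁻¹ : Rˣ)) (n + 1) (n + 1) x *
        (algebraMap R F (q⁻¹ : Rˣ)) ^ (k + 1) * symmSum (algebraMap R F q) (algebraMap R F (q⁻¹ : Rˣ)) x
          (quotFactor (algebraMap R F q) (algebraMap R F (q⁻¹ : Rˣ)) n x) (window _ (k + 1) n)) ∧
    ∀ x : Fin (2 * n) → F, Generic (algebraMap R F q) (algebraMap R F (q⁻¹ : Rˣ)) x →
      aeval x (tailSum q Ψ n k) =
        cutProd (algebraMap R F q) (algebraMap R F (q⁻¹ : Rˣ)) (n + 1) (n + 1) x *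
        (algebraMap R F (q⁻¹ : Rˣ)) ^ k * symmSum (algebraMap R F q) (algebraMap R F (q⁻¹ : Rˣ)) x
          (quotFactor (algebraMap R F q) (algebraMap R F (q⁻¹ : Rˣ)) n x) (window _ k n) := by
  have hQ : algebraMap R F q * algebraMap R F (q⁻¹ : Rˣ) = 1 := by rw [← map_mul, Units.mul_inv, map_one]
  generalize hd : n - k = d
  induction d generalizing k with
  | zero =>
    obtain rfl : k = n := by omega
    refine ⟨fun x _ => ?_, fun x hx => ?_⟩
    · have e : window (2 * k) (k + 1) k = ∅ := by
        ext i; simp [window]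
      rw [e, tailSum, Finset.Icc_eq_empty (by omega)]
      simp [symmSum]
    · have e : window (2 * k) k k = {⟨k, by omega⟩} := by
        ext i; simp only [window, Fin.ext_iff, mem_filter, mem_univ, true_and, mem_singleton]; omega
      have e' : gap (2 * k) k k = initial (2 * k) k := by
        funext j; simp only [gap, initial]; congr 1; rw [eq_iff_iff]; omega
      rw [e, tailSum, Finset.Icc_self, Finset.sum_singleton, e', h0, map_mul, aeval_base,
        cutProd_eq_mul_quotFactor k (by omega) hx]
      simp [symmSum]
      ring
  | succ d ih =>
    obtain ⟨ih2, ih1⟩ := ih (k + 1) (by omega) (by omega)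
    refine ⟨ih1, fun x hx => ?_⟩
    have hi : k + 1 < 2 * n := by omega
    have hne : (⟨k, by omega⟩ : Fin (2 * n)) ≠ ⟨k + 1, hi⟩ := by simp
    have hxne : x ⟨k + 1, hi⟩ - x ⟨k, by omega⟩ ≠ 0 := sub_ne_zero.2 fun e => hne (hx.inj e).symm
    apply mul_left_cancel₀ hxne
    have key := congrArg (aeval x) (h.tailSum (m := n) (k := k) (by omega) (by omega))
    simp only [map_mul, map_sub, map_add, map_pow, aeval_X, algHom_C, aeval_rename] at key
    rw [key, ih1 x hx, ih1 _ (hx.comp _), ih2 x hx]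
    have e1 : window (2 * n) k n =
        insert ⟨k, by omega⟩ (insert ⟨k + 1, hi⟩ (window _ (k + 2) n)) := by
      ext i; simp [window, Fin.ext_iff]; omega
    have e2 : (window (2 * n) (k + 1) n) =
        insert ⟨k + 1, hi⟩ (window _ (k + 2) n) := by
      ext i; simp [window, Fin.ext_iff]; omega
    have e3 : (window (2 * n) (k + 1) n).map (adj k hi).toEmbedding =
        insert ⟨k, by omega⟩ (window _ (k + 2) n) := by
      rw [e2, Finset.map_insert, window, map_adj_filter (fun j : Fin (2 * n) => k + 2 ≤ j.val ∧ j.val ≤ n) hi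
        (by simp)]
      congr 1
      exact Equiv.swap_apply_right _ _
    have e4 : symmSum (algebraMap R F q) (algebraMap R F (q⁻¹ : Rˣ)) (x ∘ adj k hi)
        (quotFactor (algebraMap R F q) (algebraMap R F (q⁻¹ : Rˣ)) n (x ∘ adj k hi))
        (window _ (k + 1) n) =
        symmSum (algebraMap R F q) (algebraMap R F (q⁻¹ : Rˣ)) x
          (quotFactor (algebraMap R F q) (algebraMap R F (q⁻¹ : Rˣ)) n x)
          (insert ⟨k, by omega⟩ (window _ (k + 2) n)) := by
      rw [← e3, ← symmSum_comp]
      refine symmSum_congr _ _ _ _ _ _ fun l _ => ?_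
      exact quotFactor_comp_adj _ _ n x l hi (by omega)
    have e5 := cutProd_comp_adj (algebraMap R F q) (algebraMap R F (q⁻¹ : Rˣ)) (n + 1) (n + 1) le_rfl x k hi
      (by omega)
    have e6 := symmSum_insert_insert hQ x (quotFactor (algebraMap R F q) (algebraMap R F (q⁻¹ : Rˣ)) n x)
      (J := (window _ (k + 2) n)) hx.inj hne (by simp [window]) (by simp [window])
    rw [e1, e4, e6, e2, show k + 1 + 1 = k + 2 from rfl, pow_succ _ k, pow_add _ k 2]
    generalize symmSum _ _ x _ (insert _ (window _ (k + 2) n)) = G1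
    generalize symmSum _ _ x _ (insert _ (window _ (k + 2) n)) = G2
    generalize symmSum _ _ x _ (window _ (k + 2) n) = G3
    generalize cutProd _ _ _ _ (x ∘ adj k hi) = u' at *
    generalize cutProd _ _ _ _ x = u at *
    generalize algebraMap R F q = Q at *
    generalize algebraMap R F (q⁻¹ : Rˣ) = Q' at *
    generalize x ⟨k, _⟩ = a at *
    generalize x ⟨k + 1, _⟩ = b at *
    generalize Q' ^ k = v
    have hba : (b - a) * (v * (Q' * G1 + ((Q * b - Q' * a) * G2 + (Q' - Q) * a * G1) / (b - a) - G3)) =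
        v * ((b - a) * (Q' * G1 - G3) + ((Q * b - Q' * a) * G2 + (Q' - Q) * a * G1)) := by
      field_simp; ring
    linear_combination Q * v * Q' * G2 * e5 - u * hba + u * v * ((Q * b - Q' * a) * G2 + (Q' - Q) * a * G1) * hQ
      - (b - a) * u * G3 * v * (Q * Q' + 1) * hQ

/-- The component of the raised vector that has to be computed is a complete symmetrization. -/
theorem raising_initial_eq_zero [IsDomain R] (hn : 0 < n) {q : Rˣ}
    {Ψ : Config (2 * n) → MvPolynomial (Fin (2 * n)) R} (h : IsSpin q Ψ)
    (h0 : Ψ (initial (2 * n) n) = base n q) : raising q Ψ (initial (2 * n) (n + 1)) = 0 := by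
  have e1 : raising q Ψ (initial (2 * n) (n + 1)) = tailSum q Ψ n 0 := by
    have h1 : ∀ k ≤ n + 1, ht (initial (2 * n) (n + 1)) k = k := by
      intro k
      induction k with
      | zero => intro _; rw [ht_zero]; rfl
      | succ k ih =>
        intro hk
        rw [ht_succ _ ⟨k, by omega⟩, if_pos (by simp [initial]; omega), ih (by omega)]
        push_cast; rfl
    rw [raising, tailSum, ← Finset.sum_filter]
    refine Finset.sum_bij (fun j _ => j.val) ?_ ?_ ?_ ?_
    · intro j hj
      simp only [initial, mem_filter, mem_univ, true_and, decide_eq_true_eq] at hj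
      rw [Finset.mem_Icc]; omega
    · intro a _ b _ hab
      exact Fin.ext hab
    · intro b hb
      rw [Finset.mem_Icc] at hb
      exact ⟨⟨b, by omega⟩, by simp [initial]; omega, rfl⟩
    · intro j hj
      simp only [initial, mem_filter, mem_univ, true_and, decide_eq_true_eq] at hj
      rw [h1 _ (by omega), smul_eq_C_mul, ← C_pow, zpow_neg, zpow_natCast, ← inv_pow, Units.val_pow_eq_pow_val]
      congr 2
      funext l
      simp only [Function.update_apply, gap, initial, Fin.ext_iff]
      split_ifs with hl
      · simp [hl]
      · simp [hl]
  rw [e1]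
  apply eq_of_aeval_gen
  rw [(aeval_tailSum hn h h0 0 (Nat.zero_le _)).2 _ (generic_gen q)]
  have := symmSum_quotFactor_eq_zero hn (Q := algebraMap R _ q) (Q' := algebraMap R _ (q⁻¹ : Rˣ))
    (by rw [← map_mul, Units.mul_inv, map_one]) (generic_gen (R := R) (N := 2 * n) q)
  have e2 : window (2 * n) 0 n = ({i : Fin (2 * n) | i.val ≤ n} : Finset _) := by
    ext i; simp [window]
  rw [e2, this, mul_zero, map_zero]

/-- The spin solution built from the factorized component is annihilated by the raising operator. -/
theorem raising_eq_zero [IsDomain R] (hn : 0 < n) {q : Rˣ}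
    {Ψ : Config (2 * n) → MvPolynomial (Fin (2 * n)) R} (h : IsSpin q Ψ)
    (h0 : Ψ (initial (2 * n) n) = base n q) (S : Config (2 * n)) (hS : ht S (2 * n) = 2) :
    raising q Ψ S = 0 := by
  refine config_induction (m := n + 1) (fun S => raising q Ψ S = 0) (raising_initial_eq_zero hn h h0)
    (fun S i hi _ h1 h2 hz => ?_) S (by rw [hS]; push_cast; ring)
  have := h.raising.move (S ∘ adj i hi) i hi (by simpa using h2) (by simpa using h1)
  rw [comp_adj_comp_adj, hz, map_zero, mul_zero, mul_zero, add_zero] at this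
  exact (mul_eq_zero.1 this).resolve_left (X_sub_X_ne_zero i hi)

end QKZ

/-! ### Expansion of the spin solution in link patterns -/

namespace QKZ

variable {N : ℕ} {R : Type*} [CommRing R]

/-- Only configurations with as many up steps as down steps can be reached. -/
theorem spinVector_eq_zero [IsDomain R] (q : Rˣ) (f : MvPolynomial (Fin N) R) (S : Config N)
    (h : ht S N ≠ 0) : spinVector q f S = 0 := by
  induction hA : area S using Nat.strong_induction_on generalizing S with
  | _ A ih =>
    subst hA
    by_cases hd : ∃ i, ∃ hi : i + 1 < N, S ⟨i, by omega⟩ = false ∧ S ⟨i + 1, hi⟩ = true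
    · obtain ⟨j, hj, ⟨j0, j1⟩, hS⟩ := spinVector_of_descent q f S hd
      rw [hS, ih _ (area_comp_adj S j hj j0 j1) _ (by rwa [ht_comp_adj _ _ _ _ (by omega)]) rfl, demazure_zero]
    · rw [spinVector_of_not_descent q f S hd, if_neg h]

theorem map_raising {M M' : Type*} [AddCommGroup M] [Module R M] [AddCommGroup M'] [Module R M']
    (φ : M →ₗ[R] M') (q : Rˣ) (v : Config N → M) (S : Config N) :
    φ (raising q v S) = raising q (fun S => φ (v S)) S := by
  simp only [raising, map_sum]
  refine Finset.sum_congr rfl fun j _ => ?_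
  split_ifs <;> simp

theorem coeff_raising (q : Rˣ) (v : Config N → MvPolynomial (Fin N) R) (S : Config N) (m : Fin N →₀ ℕ) :
    coeff m (raising q v S) = raising q (fun S => coeff m (v S)) S :=
  map_raising (lcoeff R m) q v S

theorem raising_sub_sum_iota {M : Type*} [AddCommGroup M] [Module R M] (q : Rˣ) (v : Config N → M)
    (c : LinkPattern N → M) (S : Config N) :
    raising q (fun S => v S - ∑ p, LinkPattern.iota ((q⁻¹ : Rˣ) : R) p S • c p) S = raising q v S := by
  have h (p : LinkPattern N) :
      raising q (fun S => LinkPattern.iota ((q⁻¹ : Rˣ) : R) p S • c p) S = 0 := by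
    have := map_raising (LinearMap.toSpanSingleton R _ (c p)) q
      (LinkPattern.iota ((q⁻¹ : Rˣ) : R) p) S
    rw [raising_iota, map_zero] at this
    exact this.symm
  have h' : raising q (fun S => v S - ∑ p, LinkPattern.iota ((q⁻¹ : Rˣ) : R) p S • c p) S =
      raising q v S - ∑ p, raising q (fun S => LinkPattern.iota ((q⁻¹ : Rˣ) : R) p S • c p) S := by
    simp only [raising]
    rw [Finset.sum_comm, ← Finset.sum_sub_distrib]
    refine Finset.sum_congr rfl fun j _ => ?_
    split_ifs
    · rw [smul_sub, Finset.smul_sum]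
    · simp
  rw [h', Finset.sum_eq_zero fun p _ => h p, sub_zero]

/-- For an indeterminate `q`, the spin solution is a combination of the spin vectors of link patterns,
with polynomial coefficients. -/
theorem exists_link_expansion (K : Type*) [Field K] {n : ℕ} (hn : 0 < n) :
    ∃ c : LinkPattern (2 * n) → MvPolynomial (Fin (2 * n)) (LaurentPolynomial K), ∀ S,
      spinVector (unitT K) (base n (unitT K)) S =
        ∑ p, LinkPattern.iota (((unitT K)⁻¹ : (LaurentPolynomial K)ˣ) : LaurentPolynomial K) p S • c p := by
  set q := unitT K
  obtain ⟨c, hc⟩ := LinkPattern.exists_coeff ((q⁻¹ : (LaurentPolynomial K)ˣ) : LaurentPolynomial K)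
    fun p : LinkPattern (2 * n) => spinVector q (base n q) p.up
  refine ⟨c, fun S => ?_⟩
  by_cases hS : ht S (2 * n) = 0
  · have h1 : ∀ S, ht S (2 * n) = 2 → raising q (fun S => spinVector q (base n q) S -
        ∑ p, LinkPattern.iota ((q⁻¹ : (LaurentPolynomial K)ˣ) : LaurentPolynomial K) p S • c p) S = 0 := by
      intro S hS
      rw [raising_sub_sum_iota]
      exact raising_eq_zero hn (isSpin_spinVector q (base n q) fun i hi h => demazure_base n q i hi h)
        (spinVector_initial q _) S hS
    have h2 : ∀ p : LinkPattern (2 * n), spinVector q (base n q) p.up -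
        ∑ p', LinkPattern.iota ((q⁻¹ : (LaurentPolynomial K)ˣ) : LaurentPolynomial K) p' p.up • c p' = 0 := by
      intro p
      rw [hc, sub_self]
    rw [← sub_eq_zero]
    generalize hw : (fun S => spinVector q (base n q) S -
        ∑ p, LinkPattern.iota ((q⁻¹ : (LaurentPolynomial K)ˣ) : LaurentPolynomial K) p S • c p) = w at h1
    have hw' := fun S => congrFun hw S
    simp only [hw'] at h2 ⊢
    ext1 m
    rw [coeff_zero]
    refine eq_zero_of_raising_eq_zero (fun S => coeff m (w S)) (fun S hS => ?_) (fun p => ?_) S hS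
    · rw [← coeff_raising, h1 S hS, coeff_zero]
    · rw [h2, coeff_zero]
  · rw [spinVector_eq_zero q _ S hS, Finset.sum_eq_zero]
    intro p _
    have : LinkPattern.iota ((q⁻¹ : (LaurentPolynomial K)ˣ) : LaurentPolynomial K) p S = 0 := by
      by_contra h
      exact hS (LinkPattern.compatible_of_iota_ne_zero h).ht_eq_zero
    rw [this, zero_smul]

theorem IsSpin.map {R' : Type*} [CommRing R'] (φ : R →+* R') {q : Rˣ} {Ψ : Config N → MvPolynomial (Fin N) R}
    (h : IsSpin q Ψ) : IsSpin (Units.map φ.toMonoidHom q) fun S => MvPolynomial.map φ (Ψ S) where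
  eq S i hi hS := by
    have := congrArg (MvPolynomial.map φ) (h.eq S i hi hS)
    simpa [map_rename] using this
  move S i hi h0 h1 := by
    have := congrArg (MvPolynomial.map φ) (h.move S i hi h0 h1)
    simpa [map_rename] using this

/-- For every invertible `q` there is a spin solution that starts with the factorized polynomial and is
a combination of the spin vectors of link patterns. -/
theorem exists_isSpin {K : Type*} [Field K] (q : Kˣ) {n : ℕ} (hn : 0 < n) :
    ∃ (Ψ : Config (2 * n) → MvPolynomial (Fin (2 * n)) K) (c : LinkPattern (2 * n) → MvPolynomial (Fin (2 * n)) K),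
      IsSpin q Ψ ∧ Ψ (initial (2 * n) n) = base n q ∧
      ∀ S, Ψ S = ∑ p, LinkPattern.iota ((q⁻¹ : Kˣ) : K) p S • c p := by
  obtain ⟨c, hc⟩ := exists_link_expansion K hn
  let φ : LaurentPolynomial K →+* K := LaurentPolynomial.eval₂ (RingHom.id K) q
  have h1 : Units.map φ.toMonoidHom (unitT K) = q := by
    ext
    change φ (LaurentPolynomial.T 1) = q
    simp [φ]
  have h2 : φ ((unitT K)⁻¹ : (LaurentPolynomial K)ˣ) = ((q⁻¹ : Kˣ) : K) := by
    rw [← h1, ← map_inv]; rfl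
  have h3 : φ (unitT K : LaurentPolynomial K) = q := by rw [← h1]; rfl
  refine ⟨fun S => MvPolynomial.map φ (spinVector (unitT K) (base n (unitT K)) S),
    fun p => MvPolynomial.map φ (c p), ?_, ?_, fun S => ?_⟩
  · have := (isSpin_spinVector (unitT K) (base n (unitT K)) fun i hi h => demazure_base n _ i hi h).map φ
    rwa [h1] at this
  · dsimp only
    rw [spinVector_initial, base, map_cutProd, map_C, map_C, h2, h3, base]
    congr 1
    funext j; simp
  · dsimp only
    rw [hc, map_sum]
    refine Finset.sum_congr rfl fun p _ => ?_
    rw [smul_eq_C_mul, map_mul, map_C, LinkPattern.map_iota, h2, smul_eq_C_mul]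

end QKZ

/-! ### The exchange relations in the basis of link patterns -/

namespace QKZ

variable {N : ℕ} {K : Type*} [Field K]

/-- The exchange relations `R_i(w_{i+1} / w_i) Ψ = τ_i Ψ` with denominators cleared. -/
def IsLoop (q : Kˣ) (Ψ : LinkPattern N → MvPolynomial (Fin N) K) : Prop :=
  ∀ (i : ℕ) (hi : i + 1 < N) (σ : LinkPattern N),
    (X ⟨i + 1, hi⟩ - X ⟨i, by omega⟩) * (∑ p with p.connect i hi = σ,
        (if p.1 ⟨i, by omega⟩ = ⟨i + 1, hi⟩ then -((q : K) + ((q⁻¹ : Kˣ) : K)) else 1) • Ψ p) =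
      (C (q : K) * X ⟨i, by omega⟩ - C ((q⁻¹ : Kˣ) : K) * X ⟨i + 1, hi⟩) * rename (adj i hi) (Ψ σ) -
        (C (q : K) * X ⟨i + 1, hi⟩ - C ((q⁻¹ : Kˣ) : K) * X ⟨i, by omega⟩) * Ψ σ

theorem rename_adj_adj {R : Type*} [CommRing R] (i : ℕ) (hi : i + 1 < N) (g : MvPolynomial (Fin N) R) :
    rename (adj i hi) (rename (adj i hi) g) = g := by
  rw [rename_rename]
  have : (adj i hi ∘ adj i hi : Fin N → Fin N) = id := by funext k; simp [adj]
  rw [this, rename_id_apply]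

/-- As the spin vectors of link patterns are independent and intertwine the actions of `e_i`, the exchange
relations descend from spins to link patterns. -/
theorem IsSpin.isLoop {q : Kˣ} {Ψ : Config N → MvPolynomial (Fin N) K}
    {c : LinkPattern N → MvPolynomial (Fin N) K} (h : IsSpin q Ψ)
    (hc : ∀ S, Ψ S = ∑ p, LinkPattern.iota ((q⁻¹ : Kˣ) : K) p S • c p) : IsLoop q c := by
  intro i hi
  have hq : (C (q : K) * C ((q⁻¹ : Kˣ) : K) : MvPolynomial (Fin N) K) = 1 := by
    rw [← C_mul, Units.mul_inv, C_1]
  set wt : LinkPattern N → K := fun p =>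
    if p.1 ⟨i, by omega⟩ = ⟨i + 1, hi⟩ then -((q : K) + ((q⁻¹ : Kˣ) : K)) else 1 with hwt
  -- The action of `e_i` on the spin components.
  have hsum : ∀ S, ∑ σ, LinkPattern.iota ((q⁻¹ : Kˣ) : K) σ S • ((X ⟨i + 1, hi⟩ - X ⟨i, by omega⟩) *
      ∑ p with LinkPattern.connect i hi p = σ, wt p • c p) = (X ⟨i + 1, hi⟩ - X ⟨i, by omega⟩) * ∑ p,
        (wt p * LinkPattern.iota ((q⁻¹ : Kˣ) : K) (LinkPattern.connect i hi p) S) • c p := by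
    intro S
    rw [← Finset.sum_fiberwise univ (LinkPattern.connect i hi)
      (fun p => (wt p * LinkPattern.iota ((q⁻¹ : Kˣ) : K) (LinkPattern.connect i hi p) S) • c p),
      Finset.mul_sum]
    refine Finset.sum_congr rfl fun σ _ => ?_
    rw [← mul_smul_comm, Finset.smul_sum]
    congr 1
    refine Finset.sum_congr rfl fun p hp => ?_
    rw [(mem_filter.1 hp).2, smul_smul, mul_comm]
  have key : ∀ s : LinkPattern N, ∑ σ, LinkPattern.iota ((q⁻¹ : Kˣ) : K) σ s.up •
      ((X ⟨i + 1, hi⟩ - X ⟨i, by omega⟩) * (∑ p with LinkPattern.connect i hi p = σ, wt p • c p) -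
      ((C (q : K) * X ⟨i, by omega⟩ - C ((q⁻¹ : Kˣ) : K) * X ⟨i + 1, hi⟩) * rename (adj i hi) (c σ) -
        (C (q : K) * X ⟨i + 1, hi⟩ - C ((q⁻¹ : Kˣ) : K) * X ⟨i, by omega⟩) * c σ)) ∈
      (⊥ : Submodule K (MvPolynomial (Fin N) K)) := by
    intro s
    rw [Submodule.mem_bot]
    generalize s.up = S
    have e1 : ∑ σ, LinkPattern.iota ((q⁻¹ : Kˣ) : K) σ S •
        ((C (q : K) * X ⟨i, by omega⟩ - C ((q⁻¹ : Kˣ) : K) * X ⟨i + 1, hi⟩) * rename (adj i hi) (c σ) -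
        (C (q : K) * X ⟨i + 1, hi⟩ - C ((q⁻¹ : Kˣ) : K) * X ⟨i, by omega⟩) * c σ) =
        (C (q : K) * X ⟨i, by omega⟩ - C ((q⁻¹ : Kˣ) : K) * X ⟨i + 1, hi⟩) * rename (adj i hi) (Ψ S) -
        (C (q : K) * X ⟨i + 1, hi⟩ - C ((q⁻¹ : Kˣ) : K) * X ⟨i, by omega⟩) * Ψ S := by
      rw [hc S, map_sum, Finset.mul_sum, Finset.mul_sum, ← Finset.sum_sub_distrib]
      refine Finset.sum_congr rfl fun σ _ => ?_
      rw [map_smul, smul_sub, mul_smul_comm, mul_smul_comm]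
    refine (Finset.sum_congr rfl fun σ _ => smul_sub _ _ _).trans ?_
    rw [Finset.sum_sub_distrib, hsum, e1, sub_eq_zero]
    have hxy : (q : K) * ((q⁻¹ : Kˣ) : K) = 1 := Units.mul_inv q
    cases h0 : S ⟨i, by omega⟩ <;> cases h1 : S ⟨i + 1, hi⟩
    · have := h.eq S i hi (by rw [h0, h1])
      rw [this, sub_self, Finset.sum_eq_zero, mul_zero]
      intro p _
      rw [LinkPattern.iota_connect_of_eq i hi (by rw [h0, h1]), mul_zero, zero_smul]
    · have e2 : ∑ p, (wt p * LinkPattern.iota ((q⁻¹ : Kˣ) : K) (LinkPattern.connect i hi p) S) • c p =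
          Ψ (S ∘ adj i hi) - C ((q⁻¹ : Kˣ) : K) * Ψ S := by
        rw [hc, hc, Finset.mul_sum, ← Finset.sum_sub_distrib]
        refine Finset.sum_congr rfl fun p _ => ?_
        rw [hwt]; dsimp only
        rw [LinkPattern.iota_connect' hxy i hi h0 h1, sub_smul, mul_smul, C_mul']
      have hm := h.move (S ∘ adj i hi) i hi (by simpa using h1) (by simpa using h0)
      rw [comp_adj_comp_adj] at hm
      have hm' := congrArg (rename (adj i hi)) hm
      simp only [map_mul, map_sub, map_add, rename_X, rename_C, Equiv.swap_apply_left,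
        Equiv.swap_apply_right, rename_adj_adj] at hm'
      rw [e2]
      apply mul_left_cancel₀ (X_sub_X_ne_zero (R := K) i hi)
      generalize rename (adj i hi) (Ψ S) = A' at *
      generalize rename (adj i hi) (Ψ (S ∘ adj i hi)) = B' at *
      generalize Ψ S = A at *
      generalize Ψ (S ∘ adj i hi) = B at *
      generalize (C (q : K) : MvPolynomial (Fin N) K) = Q at *
      generalize (C ((q⁻¹ : Kˣ) : K) : MvPolynomial (Fin N) K) = Q' at *
      generalize (X ⟨i, _⟩ : MvPolynomial (Fin N) K) = a at *
      generalize (X ⟨i + 1, _⟩ : MvPolynomial (Fin N) K) = b at *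
      linear_combination -(b - a) ^ 2 * B * hq + (Q * a - Q' * b) * hm' + (Q * b - Q' * a) * hm -
        Q' * (b - a) * hm
    · have e2 : ∑ p, (wt p * LinkPattern.iota ((q⁻¹ : Kˣ) : K) (LinkPattern.connect i hi p) S) • c p =
          Ψ (S ∘ adj i hi) - C (q : K) * Ψ S := by
        rw [hc, hc, Finset.mul_sum, ← Finset.sum_sub_distrib]
        refine Finset.sum_congr rfl fun p _ => ?_
        rw [hwt]; dsimp only
        rw [LinkPattern.iota_connect hxy i hi h0 h1, add_smul, neg_mul, neg_smul, mul_smul, C_mul']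
        abel
      rw [e2]
      linear_combination h.move S i hi h0 h1
    · have := h.eq S i hi (by rw [h0, h1])
      rw [this, sub_self, Finset.sum_eq_zero, mul_zero]
      intro p _
      rw [LinkPattern.iota_connect_of_eq i hi (by rw [h0, h1]), mul_zero, zero_smul]
  intro σ
  have := LinkPattern.coeff_mem ⊥ _ key σ
  rw [Submodule.mem_bot, sub_eq_zero] at this
  exact this

/-- Only the rainbow contributes to the configuration whose up steps come first. -/
theorem rainbow_coeff {R M : Type*} [CommRing R] [AddCommGroup M] [Module R M] {n : ℕ} (x : R)
    (c : LinkPattern (2 * n) → M) :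
    ∑ p, LinkPattern.iota x p (initial (2 * n) n) • c p = c (LinkPattern.rainbow n) := by
  rw [Finset.sum_eq_single (LinkPattern.rainbow n)]
  · rw [← LinkPattern.rainbow_up, LinkPattern.iota_up, one_smul]
  · intro p _ hp
    have : LinkPattern.iota x p (initial (2 * n) n) = 0 := by
      by_contra h
      have hcomp := LinkPattern.compatible_of_iota_ne_zero h
      refine hp (LinkPattern.eq_of_up_eq ?_)
      rw [LinkPattern.rainbow_up]
      funext j
      have hj := hcomp j
      simp only [initial] at hj ⊢
      by_cases hjn : j.val < n
      · rw [decide_eq_true hjn] at hj ⊢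
        rw [p.up_eq_true, Fin.lt_def]
        simp at hj; omega
      · rw [decide_eq_false hjn] at hj ⊢
        rw [p.up_eq_false, Fin.lt_def]
        simp at hj; omega
    rw [this, zero_smul]
  · simp

end QKZ

/-! ### Degrees -/

namespace QKZ

variable {N : ℕ} {K : Type*} [Field K]

theorem degreeOf_linear {a b : K} (ha : a ≠ 0) (hb : b ≠ 0) {i k : Fin N} (hik : i ≠ k) (j : Fin N) :
    degreeOf j (C a * X i - C b * X k) = if j = i ∨ j = k then 1 else 0 := by
  apply le_antisymm
  · refine (degreeOf_sub_le j _ _).trans (max_le ?_ ?_) <;>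
      refine (degreeOf_C_mul_le _ _ _).trans ?_ <;> rw [degreeOf_X] <;> split_ifs <;> simp_all
  · split_ifs with h
    · rcases h with rfl | rfl
      · have := monomial_le_degreeOf (f := C a * X j - C b * X k) (m := Finsupp.single j 1) j (by
          simp [coeff_C_mul, coeff_X, Finsupp.single_left_inj, ha, hik.symm])
        simpa using this
      · have := monomial_le_degreeOf (f := C a * X i - C b * X j) (m := Finsupp.single j 1) j (by
          simp [coeff_C_mul, coeff_X, Finsupp.single_left_inj, hb, hik])
        simpa using this
    · exact Nat.zero_le _

theorem totalDegree_linear {a b : K} (ha : a ≠ 0) (hb : b ≠ 0) {i k : Fin N} (hik : i ≠ k) :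
    (C a * X i - C b * X k : MvPolynomial (Fin N) K).totalDegree = 1 := by
  apply le_antisymm
  · refine (totalDegree_sub _ _).trans (max_le ?_ ?_) <;>
      refine (totalDegree_mul _ _).trans ?_ <;> rw [totalDegree_C, totalDegree_X]
  · have := degreeOf_le_totalDegree (C a * X i - C b * X k) i
    rwa [degreeOf_linear ha hb hik, if_pos (Or.inl rfl)] at this

theorem coeff_quadratic {a b : K} (i k : Fin N) :
    coeff (Finsupp.single i 1 + Finsupp.single k 1) (C a * X i * X k - C b) = a := by
  have h : (0 : Fin N →₀ ℕ) ≠ Finsupp.single i 1 + Finsupp.single k 1 := by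
    intro h
    have := DFunLike.congr_fun h i
    simp only [Finsupp.coe_zero, Pi.zero_apply, Finsupp.add_apply, Finsupp.single_eq_same] at this
    omega
  rw [coeff_sub, coeff_mul_X, coeff_C_mul, coeff_X, if_pos rfl, mul_one, coeff_C,
    if_neg h, sub_zero]

theorem degreeOf_quadratic {a : K} (ha : a ≠ 0) (b : K) {i k : Fin N} (hik : i ≠ k) (j : Fin N) :
    degreeOf j (C a * X i * X k - C b) = if j = i ∨ j = k then 1 else 0 := by
  apply le_antisymm
  · refine (degreeOf_sub_le j _ _).trans (max_le ?_ (by rw [degreeOf_C]; exact Nat.zero_le _))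
    refine (degreeOf_mul_le _ _ _).trans ?_
    refine (add_le_add (degreeOf_C_mul_le _ _ _) le_rfl).trans ?_
    rw [degreeOf_X, degreeOf_X]
    by_cases h1 : j = i
    · simp [h1, hik]
    · simp [h1]
  · have := monomial_le_degreeOf (f := C a * X i * X k - C b)
      (m := Finsupp.single i 1 + Finsupp.single k 1) j (by
        rw [mem_support_iff, coeff_quadratic]; exact ha)
    refine le_trans ?_ this
    split_ifs with h
    · rcases h with rfl | rfl <;> simp
    · exact Nat.zero_le _

theorem totalDegree_quadratic {a : K} (ha : a ≠ 0) (b : K) (i k : Fin N) :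
    (C a * X i * X k - C b : MvPolynomial (Fin N) K).totalDegree = 2 := by
  apply le_antisymm
  · refine (totalDegree_sub _ _).trans (max_le ?_ (by rw [totalDegree_C]; exact Nat.zero_le _))
    refine (totalDegree_mul _ _).trans ?_
    refine (add_le_add (totalDegree_mul _ _) le_rfl).trans ?_
    rw [totalDegree_C, totalDegree_X, totalDegree_X]
  · have := le_totalDegree (p := C a * X i * X k - C b)
      (s := Finsupp.single i 1 + Finsupp.single k 1) (by
        rw [mem_support_iff, coeff_quadratic]; exact ha)
    rw [Finsupp.sum_add_index' (by simp) (by simp)] at this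
    simpa using this

theorem degreeOf_unary {a : K} (ha : a ≠ 0) (b : K) (i j : Fin N) :
    degreeOf j (C a * X i - C b) = if j = i then 1 else 0 := by
  apply le_antisymm
  · refine (degreeOf_sub_le j _ _).trans (max_le ?_ (by rw [degreeOf_C]; exact Nat.zero_le _))
    refine (degreeOf_C_mul_le _ _ _).trans ?_
    rw [degreeOf_X]
  · split_ifs with h
    · subst h
      have h0 : (0 : Fin N →₀ ℕ) ≠ Finsupp.single j 1 := by
        intro h
        have := DFunLike.congr_fun h j
        simp at this
      have := monomial_le_degreeOf (f := C a * X j - C b) (m := Finsupp.single j 1) j (by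
        rw [mem_support_iff, coeff_sub, coeff_C_mul, coeff_X, coeff_C, if_neg h0]; simpa using ha)
      simpa using this
    · exact Nat.zero_le _

theorem totalDegree_unary {a : K} (ha : a ≠ 0) (b : K) (i : Fin N) :
    (C a * X i - C b : MvPolynomial (Fin N) K).totalDegree = 1 := by
  apply le_antisymm
  · refine (totalDegree_sub _ _).trans (max_le ?_ (by rw [totalDegree_C]; exact Nat.zero_le _))
    refine (totalDegree_mul _ _).trans ?_
    rw [totalDegree_C, totalDegree_X]
  · have := degreeOf_le_totalDegree (C a * X i - C b) i
    rwa [degreeOf_unary ha b, if_pos rfl] at this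

theorem ne_zero_of_totalDegree_ne_zero {f : MvPolynomial (Fin N) K} (h : f.totalDegree ≠ 0) : f ≠ 0 := by
  rintro rfl; simp at h

/-- The number of pairs `i < k` of elements of a set that contain a given element `j` of it. -/
theorem sum_pairs_mem (P : Fin N → Prop) [DecidablePred P] (j : Fin N) :
    ∑ p : Fin N × Fin N with p.1 < p.2 ∧ P p.1 ∧ P p.2, (if j = p.1 ∨ j = p.2 then 1 else 0) =
      if P j then #{i | P i} - 1 else 0 := by
  have h1 : ∑ p : Fin N × Fin N with p.1 < p.2 ∧ P p.1 ∧ P p.2, (if j = p.1 ∨ j = p.2 then 1 else 0) =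
      ∑ i : Fin N, ∑ k : Fin N, ((if i = j then (if j < k ∧ P j ∧ P k then 1 else 0) else 0) +
        if k = j then (if i < j ∧ P i ∧ P j then 1 else 0) else 0) := by
    rw [Finset.sum_filter, Fintype.sum_prod_type]
    refine Finset.sum_congr rfl fun i _ => Finset.sum_congr rfl fun k _ => ?_
    dsimp only
    by_cases e1 : i = j
    · subst e1
      by_cases e2 : k = i
      · subst e2; simp
      · simp [e2]
    · by_cases e2 : k = j
      · subst e2; simp [e1]
      · simp [e1, e2, Ne.symm e1, Ne.symm e2]
  rw [h1]
  simp only [Finset.sum_add_distrib, Finset.sum_ite_eq', mem_univ, if_true]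
  rw [Finset.sum_comm]
  simp only [Finset.sum_ite_eq', mem_univ, if_true]
  rw [← Finset.sum_add_distrib]
  split_ifs with hj
  · have h2 : #{i | P i} - 1 = #(({i | P i} : Finset (Fin N)).erase j) := by
      rw [Finset.card_erase_of_mem (by simp [hj])]
    rw [h2, Finset.card_eq_sum_ones, ← Finset.filter_ne', Finset.filter_filter, Finset.sum_filter]
    refine Finset.sum_congr rfl fun k _ => ?_
    rcases lt_trichotomy j k with h | h | h
    · simp [h, hj, h.ne', not_lt.2 h.le]
    · simp [h]
    · simp [h, hj, h.ne, not_lt.2 h.le]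
  · simp [hj]

theorem two_mul_card_pairs (P : Fin N → Prop) [DecidablePred P] :
    2 * #{p : Fin N × Fin N | p.1 < p.2 ∧ P p.1 ∧ P p.2} = #{i | P i} * (#{i | P i} - 1) := by
  have h : ∑ j : Fin N, ∑ p : Fin N × Fin N with p.1 < p.2 ∧ P p.1 ∧ P p.2,
      (if j = p.1 ∨ j = p.2 then 1 else 0) = 2 * #{p : Fin N × Fin N | p.1 < p.2 ∧ P p.1 ∧ P p.2} := by
    rw [Finset.sum_comm, mul_comm, ← smul_eq_mul, ← Finset.sum_const]
    refine Finset.sum_congr rfl fun p hp => ?_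
    have hne : p.1 ≠ p.2 := (mem_filter.1 hp).2.1.ne
    rw [← Finset.sum_filter, ← Finset.card_eq_sum_ones, ← Finset.card_pair hne]
    congr 1
    ext j; simp
  rw [← h, Finset.sum_congr rfl fun j _ => sum_pairs_mem P j, ← Finset.sum_filter, Finset.sum_const,
    smul_eq_mul]

section base

variable (q : Kˣ)

theorem leftPair_eq (i k : Fin N) :
    leftPair (C (q : K)) (C ((q⁻¹ : Kˣ) : K)) (X : Fin N → MvPolynomial (Fin N) K) i k =
    -((C (q : K) * X i - C ((q⁻¹ : Kˣ) : K) * X k) *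
      (C ((q : K) ^ 2) * X i * X k - C (((q⁻¹ : Kˣ) : K) ^ 2))) := by
  rw [leftPair, C_pow, C_pow]; ring

theorem degreeOf_leftPair {i k : Fin N} (hik : i ≠ k) (j : Fin N) :
    degreeOf j (leftPair (C (q : K)) (C ((q⁻¹ : Kˣ) : K)) (X : Fin N → MvPolynomial (Fin N) K) i k) =
      2 * if j = i ∨ j = k then 1 else 0 := by
  rw [leftPair_eq, degreeOf_neg, degreeOf_mul_eq, degreeOf_linear q.ne_zero q⁻¹.ne_zero hik,
    degreeOf_quadratic (pow_ne_zero 2 q.ne_zero) _ hik, two_mul]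
  · apply ne_zero_of_totalDegree_ne_zero
    rw [totalDegree_linear q.ne_zero q⁻¹.ne_zero hik]; simp
  · apply ne_zero_of_totalDegree_ne_zero
    rw [totalDegree_quadratic (pow_ne_zero 2 q.ne_zero)]; simp

theorem totalDegree_leftPair {i k : Fin N} (hik : i ≠ k) :
    (leftPair (C (q : K)) (C ((q⁻¹ : Kˣ) : K)) (X : Fin N → MvPolynomial (Fin N) K) i k).totalDegree = 3 := by
  rw [leftPair_eq, totalDegree_neg, totalDegree_mul_of_isDomain,
    totalDegree_linear q.ne_zero q⁻¹.ne_zero hik, totalDegree_quadratic (pow_ne_zero 2 q.ne_zero)]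
  · apply ne_zero_of_totalDegree_ne_zero
    rw [totalDegree_linear q.ne_zero q⁻¹.ne_zero hik]; simp
  · apply ne_zero_of_totalDegree_ne_zero
    rw [totalDegree_quadratic (pow_ne_zero 2 q.ne_zero)]; simp

theorem degreeOf_rightPair {i k : Fin N} (hik : i ≠ k) (j : Fin N) :
    degreeOf j (rightPair (C (q : K)) (C ((q⁻¹ : Kˣ) : K)) (X : Fin N → MvPolynomial (Fin N) K) i k) =
      2 * if j = i ∨ j = k then 1 else 0 := by
  rw [rightPair, degreeOf_mul_eq, degreeOf_linear q.ne_zero q⁻¹.ne_zero hik,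
    degreeOf_quadratic q.ne_zero _ hik, two_mul]
  · apply ne_zero_of_totalDegree_ne_zero
    rw [totalDegree_linear q.ne_zero q⁻¹.ne_zero hik]; simp
  · apply ne_zero_of_totalDegree_ne_zero
    rw [totalDegree_quadratic q.ne_zero]; simp

theorem totalDegree_rightPair {i k : Fin N} (hik : i ≠ k) :
    (rightPair (C (q : K)) (C ((q⁻¹ : Kˣ) : K)) (X : Fin N → MvPolynomial (Fin N) K) i k).totalDegree = 3 := by
  rw [rightPair, totalDegree_mul_of_isDomain,
    totalDegree_linear q.ne_zero q⁻¹.ne_zero hik, totalDegree_quadratic q.ne_zero]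
  · apply ne_zero_of_totalDegree_ne_zero
    rw [totalDegree_linear q.ne_zero q⁻¹.ne_zero hik]; simp
  · apply ne_zero_of_totalDegree_ne_zero
    rw [totalDegree_quadratic q.ne_zero]; simp

theorem totalDegree_prod {ι : Type*} (s : Finset ι) (f : ι → MvPolynomial (Fin N) K)
    (h : ∀ i ∈ s, f i ≠ 0) : (∏ i ∈ s, f i).totalDegree = ∑ i ∈ s, (f i).totalDegree := by
  classical
  induction s using Finset.induction_on with
  | empty => simp
  | insert a s ha ih =>
    rw [Finset.prod_insert ha, Finset.sum_insert ha, totalDegree_mul_of_isDomain (h a (by simp)),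
      ih fun i hi => h i (by simp [hi])]
    exact Finset.prod_ne_zero_iff.2 fun i hi => h i (by simp [hi])

theorem pairProd_degrees {P : Fin N → Prop} [DecidablePred P] {f : Fin N → Fin N → MvPolynomial (Fin N) K}
    (h1 : ∀ i k, i ≠ k → ∀ j, degreeOf j (f i k) = 2 * if j = i ∨ j = k then 1 else 0)
    (h2 : ∀ i k, i ≠ k → (f i k).totalDegree = 3) :
    pairProd P f ≠ 0 ∧
    (∀ j, degreeOf j (pairProd P f) = 2 * if P j then #{i | P i} - 1 else 0) ∧
    2 * (pairProd P f).totalDegree = 3 * (#{i | P i} * (#{i | P i} - 1)) := by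
  have h0 : ∀ p ∈ ({p : Fin N × Fin N | p.1 < p.2 ∧ P p.1 ∧ P p.2} : Finset _), f p.1 p.2 ≠ 0 := by
    intro p hp
    apply ne_zero_of_totalDegree_ne_zero
    rw [h2 _ _ (mem_filter.1 hp).2.1.ne]; simp
  refine ⟨Finset.prod_ne_zero_iff.2 h0, fun j => ?_, ?_⟩
  · rw [pairProd, degreeOf_prod_eq _ _ h0, ← sum_pairs_mem, Finset.mul_sum]
    exact Finset.sum_congr rfl fun p hp => h1 _ _ (mem_filter.1 hp).2.1.ne j
  · rw [pairProd, totalDegree_prod _ _ h0,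
      Finset.sum_congr rfl fun p hp => h2 _ _ (mem_filter.1 hp).2.1.ne, Finset.sum_const, smul_eq_mul,
      ← two_mul_card_pairs]
    ring

theorem base_degrees (n : ℕ) : base n q ≠ 0 ∧
    (∀ j, degreeOf j (base n q) = 2 * (n - 1)) ∧ (base n q).totalDegree = 3 * (n * (n - 1)) := by
  obtain ⟨a1, a2, a3⟩ := pairProd_degrees (P := fun i : Fin (2 * n) => i.val < n)
    (fun i k h j => degreeOf_leftPair q h j) (fun i k h => totalDegree_leftPair q h)
  obtain ⟨b1, b2, b3⟩ := pairProd_degrees (P := fun i : Fin (2 * n) => n ≤ i.val)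
    (fun i k h j => degreeOf_rightPair q h j) (fun i k h => totalDegree_rightPair q h)
  have c1 : #{i : Fin (2 * n) | i.val < n} = n := by
    rw [Fin.card_filter_val_lt]; omega
  have c2 : #{i : Fin (2 * n) | n ≤ i.val} = n := by
    have h := Finset.card_filter_add_card_filter_not (s := (univ : Finset (Fin (2 * n)))) (fun i => i.val < n)
    simp only [not_lt, card_univ, Fintype.card_fin] at h
    omega
  rw [c1] at a2 a3
  rw [c2] at b2 b3
  refine ⟨mul_ne_zero a1 b1, fun j => ?_, ?_⟩
  · rw [base, cutProd, degreeOf_mul_eq a1 b1, a2, b2]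
    by_cases hj : j.val < n
    · rw [if_pos hj, if_neg (by omega)]; omega
    · rw [if_neg hj, if_pos (by omega)]; omega
  · rw [base, cutProd, totalDegree_mul_of_isDomain a1 b1]
    omega

end base

end QKZ

/-! ### Degrees and reciprocity of the solution -/

namespace QKZ

theorem two_mul_pos {n : ℕ} (hn : 0 < n) : 0 < 2 * n := by omega

theorem two_mul_sub_one_lt {n : ℕ} (hn : 0 < n) : 2 * n - 1 < 2 * n := by omega

variable {N : ℕ} {K : Type*} [Field K]

theorem sub_eq_linear {i k : Fin N} :
    (X i - X k : MvPolynomial (Fin N) K) = C (1 : K) * X i - C (1 : K) * X k := by simp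

theorem degreeOf_le_of_move {q : Kˣ} {i : ℕ} {hi : i + 1 < N} {f g : MvPolynomial (Fin N) K}
    (h : (X ⟨i + 1, hi⟩ - X ⟨i, by omega⟩) * g =
      (C (q : K) * X ⟨i, by omega⟩ - C ((q⁻¹ : Kˣ) : K) * X ⟨i + 1, hi⟩) * rename (adj i hi) f +
        (C ((q⁻¹ : Kˣ) : K) - C (q : K)) * X ⟨i, by omega⟩ * f) {d : ℕ}
    (hf : ∀ j, degreeOf j f ≤ d) (j : Fin N) : degreeOf j g ≤ d := by
  rcases eq_or_ne g 0 with rfl | hg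
  · simp
  have hne : (⟨i + 1, hi⟩ : Fin N) ≠ ⟨i, by omega⟩ := by simp
  have h1 := congrArg (degreeOf j) h
  rw [degreeOf_mul_eq (X_sub_X_ne_zero i hi) hg, sub_eq_linear,
    degreeOf_linear one_ne_zero one_ne_zero hne] at h1
  have h2 : degreeOf j (rename (adj i hi) f) ≤ d := by
    have := degreeOf_rename_of_injective (p := f) (adj i hi).injective (adj i hi j)
    rw [Equiv.swap_apply_self] at this
    rw [this]; exact hf _
  have h3 : degreeOf j ((C (q : K) * X ⟨i, by omega⟩ - C ((q⁻¹ : Kˣ) : K) * X ⟨i + 1, hi⟩) *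
      rename (adj i hi) f) ≤ (if j = ⟨i + 1, hi⟩ ∨ j = ⟨i, by omega⟩ then 1 else 0) + d := by
    refine (degreeOf_mul_le _ _ _).trans (add_le_add ?_ h2)
    rw [degreeOf_linear q.ne_zero q⁻¹.ne_zero hne.symm]
    simp only [or_comm, le_refl]
  have h4 : degreeOf j ((C ((q⁻¹ : Kˣ) : K) - C (q : K)) * X ⟨i, by omega⟩ * f) ≤
      (if j = ⟨i + 1, hi⟩ ∨ j = ⟨i, by omega⟩ then 1 else 0) + d := by
    refine (degreeOf_mul_le _ _ _).trans (add_le_add ?_ (hf j))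
    rw [← C_sub]
    refine (degreeOf_C_mul_le _ _ _).trans ?_
    rw [degreeOf_X]
    split_ifs <;> simp_all
  have h5 := (degreeOf_add_le j _ _).trans (max_le h3 h4)
  omega

theorem totalDegree_le_of_move {q : Kˣ} {i : ℕ} {hi : i + 1 < N} {f g : MvPolynomial (Fin N) K}
    (h : (X ⟨i + 1, hi⟩ - X ⟨i, by omega⟩) * g =
      (C (q : K) * X ⟨i, by omega⟩ - C ((q⁻¹ : Kˣ) : K) * X ⟨i + 1, hi⟩) * rename (adj i hi) f +
        (C ((q⁻¹ : Kˣ) : K) - C (q : K)) * X ⟨i, by omega⟩ * f) :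
    g.totalDegree ≤ f.totalDegree := by
  rcases eq_or_ne g 0 with rfl | hg
  · simp
  have hne : (⟨i + 1, hi⟩ : Fin N) ≠ ⟨i, by omega⟩ := by simp
  have h1 := congrArg MvPolynomial.totalDegree h
  rw [totalDegree_mul_of_isDomain (X_sub_X_ne_zero i hi) hg, sub_eq_linear,
    totalDegree_linear one_ne_zero one_ne_zero hne] at h1
  have h3 : ((C (q : K) * X ⟨i, by omega⟩ - C ((q⁻¹ : Kˣ) : K) * X ⟨i + 1, hi⟩) *
      rename (adj i hi) f : MvPolynomial (Fin N) K).totalDegree ≤ 1 + f.totalDegree := by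
    refine (totalDegree_mul _ _).trans (add_le_add ?_ (totalDegree_rename_le _ _))
    rw [totalDegree_linear q.ne_zero q⁻¹.ne_zero hne.symm]
  have h4 : ((C ((q⁻¹ : Kˣ) : K) - C (q : K)) * X ⟨i, by omega⟩ * f :
      MvPolynomial (Fin N) K).totalDegree ≤ 1 + f.totalDegree := by
    refine (totalDegree_mul _ _).trans (add_le_add ?_ le_rfl)
    rw [← C_sub]
    refine (totalDegree_mul _ _).trans ?_
    rw [totalDegree_C, totalDegree_X]
  have h5 := (totalDegree_add _ _).trans (max_le h3 h4)
  omega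

section Recip

variable {F : Type*} [Field F] [Algebra K F]

/-- Reciprocity of degree `d` in the variable `a`: the substitution `w_a ↦ c / w_a` multiplies `f` by
`(e w_a)^{-d}`. -/
def Recip (F : Type*) [Field F] [Algebra K F] (a : Fin N) (c e : K) (d : ℕ) (f : MvPolynomial (Fin N) K) :
    Prop :=
  ∀ x : Fin N → F, Function.Injective x → x a ≠ 0 →
    (algebraMap K F e * x a) ^ d * aeval (Function.update x a (algebraMap K F c / x a)) f = aeval x f

/-- Demazure--Lusztig operators that do not involve the variable `a` preserve reciprocity in it. -/
theorem Recip.of_move {q : Kˣ} {i : ℕ} {hi : i + 1 < N} {f g : MvPolynomial (Fin N) K}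
    (h : (X ⟨i + 1, hi⟩ - X ⟨i, by omega⟩) * g =
      (C (q : K) * X ⟨i, by omega⟩ - C ((q⁻¹ : Kˣ) : K) * X ⟨i + 1, hi⟩) * rename (adj i hi) f +
        (C ((q⁻¹ : Kˣ) : K) - C (q : K)) * X ⟨i, by omega⟩ * f) {a : Fin N} {c e : K} {d : ℕ}
    (h1 : a ≠ ⟨i, by omega⟩) (h2 : a ≠ ⟨i + 1, hi⟩) (hf : Recip F a c e d f) : Recip F a c e d g := by
  intro x hx hxa
  have ha : adj i hi a = a := Equiv.swap_apply_of_ne_of_ne h1 h2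
  have hupd : Function.update x a (algebraMap K F c / x a) ∘ adj i hi =
      Function.update (x ∘ adj i hi) a (algebraMap K F c / x a) := by
    funext j
    simp only [Function.comp, Function.update_apply]
    by_cases hj : j = a
    · rw [hj, ha]
    · rw [if_neg hj, if_neg]
      intro e
      exact hj ((adj i hi).injective (e.trans ha.symm))
  have k1 := congrArg (aeval x) h
  have k2 := congrArg (aeval (Function.update x a (algebraMap K F c / x a))) h
  simp only [map_mul, map_sub, map_add, aeval_X, algHom_C, aeval_rename, hupd,
    Function.update_of_ne h1.symm, Function.update_of_ne h2.symm] at k1 k2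
  have k3 := hf x hx hxa
  have k4 := hf (x ∘ adj i hi) (hx.comp (adj i hi).injective) (by rwa [Function.comp, ha])
  simp only [Function.comp_apply, ha] at k4
  have hne : x ⟨i + 1, hi⟩ - x ⟨i, by omega⟩ ≠ 0 := sub_ne_zero.2 fun e => by
    have := hx e
    simp at this
  apply mul_left_cancel₀ hne
  rw [k1, ← k3, ← k4]
  linear_combination (algebraMap K F e * x a) ^ d * k2

/-- Reciprocal polynomials, as a subspace. -/
def recipSubmodule (F : Type*) [Field F] [Algebra K F] (a : Fin N) (c e : K) (d : ℕ) :
    Submodule K (MvPolynomial (Fin N) K) where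
  carrier := {f | Recip F a c e d f}
  zero_mem' := by intro x _ _; simp
  add_mem' := by
    intro f g hf hg x hx hxa
    rw [map_add, map_add, mul_add, hf x hx hxa, hg x hx hxa]
  smul_mem' := by
    intro t f hf x hx hxa
    rw [map_smul, map_smul, mul_smul_comm, hf x hx hxa]

theorem pairProd_congr {M : Type*} [CommMonoid M] {P : Fin N → Prop} [DecidablePred P]
    {f g : Fin N → Fin N → M} (h : ∀ i k, i < k → P i → P k → f i k = g i k) :
    pairProd P f = pairProd P g :=
  Finset.prod_congr rfl fun p hp => by
    have := (mem_filter.1 hp).2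
    exact h _ _ this.1 this.2.1 this.2.2

theorem recip_base_zero (q : Kˣ) {n : ℕ} (hn : 0 < n) :
    Recip F (⟨0, two_mul_pos hn⟩ : Fin (2 * n)) ((((q⁻¹ : Kˣ) : K)) ^ 6) ((q : K) ^ 3) (2 * (n - 1)) (base n q) := by
  intro x hx hx0
  set a : Fin (2 * n) := ⟨0, two_mul_pos hn⟩ with ha
  rw [aeval_base, aeval_base, cutProd, cutProd]
  have hQ : algebraMap K F q * algebraMap K F ((q⁻¹ : Kˣ) : K) = 1 := by
    rw [← map_mul, Units.mul_inv, map_one]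
  set Q := algebraMap K F q
  rw [map_pow, map_pow]
  set Q' := algebraMap K F ((q⁻¹ : Kˣ) : K)
  set x' := Function.update x a (Q' ^ 6 / x a) with hx'
  have hne : ∀ j : Fin (2 * n), 0 < j.val → x' j = x j := fun j hj =>
    Function.update_of_ne (by rintro rfl; simp [ha] at hj) _ _
  have hxa : x' a = Q' ^ 6 / x a := Function.update_self _ _ _
  have e1 : ∀ y : Fin (2 * n) → F, pairProd (fun i : Fin (2 * n) => i.val < n) (leftPair Q Q' y) =
      pairProd (fun i : Fin (2 * n) => 0 < i.val ∧ i.val < n) (leftPair Q Q' y) *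
      ∏ j : Fin (2 * n) with 0 < j.val ∧ j.val < n, leftPair Q Q' y a j := fun y =>
    pairProd_insert_left (fun i : Fin (2 * n) => 0 < i.val ∧ i.val < n) _ _ a (fun j hj => hj.1)
      (fun j => by rw [ha, Fin.ext_iff]; dsimp only; omega)
  have e2 : pairProd (fun i : Fin (2 * n) => n ≤ i.val) (rightPair Q Q' x') =
      pairProd (fun i : Fin (2 * n) => n ≤ i.val) (rightPair Q Q' x) :=
    pairProd_congr fun i k _ h1 h2 => by
      rw [rightPair, rightPair, hne i (by omega), hne k (by omega)]
  have e3 : pairProd (fun i : Fin (2 * n) => 0 < i.val ∧ i.val < n) (leftPair Q Q' x') =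
      pairProd (fun i : Fin (2 * n) => 0 < i.val ∧ i.val < n) (leftPair Q Q' x) :=
    pairProd_congr fun i k _ h1 h2 => by
      rw [leftPair, leftPair, hne i (by omega), hne k (by omega)]
  have e4 : (Q ^ 3 * x a) ^ (2 * (n - 1)) *
      ∏ j : Fin (2 * n) with 0 < j.val ∧ j.val < n, leftPair Q Q' x' a j =
      ∏ j : Fin (2 * n) with 0 < j.val ∧ j.val < n, leftPair Q Q' x a j := by
    have hc : #{j : Fin (2 * n) | 0 < j.val ∧ j.val < n} = n - 1 := by
      have h1 : ({j : Fin (2 * n) | 0 < j.val ∧ j.val < n} : Finset _) =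
          ({j : Fin (2 * n) | j.val < n} : Finset _).erase a := by
        ext j; simp only [mem_erase, mem_filter, mem_univ, true_and, ha, ne_eq, Fin.ext_iff]; omega
      rw [h1, Finset.card_erase_of_mem (by simp [ha, hn]), Fin.card_filter_val_lt]; omega
    rw [pow_mul, ← hc, ← Finset.prod_const, ← Finset.prod_mul_distrib]
    refine Finset.prod_congr rfl fun j hj => ?_
    rw [leftPair, leftPair, hne j (mem_filter.1 hj).2.1, hxa]
    have hQ0 : Q ≠ 0 := left_ne_zero_of_mul_eq_one hQ
    have hQ' : Q' = Q⁻¹ := (eq_inv_of_mul_eq_one_right hQ)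
    rw [hQ']
    field_simp
  rw [e1, e1 x, e2, e3, ← e4]
  ring

theorem recip_base_last (q : Kˣ) {n : ℕ} (hn : 0 < n) :
    Recip F (⟨2 * n - 1, two_mul_sub_one_lt hn⟩ : Fin (2 * n)) (1 : K) (1 : K) (2 * (n - 1)) (base n q) := by
  intro x hx hx0
  set a : Fin (2 * n) := ⟨2 * n - 1, two_mul_sub_one_lt hn⟩ with ha
  rw [aeval_base, aeval_base, cutProd, cutProd]
  rw [map_one, one_mul]
  set Q := algebraMap K F q
  set Q' := algebraMap K F ((q⁻¹ : Kˣ) : K)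
  set x' := Function.update x a (1 / x a) with hx'
  have hne : ∀ j : Fin (2 * n), j.val < 2 * n - 1 → x' j = x j := fun j hj =>
    Function.update_of_ne (by rintro rfl; simp [ha] at hj) _ _
  have hxa : x' a = 1 / x a := Function.update_self _ _ _
  have e1 : ∀ y : Fin (2 * n) → F, pairProd (fun i : Fin (2 * n) => n ≤ i.val) (rightPair Q Q' y) =
      pairProd (fun i : Fin (2 * n) => n ≤ i.val ∧ i.val < 2 * n - 1) (rightPair Q Q' y) *
      ∏ j : Fin (2 * n) with n ≤ j.val ∧ j.val < 2 * n - 1, rightPair Q Q' y j a := fun y =>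
    pairProd_insert_right (fun i : Fin (2 * n) => n ≤ i.val ∧ i.val < 2 * n - 1) _ _ a (fun j hj => hj.2)
      (fun j => by rw [ha, Fin.ext_iff]; dsimp only; omega)
  have e2 : pairProd (fun i : Fin (2 * n) => i.val < n) (leftPair Q Q' x') =
      pairProd (fun i : Fin (2 * n) => i.val < n) (leftPair Q Q' x) :=
    pairProd_congr fun i k _ h1 h2 => by
      rw [leftPair, leftPair, hne i (by omega), hne k (by omega)]
  have e3 : pairProd (fun i : Fin (2 * n) => n ≤ i.val ∧ i.val < 2 * n - 1) (rightPair Q Q' x') =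
      pairProd (fun i : Fin (2 * n) => n ≤ i.val ∧ i.val < 2 * n - 1) (rightPair Q Q' x) :=
    pairProd_congr fun i k _ h1 h2 => by
      rw [rightPair, rightPair, hne i (by omega), hne k (by omega)]
  have e4 : x a ^ (2 * (n - 1)) *
      ∏ j : Fin (2 * n) with n ≤ j.val ∧ j.val < 2 * n - 1, rightPair Q Q' x' j a =
      ∏ j : Fin (2 * n) with n ≤ j.val ∧ j.val < 2 * n - 1, rightPair Q Q' x j a := by
    have hc : #{j : Fin (2 * n) | n ≤ j.val ∧ j.val < 2 * n - 1} = n - 1 := by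
      have h1 : ({j : Fin (2 * n) | n ≤ j.val ∧ j.val < 2 * n - 1} : Finset _) =
          ({j : Fin (2 * n) | ¬ j.val < n} : Finset _).erase a := by
        ext j; simp only [mem_erase, mem_filter, mem_univ, true_and, ha, ne_eq, Fin.ext_iff]; omega
      have h2 := Finset.card_filter_add_card_filter_not (s := (univ : Finset (Fin (2 * n)))) (fun i => i.val < n)
      rw [Fin.card_filter_val_lt, card_univ, Fintype.card_fin] at h2
      rw [h1, Finset.card_erase_of_mem (by simp [ha]; omega)]; omega
    rw [pow_mul, ← hc, ← Finset.prod_const, ← Finset.prod_mul_distrib]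
    refine Finset.prod_congr rfl fun j hj => ?_
    rw [rightPair, rightPair, hne j (mem_filter.1 hj).2.2, hxa]
    field_simp
  rw [e1, e1 x, e2, e3, ← e4]
  ring

end Recip

/-- A solution of the exchange relations in the basis of link patterns, with the first component
factorized, of minimal degree and reciprocal in the first and in the last variable. -/
theorem exists_isLoop (F : Type*) [Field F] [Algebra K F] (q : Kˣ) {n : ℕ} (hn : 0 < n) :
    ∃ c : LinkPattern (2 * n) → MvPolynomial (Fin (2 * n)) K, IsLoop q c ∧
      c (LinkPattern.rainbow n) = base n q ∧ (∀ p j, degreeOf j (c p) ≤ 2 * (n - 1)) ∧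
      (∀ p, (c p).totalDegree ≤ 3 * (n * (n - 1))) ∧
      (∀ p, Recip F ⟨0, two_mul_pos hn⟩ ((((q⁻¹ : Kˣ) : K)) ^ 6) ((q : K) ^ 3) (2 * (n - 1)) (c p)) ∧
      ∀ p, Recip F ⟨2 * n - 1, two_mul_sub_one_lt hn⟩ 1 1 (2 * (n - 1)) (c p) := by
  obtain ⟨Ψ, c, hΨ, h0, hc⟩ := exists_isSpin q hn
  have hmain : ∀ S : Config (2 * n), ht S (2 * n) = 2 * n - (2 * n : ℕ) → S ⟨0, two_mul_pos hn⟩ = true →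
      S ⟨2 * n - 1, two_mul_sub_one_lt hn⟩ = false →
      (∀ j, degreeOf j (Ψ S) ≤ 2 * (n - 1)) ∧ (Ψ S).totalDegree ≤ 3 * (n * (n - 1)) ∧
      Recip F ⟨0, two_mul_pos hn⟩ ((((q⁻¹ : Kˣ) : K)) ^ 6) ((q : K) ^ 3) (2 * (n - 1)) (Ψ S) ∧
      Recip F ⟨2 * n - 1, two_mul_sub_one_lt hn⟩ 1 1 (2 * (n - 1)) (Ψ S) := by
    refine config_induction _ ?_ ?_
    · intro _ _
      rw [h0]
      exact ⟨fun j => ((base_degrees q n).2.1 j).le, (base_degrees q n).2.2.le, recip_base_zero q hn,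
        recip_base_last q hn⟩
    · intro S i hi _ i0 i1 ih s0 s1
      have g1 : i ≠ 0 := by rintro rfl; rw [s0] at i0; exact absurd i0 (by simp)
      have g2 : i + 1 ≠ 2 * n - 1 := by
        intro e
        simp only [e] at i1
        rw [s1] at i1; exact absurd i1 (by simp)
      obtain ⟨k1, k2, k3, k4⟩ := ih
        (by simp only [Function.comp]; rw [adj_of_ne hi _ (by omega) (by omega), s0])
        (by simp only [Function.comp]; rw [adj_of_ne hi _ (by omega) (by omega), s1])
      have hm := hΨ.move (S ∘ adj i hi) i hi (by simpa using i1) (by simpa using i0)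
      rw [comp_adj_comp_adj] at hm
      exact ⟨degreeOf_le_of_move hm k1, (totalDegree_le_of_move hm).trans k2,
        k3.of_move hm (by simp [Fin.ext_iff]; omega) (by simp [Fin.ext_iff]),
        k4.of_move hm (by simp [Fin.ext_iff]; omega) (by simp [Fin.ext_iff]; omega)⟩
  have hup := fun s : LinkPattern (2 * n) => hmain s.up
    (by rw [s.compatible_up.ht_eq_zero]; push_cast; ring)
    (by
      rw [s.up_eq_true, Fin.lt_def]
      have := s.apply_ne ⟨0, two_mul_pos hn⟩
      rw [ne_eq, Fin.ext_iff] at this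
      dsimp only at this ⊢
      omega)
    (by
      rw [s.up_eq_false, Fin.lt_def]
      have := s.apply_ne ⟨2 * n - 1, two_mul_sub_one_lt hn⟩
      have h2 := (s.1 ⟨2 * n - 1, two_mul_sub_one_lt hn⟩).2
      rw [ne_eq, Fin.ext_iff] at this
      dsimp only at this ⊢
      omega)
  have hmem : ∀ W : Submodule K (MvPolynomial (Fin (2 * n)) K), (∀ s : LinkPattern (2 * n), Ψ s.up ∈ W) →
      ∀ s, c s ∈ W := fun W hW => LinkPattern.coeff_mem W c fun s => by rw [← hc]; exact hW s
  refine ⟨c, hΨ.isLoop hc, ?_, fun p j => ?_, fun p => ?_, fun p => ?_, fun p => ?_⟩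
  · rw [← rainbow_coeff ((q⁻¹ : Kˣ) : K) c, ← hc, h0]
  · rw [degreeOf_le_iff]
    have := hmem (restrictDegree _ K (2 * (n - 1))) (fun s => by
      rw [mem_restrictDegree]
      exact fun m hm j => degreeOf_le_iff.1 ((hup s).1 j) m hm) p
    rw [mem_restrictDegree] at this
    exact fun m hm => this m hm j
  · have := hmem (restrictTotalDegree _ K (3 * (n * (n - 1)))) (fun s => by
      rw [mem_restrictTotalDegree]
      exact (hup s).2.1) p
    rwa [mem_restrictTotalDegree] at this
  · exact hmem (recipSubmodule F _ _ _ _) (fun s => (hup s).2.2.1) p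
  · exact hmem (recipSubmodule F _ _ _ _) (fun s => (hup s).2.2.2) p

end QKZ

/-! ### The polynomial solution of the system -/

namespace QKZ

variable {N : ℕ} {K : Type*} [Field K]

theorem w_injective : Function.Injective (BqKZ.w : Fin N → BqKZ.RatFun K N) := gen_injective

theorem eq_of_aeval_w {f g : MvPolynomial (Fin N) K}
    (h : aeval (BqKZ.w : Fin N → BqKZ.RatFun K N) f = aeval BqKZ.w g) : f = g :=
  eq_of_aeval_gen h

theorem aeval_w_ne_zero {f : MvPolynomial (Fin N) K} (h : f ≠ 0) :
    aeval (BqKZ.w : Fin N → BqKZ.RatFun K N) f ≠ 0 := fun e =>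
  h (eq_of_aeval_w (e.trans (map_zero _).symm))

theorem w_ne_zero (j : Fin N) : (BqKZ.w j : BqKZ.RatFun K N) ≠ 0 := by
  have := aeval_w_ne_zero (K := K) (X_ne_zero j)
  rwa [aeval_X] at this

theorem unary_ne_zero {a b : K} (h : a ≠ 0) (j : Fin N) :
    algebraMap K (BqKZ.RatFun K N) a * BqKZ.w j - algebraMap K (BqKZ.RatFun K N) b ≠ 0 := by
  have := aeval_w_ne_zero (ne_zero_of_totalDegree_ne_zero (f := C a * X j - C b) (by
    rw [totalDegree_unary h]; simp))
  simpa using this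

theorem linear_ne_zero {a b : K} (ha : a ≠ 0) (hb : b ≠ 0) {i j : Fin N} (hij : i ≠ j) :
    algebraMap K (BqKZ.RatFun K N) a * BqKZ.w i - algebraMap K (BqKZ.RatFun K N) b * BqKZ.w j ≠ 0 := by
  have := aeval_w_ne_zero (ne_zero_of_totalDegree_ne_zero (f := C a * X i - C b * X j) (by
    rw [totalDegree_linear ha hb hij]; simp))
  simpa using this

/-- The first equations of the system, with denominators cleared. -/
theorem isLoop_iff (q : Kˣ) (Ψ : LinkPattern N → MvPolynomial (Fin N) K) :
    IsLoop q Ψ ↔ ∀ (i : ℕ) (hi : i + 1 < N),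
      (BqKZ.RMatrix (algebraMap K (BqKZ.RatFun K N) q) i hi
        (BqKZ.w ⟨i + 1, hi⟩ / BqKZ.w ⟨i, by omega⟩)).mulVec (BqKZ.subst BqKZ.w Ψ) =
      BqKZ.subst (BqKZ.w ∘ Equiv.swap ⟨i, by omega⟩ ⟨i + 1, hi⟩) Ψ := by
  refine forall_congr' fun i => forall_congr' fun hi => ?_
  rw [funext_iff]
  refine forall_congr' fun σ => ?_
  have hne : (⟨i, by omega⟩ : Fin N) ≠ ⟨i + 1, hi⟩ := by simp
  have hw := w_ne_zero (K := K) (⟨i, by omega⟩ : Fin N)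
  have hd : algebraMap K (BqKZ.RatFun K N) q * BqKZ.w ⟨i, by omega⟩ -
      (algebraMap K (BqKZ.RatFun K N) q)⁻¹ * BqKZ.w ⟨i + 1, hi⟩ ≠ 0 := by
    rw [← map_inv₀]
    exact linear_ne_zero q.ne_zero (inv_ne_zero q.ne_zero) hne
  have hs : (BqKZ.tlMatrix (-(algebraMap K (BqKZ.RatFun K N) q + (algebraMap K (BqKZ.RatFun K N) q)⁻¹))
      i hi).mulVec (BqKZ.subst BqKZ.w Ψ) σ = aeval BqKZ.w (∑ p with LinkPattern.connect i hi p = σ,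
        (if p.1 ⟨i, by omega⟩ = ⟨i + 1, hi⟩ then -((q : K) + ((q⁻¹ : Kˣ) : K)) else 1) • Ψ p) := by
    rw [Matrix.mulVec, dotProduct, map_sum, Finset.sum_filter]
    refine Finset.sum_congr rfl fun p _ => ?_
    rw [BqKZ.tlMatrix, Matrix.of_apply]
    split_ifs with h1 h2
    · rw [map_smul, Algebra.smul_def]
      simp [BqKZ.subst]
    · rw [one_mul, one_smul]; rfl
    · rw [zero_mul]
  have hR : (BqKZ.RMatrix (algebraMap K (BqKZ.RatFun K N) q) i hi
        (BqKZ.w ⟨i + 1, hi⟩ / BqKZ.w ⟨i, by omega⟩)).mulVec (BqKZ.subst BqKZ.w Ψ) σ =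
      (algebraMap K (BqKZ.RatFun K N) q * BqKZ.w ⟨i, by omega⟩ -
        (algebraMap K (BqKZ.RatFun K N) q)⁻¹ * BqKZ.w ⟨i + 1, hi⟩)⁻¹ *
      ((algebraMap K (BqKZ.RatFun K N) q * BqKZ.w ⟨i + 1, hi⟩ -
        (algebraMap K (BqKZ.RatFun K N) q)⁻¹ * BqKZ.w ⟨i, by omega⟩) * aeval BqKZ.w (Ψ σ) +
        (BqKZ.w ⟨i + 1, hi⟩ - BqKZ.w ⟨i, by omega⟩) *
        aeval BqKZ.w (∑ p with LinkPattern.connect i hi p = σ,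
        (if p.1 ⟨i, by omega⟩ = ⟨i + 1, hi⟩ then -((q : K) + ((q⁻¹ : Kˣ) : K)) else 1) • Ψ p)) := by
    rw [BqKZ.RMatrix, Matrix.smul_mulVec, Matrix.add_mulVec, Matrix.smul_mulVec, Matrix.smul_mulVec,
      Matrix.one_mulVec, Pi.smul_apply, Pi.add_apply, Pi.smul_apply, Pi.smul_apply, hs]
    simp only [smul_eq_mul, BqKZ.subst]
    generalize aeval (BqKZ.w : Fin N → BqKZ.RatFun K N) (Ψ σ) = A
    generalize aeval (BqKZ.w : Fin N → BqKZ.RatFun K N) (∑ p with LinkPattern.connect i hi p = σ, (_ : MvPolynomial (Fin N) K)) = B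
    have e1 : algebraMap K (BqKZ.RatFun K N) q - (algebraMap K (BqKZ.RatFun K N) q)⁻¹ *
        (BqKZ.w ⟨i + 1, hi⟩ / BqKZ.w ⟨i, by omega⟩) = (algebraMap K (BqKZ.RatFun K N) q * BqKZ.w ⟨i, by omega⟩ -
        (algebraMap K (BqKZ.RatFun K N) q)⁻¹ * BqKZ.w ⟨i + 1, hi⟩) / BqKZ.w ⟨i, by omega⟩ := by
      field_simp
    rw [e1]
    generalize (algebraMap K (BqKZ.RatFun K N) q)⁻¹ = Q' at *
    generalize algebraMap K (BqKZ.RatFun K N) q * BqKZ.w ⟨i, by omega⟩ - Q' * BqKZ.w ⟨i + 1, hi⟩ = D at *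
    field_simp
  rw [hR, inv_mul_eq_iff_eq_mul₀ hd]
  have hq' : ((q⁻¹ : Kˣ) : K) = (q : K)⁻¹ := Units.val_inv_eq_inv_val q
  constructor
  · intro h
    have := congrArg (aeval (BqKZ.w : Fin N → BqKZ.RatFun K N)) h
    simp only [map_mul, map_sub, aeval_X, algHom_C, aeval_rename, hq', map_inv₀] at this ⊢
    rw [this]
    simp only [BqKZ.subst]
    ring
  · intro h
    apply eq_of_aeval_w
    simp only [map_mul, map_sub, aeval_X, algHom_C, aeval_rename, hq', map_inv₀] at h ⊢
    simp only [BqKZ.subst] at h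
    rw [← h]
    ring

theorem IsLoop.mul_left {q : Kˣ} {Ψ : LinkPattern N → MvPolynomial (Fin N) K} (h : IsLoop q Ψ)
    (f : MvPolynomial (Fin N) K) (hf : ∀ (i : ℕ) (hi : i + 1 < N), rename (adj i hi) f = f) :
    IsLoop q fun p => f * Ψ p := by
  intro i hi σ
  have := h i hi σ
  have hs : ∑ p with LinkPattern.connect i hi p = σ,
      (if p.1 ⟨i, by omega⟩ = ⟨i + 1, hi⟩ then -((q : K) + ((q⁻¹ : Kˣ) : K)) else 1) • (f * Ψ p) =
      f * ∑ p with LinkPattern.connect i hi p = σ,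
      (if p.1 ⟨i, by omega⟩ = ⟨i + 1, hi⟩ then -((q : K) + ((q⁻¹ : Kˣ) : K)) else 1) • Ψ p := by
    rw [Finset.mul_sum]
    exact Finset.sum_congr rfl fun p _ => (mul_smul_comm _ _ _).symm
  rw [hs, map_mul, hf]
  linear_combination f * this

section commonFactor

variable {n : ℕ} (q : K)

theorem commonFactor_eq : BqKZ.commonFactor n q = C (2 ^ n) * ∏ i, (C q * X i - C q⁻¹) := by
  rw [BqKZ.commonFactor, map_pow, map_ofNat]

theorem rename_commonFactor (i : ℕ) (hi : i + 1 < 2 * n) :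
    rename (adj i hi) (BqKZ.commonFactor n q) = BqKZ.commonFactor n q := by
  rw [commonFactor_eq, map_mul, rename_C, map_prod]
  congr 1
  simp only [map_sub, map_mul, rename_C, rename_X]
  exact Equiv.prod_comp (adj i hi) fun i => (C q * X i - C q⁻¹ : MvPolynomial (Fin (2 * n)) K)

variable {q}

theorem commonFactor_degrees [CharZero K] (hq : q ≠ 0) : BqKZ.commonFactor n q ≠ 0 ∧
    (∀ j, degreeOf j (BqKZ.commonFactor n q) = 1) ∧ (BqKZ.commonFactor n q).totalDegree = 2 * n := by
  have h2 : (2 : K) ^ n ≠ 0 := pow_ne_zero _ two_ne_zero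
  have h0 : ∀ i ∈ (univ : Finset (Fin (2 * n))), (C q * X i - C q⁻¹ : MvPolynomial (Fin (2 * n)) K) ≠ 0 :=
    fun i _ => ne_zero_of_totalDegree_ne_zero (by rw [totalDegree_unary hq]; simp)
  have h1 : (∏ i, (C q * X i - C q⁻¹) : MvPolynomial (Fin (2 * n)) K) ≠ 0 := Finset.prod_ne_zero_iff.2 h0
  have h3 : (C ((2 : K) ^ n) : MvPolynomial (Fin (2 * n)) K) ≠ 0 := by rwa [ne_eq, C_eq_zero]
  rw [commonFactor_eq]
  refine ⟨mul_ne_zero h3 h1, fun j => ?_, ?_⟩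
  · rw [degreeOf_mul_eq h3 h1, degreeOf_C, degreeOf_prod_eq _ _ h0, zero_add,
      Finset.sum_congr rfl fun i _ => degreeOf_unary hq q⁻¹ i j]
    simp
  · rw [totalDegree_mul_of_isDomain h3 h1, totalDegree_C, totalDegree_prod _ _ h0, zero_add,
      Finset.sum_congr rfl fun i _ => totalDegree_unary hq q⁻¹ i]
    simp

theorem baseEntry_eq (q : Kˣ) : BqKZ.baseEntry n (q : K) = BqKZ.commonFactor n (q : K) * base n q := by
  have hq' : ((q⁻¹ : Kˣ) : K) = (q : K)⁻¹ := Units.val_inv_eq_inv_val q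
  have h1 : pairProd (fun i : Fin (2 * n) => i.val < n) (leftPair (C (q : K)) (C ((q⁻¹ : Kˣ) : K)) X) =
      ∏ p : Fin (2 * n) × Fin (2 * n) with p.1 < p.2 ∧ p.2.val < n,
      (C (q : K) * X p.1 - C (q : K)⁻¹ * X p.2) * (C ((q : K) ^ 2)⁻¹ - C ((q : K) ^ 2) * X p.1 * X p.2) := by
    refine Finset.prod_congr ?_ fun p _ => ?_
    · ext p; simp only [mem_filter, mem_univ, true_and, Fin.lt_def]; omega
    · rw [leftPair, hq', ← C_pow, ← C_pow, inv_pow]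
  have h2 : pairProd (fun i : Fin (2 * n) => n ≤ i.val) (rightPair (C (q : K)) (C ((q⁻¹ : Kˣ) : K)) X) =
      ∏ p : Fin (2 * n) × Fin (2 * n) with p.1 < p.2 ∧ n ≤ p.1.val,
      (C (q : K) * X p.1 - C (q : K)⁻¹ * X p.2) * (C (q : K) * X p.1 * X p.2 - C (q : K)⁻¹) := by
    refine Finset.prod_congr ?_ fun p _ => ?_
    · ext p; simp only [mem_filter, mem_univ, true_and, Fin.lt_def]; omega
    · rw [rightPair, hq']
  rw [base, cutProd, h1, h2, BqKZ.baseEntry, mul_assoc]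

theorem baseEntry_degrees [CharZero K] (q : Kˣ) (hn : 0 < n) : BqKZ.baseEntry n (q : K) ≠ 0 ∧
    (∀ j, degreeOf j (BqKZ.baseEntry n (q : K)) = 2 * n - 1) ∧
    (BqKZ.baseEntry n (q : K)).totalDegree = n * (3 * n - 1) := by
  obtain ⟨a1, a2, a3⟩ := commonFactor_degrees (n := n) q.ne_zero
  obtain ⟨b1, b2, b3⟩ := base_degrees q n
  rw [baseEntry_eq]
  refine ⟨mul_ne_zero a1 b1, fun j => ?_, ?_⟩
  · rw [degreeOf_mul_eq a1 b1, a2, b2]; omega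
  · rw [totalDegree_mul_of_isDomain a1 b1, a3, b3]
    obtain ⟨m, rfl⟩ : ∃ m, n = m + 1 := ⟨n - 1, by omega⟩
    rw [Nat.add_sub_cancel, show 3 * (m + 1) - 1 = 3 * m + 2 by omega]
    ring

theorem aeval_commonFactor_update {F : Type*} [Field F] [Algebra K F] (x : Fin (2 * n) → F) (a : Fin (2 * n))
    (v : F) (q : K) :
    (algebraMap K F q * x a - algebraMap K F q⁻¹) *
        aeval (Function.update x a v) (BqKZ.commonFactor n q) =
      (algebraMap K F q * v - algebraMap K F q⁻¹) * aeval x (BqKZ.commonFactor n q) := by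
  have key : ∀ y : Fin (2 * n) → F, aeval y (BqKZ.commonFactor n q) = 2 ^ n *
      ((algebraMap K F q * y a - algebraMap K F q⁻¹) * ∏ i ∈ univ.erase a,
        (algebraMap K F q * y i - algebraMap K F q⁻¹)) := by
    intro y
    rw [Finset.mul_prod_erase univ (fun i => algebraMap K F q * y i - algebraMap K F q⁻¹) (mem_univ a),
      BqKZ.commonFactor]
    simp
  rw [key, key, Function.update_self]
  have : ∏ i ∈ univ.erase a, (algebraMap K F q * Function.update x a v i - algebraMap K F q⁻¹) =
      ∏ i ∈ univ.erase a, (algebraMap K F q * x i - algebraMap K F q⁻¹) :=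
    Finset.prod_congr rfl fun i hi => by rw [Function.update_of_ne (Finset.ne_of_mem_erase hi)]
  rw [this]
  ring

end commonFactor

/-- The common factor turns the reciprocity of the components into the last two equations. -/
theorem isSolution_of_isLoop [CharZero K] {n : ℕ} (hn : 0 < n) {q : Kˣ}
    {c : LinkPattern (2 * n) → MvPolynomial (Fin (2 * n)) K} (h : IsLoop q c)
    (h0 : ∀ p, Recip (BqKZ.RatFun K (2 * n)) ⟨0, two_mul_pos hn⟩ ((((q⁻¹ : Kˣ) : K)) ^ 6) ((q : K) ^ 3)
      (2 * (n - 1)) (c p))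
    (h1 : ∀ p, Recip (BqKZ.RatFun K (2 * n)) ⟨2 * n - 1, two_mul_sub_one_lt hn⟩ 1 1 (2 * (n - 1)) (c p))
    (hd : ∀ j, BqKZ.degreeIn (fun p => BqKZ.commonFactor n (q : K) * c p) j = 2 * n - 1) :
    BqKZ.IsSolution (two_mul_pos hn) (q : K) fun p => BqKZ.commonFactor n (q : K) * c p where
  bulk := (isLoop_iff q _).1 (h.mul_left _ (rename_commonFactor _))
  boundary := by
    rw [hd]
    set a : Fin (2 * n) := ⟨2 * n - 1, two_mul_sub_one_lt hn⟩
    have hp (y : BqKZ.RatFun K (2 * n)) : y ^ (2 * n - 1) = y ^ (2 * (n - 1)) * y := by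
      rw [← pow_succ]; congr 1; omega
    funext p
    rw [Pi.smul_apply, BqKZ.subst, BqKZ.subst, smul_eq_mul, map_mul, map_mul]
    have e1 := aeval_commonFactor_update (n := n) (BqKZ.w : Fin (2 * n) → BqKZ.RatFun K (2 * n)) a
      (BqKZ.w a)⁻¹ (q : K)
    have e2 := h1 p BqKZ.w w_injective (w_ne_zero _)
    rw [map_one, one_mul, one_div] at e2
    have n1 := unary_ne_zero (b := (q : K)⁻¹) q.ne_zero a
    have n2 := w_ne_zero (K := K) a
    rw [← e2, BqKZ.boundaryFactor, hp]
    rw [map_inv₀] at e1 n1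
    generalize aeval (Function.update (BqKZ.w : Fin (2 * n) → BqKZ.RatFun K (2 * n)) a (BqKZ.w a)⁻¹) (c p) = A at *
    generalize aeval (Function.update (BqKZ.w : Fin (2 * n) → BqKZ.RatFun K (2 * n)) a (BqKZ.w a)⁻¹) (BqKZ.commonFactor n (q : K)) = B at *
    generalize aeval (BqKZ.w : Fin (2 * n) → BqKZ.RatFun K (2 * n)) (BqKZ.commonFactor n (q : K)) = D at *
    have n3 : (algebraMap K (BqKZ.RatFun K (2 * n)) q)⁻¹ - algebraMap K (BqKZ.RatFun K (2 * n)) q * BqKZ.w a ≠ 0 := by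
      rw [← neg_ne_zero, neg_sub]; exact n1
    generalize (algebraMap K (BqKZ.RatFun K (2 * n)) q)⁻¹ = Q' at *
    generalize algebraMap K (BqKZ.RatFun K (2 * n)) q = Q at *
    generalize (BqKZ.w a : BqKZ.RatFun K (2 * n)) = x at *
    have n4 : x ^ (2 * (n - 1)) ≠ 0 := pow_ne_zero _ n2
    generalize x ^ (2 * (n - 1)) = t at *
    have n5 : Q * x - Q' = -(Q' - Q * x) := by ring
    rw [n5] at e1
    generalize Q' - Q * x = z at *
    field_simp
    field_simp at e1
    linear_combination A * e1
  affine := by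
    rw [hd]
    set a : Fin (2 * n) := ⟨0, two_mul_pos hn⟩
    have hp (y : BqKZ.RatFun K (2 * n)) : y ^ (2 * n - 1) = y ^ (2 * (n - 1)) * y := by
      rw [← pow_succ]; congr 1; omega
    funext p
    rw [Pi.smul_apply, BqKZ.subst, BqKZ.subst, smul_eq_mul, map_mul, map_mul]
    have e0 : algebraMap K (BqKZ.RatFun K (2 * n)) ((((q⁻¹ : Kˣ) : K)) ^ 6) / BqKZ.w a =
        (algebraMap K (BqKZ.RatFun K (2 * n)) q ^ 6 * BqKZ.w a)⁻¹ := by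
      rw [map_pow, Units.val_inv_eq_inv_val, map_inv₀, mul_inv, inv_pow, div_eq_mul_inv]
    have e1 := aeval_commonFactor_update (n := n) (BqKZ.w : Fin (2 * n) → BqKZ.RatFun K (2 * n)) a
      (algebraMap K (BqKZ.RatFun K (2 * n)) q ^ 6 * BqKZ.w a)⁻¹ (q : K)
    have e2 := h0 p BqKZ.w w_injective (w_ne_zero _)
    rw [e0, map_pow] at e2
    have n1 := unary_ne_zero (b := (q : K)⁻¹) q.ne_zero a
    have n2 := w_ne_zero (K := K) a
    have n4 : algebraMap K (BqKZ.RatFun K (2 * n)) q ≠ 0 := by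
      rw [ne_eq, map_eq_zero]; exact q.ne_zero
    rw [← e2, BqKZ.affineFactor, hp]
    rw [map_inv₀] at e1 n1
    generalize aeval (Function.update (BqKZ.w : Fin (2 * n) → BqKZ.RatFun K (2 * n)) a (algebraMap K (BqKZ.RatFun K (2 * n)) q ^ 6 * BqKZ.w a)⁻¹) (c p) = A at *
    generalize aeval (Function.update (BqKZ.w : Fin (2 * n) → BqKZ.RatFun K (2 * n)) a (algebraMap K (BqKZ.RatFun K (2 * n)) q ^ 6 * BqKZ.w a)⁻¹)
      (BqKZ.commonFactor n (q : K)) = B at *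
    generalize aeval (BqKZ.w : Fin (2 * n) → BqKZ.RatFun K (2 * n)) (BqKZ.commonFactor n (q : K)) = D at *
    generalize algebraMap K (BqKZ.RatFun K (2 * n)) q = Q at *
    generalize (BqKZ.w a : BqKZ.RatFun K (2 * n)) = x at *
    generalize 2 * (n - 1) = m at *
    have n3 : Q ^ 2 * x - 1 ≠ 0 := fun e => n1 (by field_simp; rw [e, mul_zero])
    field_simp
    field_simp at e1
    linear_combination -A * e1

end QKZ

/-! ### Triangularity -/

namespace LinkPattern

variable {N : ℕ}

theorem card_up_comp_adj {S : QKZ.Config N} (i : ℕ) (hi : i + 1 < N) (h0 : S ⟨i, by omega⟩ = false) (k : ℕ) :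
    #{j : Fin N | j.val < k ∧ S j} ≤ #{j : Fin N | j.val < k ∧ (S ∘ QKZ.adj i hi) j} := by
  by_cases hk : k = i + 1
  · subst hk
    refine Finset.card_le_card fun j hj => ?_
    simp only [mem_filter, mem_univ, true_and] at hj ⊢
    refine ⟨hj.1, ?_⟩
    have h1 : j ≠ ⟨i, by omega⟩ := fun e => by rw [e, h0] at hj; exact absurd hj.2 (by simp)
    have h2 : j ≠ ⟨i + 1, hi⟩ := fun e => by rw [e] at hj; simp at hj
    rw [Function.comp, QKZ.adj, Equiv.swap_apply_of_ne_of_ne h1 h2]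
    exact hj.2
  · refine Finset.card_le_card_of_injOn (QKZ.adj i hi) (fun j hj => ?_) (QKZ.adj i hi).injective.injOn
    simp only [coe_filter, mem_univ, true_and, Set.mem_ofPred_eq, Function.comp, Equiv.swap_apply_self] at hj ⊢
    exact ⟨(QKZ.adj_val_lt i hi k hk j).2 hj.1, hj.2⟩

/-- At a valley `i` of the Dyck path of `p`, every other pattern with the same image under `e_i`
precedes `p`. -/
theorem precedes_of_connect_eq {p s : LinkPattern N} (i : ℕ) (hi : i + 1 < N)
    (h0 : p.up ⟨i, by omega⟩ = false) (h1 : p.up ⟨i + 1, hi⟩ = true)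
    (hs : s.connect i hi = p.connect i hi) (hne : s ≠ p) : s.Precedes p := by
  have hone : (1 : ℤ) * 1 = 1 := one_mul 1
  have g0 : (p.up ∘ QKZ.adj i hi) ⟨i, by omega⟩ = true := by simpa using h1
  have g1 : (p.up ∘ QKZ.adj i hi) ⟨i + 1, hi⟩ = false := by simpa using h0
  have hp : p.1 ⟨i, by omega⟩ < ⟨i, by omega⟩ := p.up_eq_false.1 h0
  have hp' : p.1 ⟨i, by omega⟩ ≠ ⟨i + 1, hi⟩ := fun e => by
    rw [e, Fin.mk_lt_mk] at hp; omega
  have hz : iota (1 : ℤ) p (p.up ∘ QKZ.adj i hi) = 0 := by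
    by_contra hc
    have hcomp := compatible_of_iota_ne_zero hc ⟨i, by omega⟩
    rw [g0, Function.comp, QKZ.adj, Equiv.swap_apply_of_ne_of_ne (p.apply_ne _) hp', p.compatible_up, h0] at hcomp
    exact absurd hcomp (by simp)
  -- The component at the raised valley of the spin vector of `e_i p` is `1`.
  have e1 := iota_connect (p := p) hone i hi g0 g1
  rw [if_neg hp', one_mul, hz, QKZ.comp_adj_comp_adj, iota_up] at e1
  have hcomp : s.Compatible (p.up ∘ QKZ.adj i hi) ∨ s.Compatible p.up := by
    by_cases hs' : s.1 ⟨i, by omega⟩ = ⟨i + 1, hi⟩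
    · left
      rw [connect_of_arch i hi hs'] at hs
      rw [← hs] at e1
      exact compatible_of_iota_ne_zero (x := (1 : ℤ)) (by rw [e1]; simp)
    · have e2 := iota_connect (p := s) hone i hi g0 g1
      rw [if_neg hs', hs, e1, QKZ.comp_adj_comp_adj] at e2
      by_contra hc
      rw [not_or] at hc
      have z1 : iota (1 : ℤ) s (p.up ∘ QKZ.adj i hi) = 0 :=
        by_contra fun h => hc.1 (compatible_of_iota_ne_zero h)
      have z2 : iota (1 : ℤ) s p.up = 0 := by_contra fun h => hc.2 (compatible_of_iota_ne_zero h)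
      rw [z1, z2] at e2
      simp at e2
  have hle : ∀ k, openings p k ≤ openings s k := by
    intro k
    rw [openings_eq]
    rcases hcomp with h | h
    · exact (card_up_comp_adj i hi h0 k).trans (h.card_le_openings k)
    · exact h.card_le_openings k
  refine ⟨hle, ?_⟩
  by_contra hc
  push Not at hc
  exact hne (eq_of_openings_eq fun k => le_antisymm (hc k) (hle k))

theorem precedes_wellFounded : WellFounded (Precedes : LinkPattern N → LinkPattern N → Prop) := by
  have : IsTrans (LinkPattern N) Precedes := ⟨fun a b c h1 h2 =>
    ⟨fun k => (h2.1 k).trans (h1.1 k), h1.2.imp fun k h => (h2.1 k).trans_lt h⟩⟩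
  have : Std.Irrefl (Precedes : LinkPattern N → LinkPattern N → Prop) :=
    ⟨fun a h => h.2.elim fun k h => lt_irrefl _ h⟩
  exact Finite.wellFounded_of_trans_of_irrefl _

end LinkPattern

namespace QKZ

variable {K : Type*} [Field K]

/-- The exchange relation at a valley of `p`, read at the component `e_i p`. -/
theorem IsLoop.isTriangular {n : ℕ} {q : Kˣ} {Ψ : LinkPattern (2 * n) → MvPolynomial (Fin (2 * n)) K}
    (h : IsLoop q Ψ) : BqKZ.IsTriangular (q : K) Ψ := by
  intro p hp
  obtain ⟨i, hi, h0, h1⟩ := p.exists_valley hp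
  have hp' : p.1 ⟨i, by omega⟩ ≠ ⟨i + 1, hi⟩ := fun e => by
    have := p.up_eq_false.1 h0
    rw [e, Fin.mk_lt_mk] at this; omega
  have hσ : (p.connect i hi).1 ⟨i, by omega⟩ = ⟨i + 1, hi⟩ := LinkPattern.connect_left _ _
  have hne : p.connect i hi ≠ p := fun e => hp' (by rw [e] at hσ; exact hσ)
  have hσσ := LinkPattern.connect_of_arch i hi hσ
  refine ⟨i, hi, p.connect i hi, rfl, LinkPattern.precedes_of_connect_eq i hi h0 h1 hσσ hne,
    fun s hs hsp => LinkPattern.precedes_of_connect_eq i hi h0 h1 hs hsp, ?_⟩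
  have hl := h i hi (p.connect i hi)
  have hsum : ∑ s with LinkPattern.connect i hi s = p.connect i hi,
      (if s.1 ⟨i, by omega⟩ = ⟨i + 1, hi⟩ then -((q : K) + ((q⁻¹ : Kˣ) : K)) else 1) • Ψ s =
      -((C (q : K) + C ((q⁻¹ : Kˣ) : K)) * Ψ (p.connect i hi)) + (Ψ p +
        ∑ s with LinkPattern.connect i hi s = p.connect i hi ∧ s ≠ p.connect i hi ∧ s ≠ p, Ψ s) := by
    have hm1 : p.connect i hi ∈ ({s | LinkPattern.connect i hi s = p.connect i hi} : Finset _) := by simp [hσσ]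
    have hm2 : p ∈ ({s | LinkPattern.connect i hi s = p.connect i hi} : Finset _).erase (p.connect i hi) := by
      simp [hne.symm]
    rw [← Finset.add_sum_erase _ _ hm1, ← Finset.add_sum_erase _ _ hm2, if_pos hσ, if_neg hp', one_smul,
      neg_smul, smul_eq_C_mul, C_add]
    congr 2
    refine Finset.sum_congr ?_ fun s hs => ?_
    · ext s; simp only [mem_erase, mem_filter, mem_univ, true_and]; tauto
    · simp only [mem_filter, mem_univ, true_and] at hs
      rw [if_neg, one_smul]
      intro e
      exact hs.2.1 (by rw [← hs.1, LinkPattern.connect_of_arch i hi e])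
  rw [hsum] at hl
  rw [Units.val_inv_eq_inv_val] at hl
  linear_combination hl

/-- A vector subject to the triangular recursion is determined by its first component. -/
theorem eq_zero_of_isTriangular {n : ℕ} {q : K} {Ψ : LinkPattern (2 * n) → MvPolynomial (Fin (2 * n)) K}
    (h : BqKZ.IsTriangular q Ψ) (h0 : Ψ (LinkPattern.rainbow n) = 0) : Ψ = 0 := by
  funext p
  induction p using LinkPattern.precedes_wellFounded.induction with
  | _ p ih =>
    by_cases hp : p = LinkPattern.rainbow n
    · rw [hp, h0]; rfl
    obtain ⟨i, hi, σ, _, h2, h3, h4⟩ := h p hp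
    have hs := ih σ h2
    rw [hs, Finset.sum_eq_zero fun s hs => ih s (h3 s (mem_filter.1 hs).2.1 (mem_filter.1 hs).2.2.2)] at h4
    simp only [Pi.zero_apply, map_zero, sub_zero, mul_zero, add_zero] at h4
    exact (mul_eq_zero.1 h4).resolve_left (X_sub_X_ne_zero i hi)

end QKZ

/-! ### Zeros of polynomial solutions -/

namespace QKZ

variable {N : ℕ} {K : Type*} [Field K]

/-- The polynomial `w_a^D f(…, c / w_a, …)`, for `f` of degree at most `D` in `w_a`. -/
noncomputable def reversal (a : Fin N) (c : K) (D : ℕ) (f : MvPolynomial (Fin N) K) :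
    MvPolynomial (Fin N) K :=
  ∑ m ∈ f.support, C (coeff m f * c ^ m a) * X a ^ (D - m a) * ∏ l ∈ univ.erase a, X l ^ m l

theorem aeval_reversal {F : Type*} [Field F] [Algebra K F] {a : Fin N} (c : K) {D : ℕ}
    {f : MvPolynomial (Fin N) K} (hf : degreeOf a f ≤ D) {x : Fin N → F} (hx : x a ≠ 0) :
    aeval x (reversal a c D f) =
      x a ^ D * aeval (Function.update x a (algebraMap K F c * (x a)⁻¹)) f := by
  rw [reversal, map_sum, aeval_def, eval₂_eq', Finset.mul_sum]
  refine Finset.sum_congr rfl fun m hm => ?_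
  have hD : m a ≤ D := (monomial_le_degreeOf a hm).trans hf
  rw [← Finset.mul_prod_erase univ (fun l => Function.update x a _ l ^ m l) (mem_univ a),
    Function.update_self]
  have : ∏ l ∈ univ.erase a, Function.update x a (algebraMap K F c * (x a)⁻¹) l ^ m l =
      ∏ l ∈ univ.erase a, x l ^ m l :=
    Finset.prod_congr rfl fun l hl => by rw [Function.update_of_ne (Finset.ne_of_mem_erase hl)]
  rw [this, mul_pow, inv_pow]
  simp only [map_mul, map_pow, map_prod, aeval_X, algHom_C]
  rw [pow_sub₀ _ hx hD]
  ring

theorem degreeOf_le_degreeIn (Φ : LinkPattern N → MvPolynomial (Fin N) K) (j : Fin N)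
    (p : LinkPattern N) : degreeOf j (Φ p) ≤ BqKZ.degreeIn Φ j :=
  Finset.le_sup (f := fun π => degreeOf j (Φ π)) (mem_univ p)

section boundary

variable {r : ℕ} {hr : 0 < r} {q : Kˣ} {Φ : LinkPattern r → MvPolynomial (Fin r) K}

/-- The equation at the last variable, with denominators cleared. -/
theorem boundary_reversal (h : BqKZ.IsSolution hr (q : K) Φ) (p : LinkPattern r) :
    (C (q : K)⁻¹ * X ⟨r - 1, by omega⟩ - C (q : K)) * Φ p =
      (C (q : K)⁻¹ - C (q : K) * X ⟨r - 1, by omega⟩) *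
        reversal ⟨r - 1, by omega⟩ 1 (BqKZ.degreeIn Φ ⟨r - 1, by omega⟩) (Φ p) := by
  apply eq_of_aeval_w
  have h1 := congrFun h.boundary p
  set a : Fin r := ⟨r - 1, by omega⟩
  have n1 := unary_ne_zero (b := (q : K)⁻¹) q.ne_zero a
  have n2 := w_ne_zero (K := K) a
  rw [map_mul, map_mul, aeval_reversal _ (degreeOf_le_degreeIn Φ a p) n2, map_one, one_mul]
  rw [Pi.smul_apply, smul_eq_mul, BqKZ.subst, BqKZ.subst, BqKZ.boundaryFactor] at h1
  simp only [← h1, map_sub, map_mul, aeval_X, algHom_C, map_inv₀] at n1 ⊢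
  have n3 : (algebraMap K (BqKZ.RatFun K r) q)⁻¹ - algebraMap K (BqKZ.RatFun K r) q * BqKZ.w a ≠ 0 := by
    rw [← neg_ne_zero, neg_sub]; exact n1
  generalize (algebraMap K (BqKZ.RatFun K r) q)⁻¹ - algebraMap K (BqKZ.RatFun K r) q * BqKZ.w a = z at *
  field_simp

/-- The equation at the first variable, with denominators cleared. -/
theorem affine_reversal (h : BqKZ.IsSolution hr (q : K) Φ) (p : LinkPattern r) :
    (C ((q : K) ^ 2)⁻¹ - C ((q : K) ^ 2) * X ⟨0, hr⟩) * Φ p =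
      (C (q : K) * X ⟨0, hr⟩ - C (q : K)⁻¹) * (C (((q : K) ^ 3) ^ BqKZ.degreeIn Φ ⟨0, hr⟩) *
        reversal ⟨0, hr⟩ ((q : K) ^ 6)⁻¹ (BqKZ.degreeIn Φ ⟨0, hr⟩) (Φ p)) := by
  apply eq_of_aeval_w
  have h1 := congrFun h.affine p
  set a : Fin r := ⟨0, hr⟩
  have n1 := unary_ne_zero (b := (q : K)⁻¹) q.ne_zero a
  have n2 := w_ne_zero (K := K) a
  have n4 : algebraMap K (BqKZ.RatFun K r) q ≠ 0 := by
    rw [ne_eq, map_eq_zero]; exact q.ne_zero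
  rw [map_mul, map_mul, map_mul, aeval_reversal _ (degreeOf_le_degreeIn Φ a p) n2]
  rw [Pi.smul_apply, smul_eq_mul, BqKZ.subst, BqKZ.subst, BqKZ.affineFactor, mul_inv] at h1
  simp only [map_sub, map_mul, aeval_X, algHom_C, map_inv₀, map_pow] at n1 ⊢
  rw [← h1]
  generalize algebraMap K (BqKZ.RatFun K r) q * BqKZ.w a - (algebraMap K (BqKZ.RatFun K r) q)⁻¹ = z at *
  generalize BqKZ.degreeIn Φ a = m
  rw [mul_pow]
  field_simp

end boundary

/-- The rules by which zeros of a polynomial solution of the system spread. Here `V` is the set of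
common zeros of all the components in a field, and `Z` is the set of zeros of the component at the
rainbow pattern. -/
structure ZeroRules {F : Type*} [Field F] (n : ℕ) (hn : 0 < n) (Q : F) (V Z : Set (Fin (2 * n) → F)) :
    Prop where
  ne_zero : Q ≠ 0
  subset : V ⊆ Z
  exchange_all : ∀ (i : ℕ) (hi : i + 1 < 2 * n) (x : Fin (2 * n) → F), x ∘ adj i hi ∈ V →
    Q ^ 2 * x ⟨i + 1, hi⟩ ≠ x ⟨i, by omega⟩ → x ∈ V
  last : ∀ x : Fin (2 * n) → F, Q ^ 2 * x ⟨2 * n - 1, two_mul_sub_one_lt hn⟩ = 1 → x ∈ V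
  adjacent : ∀ (i : ℕ) (hi : i + 1 < 2 * n) (x : Fin (2 * n) → F), i + 1 ≠ n → x ⟨i, by omega⟩ ≠ 0 →
    x ⟨i + 1, hi⟩ = Q ^ 2 * x ⟨i, by omega⟩ → x ∈ Z
  exchange : ∀ (i : ℕ) (hi : i + 1 < 2 * n) (x : Fin (2 * n) → F), i + 1 ≠ n → x ∘ adj i hi ∈ Z →
    Q ^ 2 * x ⟨i + 1, hi⟩ ≠ x ⟨i, by omega⟩ → x ∈ Z
  boundary : ∀ x : Fin (2 * n) → F, x ⟨2 * n - 1, two_mul_sub_one_lt hn⟩ ≠ 0 →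
    Function.update x ⟨2 * n - 1, two_mul_sub_one_lt hn⟩ (x ⟨2 * n - 1, two_mul_sub_one_lt hn⟩)⁻¹ ∈ Z →
    x ⟨2 * n - 1, two_mul_sub_one_lt hn⟩ ≠ Q ^ 2 → x ∈ Z
  affine : ∀ x : Fin (2 * n) → F, x ⟨0, two_mul_pos hn⟩ ≠ 0 →
    Function.update x ⟨0, two_mul_pos hn⟩ (Q ^ 6 * x ⟨0, two_mul_pos hn⟩)⁻¹ ∈ Z →
    Q ^ 4 * x ⟨0, two_mul_pos hn⟩ ≠ 1 → x ∈ Z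

/-- The rainbow pattern has no little arch off the middle, so it is not in the image of `e_i`. -/
theorem IsLoop.rainbow {n : ℕ} {q : Kˣ} {Φ : LinkPattern (2 * n) → MvPolynomial (Fin (2 * n)) K}
    (h : IsLoop q Φ) (i : ℕ) (hi : i + 1 < 2 * n) (hin : i + 1 ≠ n) :
    (C (q : K) * X ⟨i, by omega⟩ - C (q : K)⁻¹ * X ⟨i + 1, hi⟩) *
        rename (adj i hi) (Φ (LinkPattern.rainbow n)) =
      (C (q : K) * X ⟨i + 1, hi⟩ - C (q : K)⁻¹ * X ⟨i, by omega⟩) * Φ (LinkPattern.rainbow n) := by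
  have h1 := h i hi (LinkPattern.rainbow n)
  rw [Finset.sum_eq_zero, mul_zero, Units.val_inv_eq_inv_val] at h1
  · exact (sub_eq_zero.1 h1.symm)
  · intro p hp
    rw [mem_filter] at hp
    have h2 := p.connect_left i hi
    rw [hp.2] at h2
    have h3 : ((LinkPattern.rainbow n).1 ⟨i, by omega⟩).val = i + 1 := by rw [h2]
    rw [LinkPattern.rainbow, Fin.val_rev] at h3
    simp only at h3
    omega

/-- At a zero of one side of an equation of the system the other side vanishes too, so its polynomial
factor or its factor from the solution does. -/
theorem zeroRules [CharZero K] {n : ℕ} (hn : 0 < n) {q : Kˣ} (hq : (q : K) ^ 2 ≠ -1)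
    {Φ : LinkPattern (2 * n) → MvPolynomial (Fin (2 * n)) K}
    (h : BqKZ.IsSolution (two_mul_pos hn) (q : K) Φ) (F : Type*) [Field F] [Algebra K F] :
    ZeroRules n hn (algebraMap K F q) {x | ∀ p, aeval x (Φ p) = 0}
      {x | aeval x (Φ (LinkPattern.rainbow n)) = 0} := by
  have hl : IsLoop q Φ := (isLoop_iff q Φ).2 h.bulk
  have hQ : algebraMap K F q ≠ 0 := by rw [ne_eq, map_eq_zero]; exact q.ne_zero
  have h2 : (2 : F) ≠ 0 := by
    rw [← map_ofNat (algebraMap K F) 2, ne_eq, map_eq_zero]; exact two_ne_zero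
  -- either `q⁴ ≠ 1`, or the equations become antisymmetries after division
  have hq4 : (q : K) ^ 2 = 1 ∨ algebraMap K F q ^ 4 ≠ 1 := by
    by_contra! h4
    have h5 : ((q : K) ^ 2 - 1) * ((q : K) ^ 2 + 1) = 0 := by
      apply (algebraMap K F).injective
      simp only [map_mul, map_sub, map_add, map_pow, map_one, map_zero]
      linear_combination h4.2
    rcases mul_eq_zero.1 h5 with h6 | h6
    · exact h4.1 (sub_eq_zero.1 h6)
    · exact hq (eq_neg_of_add_eq_zero_left h6)
  have hqi : (q : K) ^ 2 = 1 → (q : K)⁻¹ = q := fun e => inv_eq_of_mul_eq_one_left (by rw [← sq, e])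
  refine ⟨hQ, fun x hx => hx _, ?_, ?_, ?_, ?_, ?_, ?_⟩
  · intro i hi x hx hne p
    have h1 := congrArg (aeval (x ∘ adj i hi)) (hl i hi p)
    have hx' := hx
    simp only [Set.mem_ofPred_eq] at hx'
    rw [map_mul, map_sum, Finset.sum_eq_zero fun s _ => by rw [map_smul, hx', smul_zero], mul_zero,
      map_sub, map_mul, map_mul, hx', mul_zero, sub_zero, aeval_rename, comp_adj_comp_adj] at h1
    rcases mul_eq_zero.1 h1.symm with h3 | h3
    · refine absurd ?_ hne
      simp only [map_sub, map_mul, aeval_X, algHom_C, Function.comp, adj_apply_mk,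
        Units.val_inv_eq_inv_val, map_inv₀] at h3
      simp at h3
      field_simp at h3
      linear_combination h3
    · exact h3
  · intro x hx p
    have h1 := boundary_reversal h p
    rcases hq4 with h4 | h4
    · have h5 : Φ p = - reversal ⟨2 * n - 1, two_mul_sub_one_lt hn⟩ 1 (BqKZ.degreeIn Φ ⟨2 * n - 1, two_mul_sub_one_lt hn⟩) (Φ p) := by
        refine mul_left_cancel₀ (ne_zero_of_totalDegree_ne_zero (N := 2 * n) (K := K)
          (f := C (q : K) * X ⟨2 * n - 1, two_mul_sub_one_lt hn⟩ - C (q : K)) (by rw [totalDegree_unary q.ne_zero]; simp)) ?_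
        rw [hqi h4] at h1
        linear_combination h1
      rw [← map_pow, h4, map_one, one_mul] at hx
      have h6 := congrArg (aeval x) h5
      rw [map_neg, aeval_reversal _ (degreeOf_le_degreeIn Φ _ p) (by rw [hx]; exact one_ne_zero), hx] at h6
      rw [map_one, inv_one, one_mul, one_pow, one_mul] at h6
      rw [← hx, Function.update_eq_self] at h6
      have : 2 * aeval x (Φ p) = 0 := by linear_combination h6
      exact (mul_eq_zero.1 this).resolve_left h2
    · have h6 := congrArg (aeval x) h1
      simp only [map_sub, map_mul, aeval_X, algHom_C, map_inv₀] at h6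
      have hx' : x ⟨2 * n - 1, two_mul_sub_one_lt hn⟩ = (algebraMap K F q ^ 2)⁻¹ := eq_inv_of_mul_eq_one_right hx
      rw [hx'] at h6
      generalize aeval x (Φ p) = A at *
      generalize algebraMap K F q = Q at *
      have h7 : (1 - Q ^ 4) * A = 0 := by
        field_simp at h6
        linear_combination h6
      exact (mul_eq_zero.1 h7).resolve_left fun e => h4 (sub_eq_zero.1 e).symm
  · intro i hi x hin h0 hx
    have h1 := hl.rainbow i hi hin
    have hne : (⟨i + 1, hi⟩ : Fin (2 * n)) ≠ ⟨i, by omega⟩ := by simp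
    rw [Set.mem_ofPred_eq]
    rcases hq4 with h4 | h4
    · have h5 : rename (adj i hi) (Φ (LinkPattern.rainbow n)) = - Φ (LinkPattern.rainbow n) := by
        refine mul_left_cancel₀ (ne_zero_of_totalDegree_ne_zero (N := 2 * n) (K := K)
          (f := C (q : K) * X ⟨i + 1, hi⟩ - C (q : K) * X ⟨i, by omega⟩) (by rw [totalDegree_linear q.ne_zero q.ne_zero hne]; simp)) ?_
        rw [hqi h4] at h1
        linear_combination -h1
      rw [← map_pow, h4, map_one, one_mul] at hx
      have h6 := congrArg (aeval x) h5
      have h7 : x ∘ adj i hi = x := by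
        funext k
        simp only [Function.comp, adj]
        rcases eq_or_ne k ⟨i, by omega⟩ with rfl | hk
        · rw [Equiv.swap_apply_left, hx]
        rcases eq_or_ne k ⟨i + 1, hi⟩ with rfl | hk'
        · rw [Equiv.swap_apply_right, hx]
        rw [Equiv.swap_apply_of_ne_of_ne hk hk']
      rw [aeval_rename, h7, map_neg] at h6
      have : 2 * aeval x (Φ (LinkPattern.rainbow n)) = 0 := by linear_combination h6
      exact (mul_eq_zero.1 this).resolve_left h2
    · have h6 := congrArg (aeval x) h1
      simp only [map_sub, map_mul, aeval_X, algHom_C, map_inv₀, hx] at h6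
      generalize aeval x (Φ (LinkPattern.rainbow n)) = A at *
      generalize algebraMap K F q = Q at *
      generalize x ⟨i, by omega⟩ = y at *
      have h7 : (Q ^ 4 - 1) * A = 0 := by
        field_simp at h6
        linear_combination -h6
      exact (mul_eq_zero.1 h7).resolve_left fun e => h4 (sub_eq_zero.1 e)
  · intro i hi x hin hx hne
    have h6 := congrArg (aeval x) (hl.rainbow i hi hin)
    rw [Set.mem_ofPred_eq] at hx ⊢
    rw [map_mul, map_mul, aeval_rename, hx, mul_zero] at h6
    refine (mul_eq_zero.1 h6.symm).resolve_left fun e => hne ?_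
    simp only [map_sub, map_mul, aeval_X, algHom_C, map_inv₀] at e
    field_simp at e
    linear_combination e
  · intro x h0 hx hne
    have h6 := congrArg (aeval x) (boundary_reversal h (LinkPattern.rainbow n))
    rw [Set.mem_ofPred_eq] at hx ⊢
    rw [map_mul, map_mul, aeval_reversal _ (degreeOf_le_degreeIn Φ _ _) h0, map_one, one_mul, hx,
      mul_zero, mul_zero] at h6
    refine (mul_eq_zero.1 h6).resolve_left fun e => hne ?_
    simp only [map_sub, map_mul, aeval_X, algHom_C, map_inv₀] at e
    field_simp at e
    linear_combination e
  · intro x h0 hx hne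
    have h6 := congrArg (aeval x) (affine_reversal h (LinkPattern.rainbow n))
    rw [Set.mem_ofPred_eq] at hx ⊢
    rw [map_mul, map_mul, map_mul, aeval_reversal _ (degreeOf_le_degreeIn Φ _ _) h0,
      map_inv₀ (algebraMap K F), map_pow (algebraMap K F), ← mul_inv, hx, mul_zero, mul_zero, mul_zero] at h6
    refine (mul_eq_zero.1 h6).resolve_left fun e => hne ?_
    simp only [map_sub, map_mul, aeval_X, algHom_C, map_inv₀, map_pow] at e
    field_simp at e
    linear_combination -e

namespace ZeroRules

variable {F : Type*} [Field F] {n : ℕ} {hn : 0 < n} {Q : F} {V Z : Set (Fin (2 * n) → F)}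

/-- The zeros at the last coordinate are carried to the `j`-th one by the exchange relations. -/
theorem mem_of_unary (h : ZeroRules n hn Q V Z) (j : Fin (2 * n)) (x : Fin (2 * n) → F)
    (hx : Q ^ 2 * x j = 1) (hne : ∀ l ≠ j, Q ^ 4 * x l ≠ 1) : x ∈ V := by
  obtain ⟨d, hd⟩ : ∃ d, j.val + d = 2 * n - 1 := ⟨2 * n - 1 - j, by omega⟩
  induction d generalizing j x with
  | zero =>
    obtain ⟨j, hj⟩ := j
    obtain rfl : j = 2 * n - 1 := hd
    exact h.last x hx
  | succ d ih =>
    obtain ⟨j, hj⟩ := j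
    simp only at hd
    have hj' : j + 1 < 2 * n := by omega
    refine h.exchange_all j hj' x (ih ⟨j + 1, hj'⟩ _ ?_ ?_ (by simp only; omega)) fun e => ?_
    · simpa [Function.comp, adj] using hx
    · intro l hl
      refine hne _ fun e => hl ?_
      rw [adj, Equiv.swap_apply_eq_iff, Equiv.swap_apply_left] at e
      exact e
    · exact hne ⟨j + 1, hj'⟩ (by simp) (by rw [← hx, ← e]; ring)

/-- The zeros at neighbouring coordinates are carried to all pairs of the same half. -/
theorem mem_of_linear (h : ZeroRules n hn Q V Z) {i : Fin (2 * n)} (j : Fin (2 * n)) (hij : i < j)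
    (hs : i.val < n ↔ j.val < n) (x : Fin (2 * n) → F) (h0 : x i ≠ 0)
    (hx : x j = Q ^ 2 * x i) (hne : ∀ l, l ≠ i → l ≠ j → Q ^ 4 * x i ≠ x l) : x ∈ Z := by
  obtain ⟨i, hi⟩ := i
  obtain ⟨d, hd⟩ : ∃ d, i + 1 + d = j.val := ⟨j - (i + 1), by rw [Fin.lt_def] at hij; simp only at hij; omega⟩
  induction d generalizing j x with
  | zero =>
    obtain ⟨j, hj⟩ := j
    obtain rfl : i + 1 = j := hd
    exact h.adjacent i hj x (by simp only at hs; omega) h0 hx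
  | succ d ih =>
    obtain ⟨j, hj⟩ := j
    simp only at hd hs
    obtain ⟨k, rfl⟩ : ∃ k, j = k + 1 := ⟨j - 1, by omega⟩
    have hk : k < 2 * n := by omega
    have hki : (⟨i, hi⟩ : Fin (2 * n)) ≠ ⟨k, hk⟩ := by simp only [ne_eq, Fin.mk.injEq]; omega
    have hki' : (⟨i, hi⟩ : Fin (2 * n)) ≠ ⟨k + 1, hj⟩ := by simp only [ne_eq, Fin.mk.injEq]; omega
    have hfix : adj k hj ⟨i, hi⟩ = ⟨i, hi⟩ := Equiv.swap_apply_of_ne_of_ne hki hki'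
    refine h.exchange k hj x (by omega) (ih ⟨k, hk⟩ _ ?_ ?_ ?_ ?_ ?_ ?_) fun e => ?_
    · simp only [Fin.mk_lt_mk]; omega
    · simp only; omega
    · rwa [Function.comp, hfix]
    · simp only [Function.comp]
      rw [hfix, adj, Equiv.swap_apply_left, hx]
    · intro l h1 h2
      simp only [Function.comp]
      rw [hfix]
      refine hne _ (fun e => h1 ?_) fun e => h2 ?_
      · rw [← hfix] at e; exact (adj k hj).injective e
      · rw [adj, Equiv.swap_apply_eq_iff, Equiv.swap_apply_right] at e; exact e
    · simp only; omega
    · refine hne ⟨k, hk⟩ hki.symm (by simp) ?_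
      rw [← e, hx]; ring

/-- The inversion of the last coordinate turns `Q² x_i x_j = 1` into the linear condition, for `j` the
last position; the exchange relations move `j`. -/
theorem mem_of_right_quadratic (h : ZeroRules n hn Q V Z) {i : Fin (2 * n)} (j : Fin (2 * n)) (hij : i < j)
    (hs : n ≤ i.val) (x : Fin (2 * n) → F) (h0 : x i ≠ 0) (hx : Q ^ 2 * x i * x j = 1)
    (h1 : Q ^ 4 * x i ≠ 1) (hne : ∀ l, l ≠ i → l ≠ j → Q ^ 4 * x i ≠ x l)
    (hne' : ∀ l, l ≠ i → l ≠ j → Q ^ 4 * x i * x l ≠ 1) : x ∈ Z := by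
  obtain ⟨i, hi⟩ := i
  have hQ := h.ne_zero
  obtain ⟨d, hd⟩ : ∃ d, j.val + d = 2 * n - 1 := ⟨2 * n - 1 - j, by omega⟩
  induction d generalizing j x with
  | zero =>
    obtain ⟨j, hj⟩ := j
    obtain rfl : j = 2 * n - 1 := hd
    have h2 : x ⟨2 * n - 1, two_mul_sub_one_lt hn⟩ ≠ 0 := fun e => by rw [e, mul_zero] at hx; exact zero_ne_one hx
    refine h.boundary x h2 (h.mem_of_linear ⟨2 * n - 1, two_mul_sub_one_lt hn⟩ hij ?_ _ ?_ ?_ ?_) fun e => h1 ?_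
    · simp only at hs ⊢; omega
    · rwa [Function.update_of_ne hij.ne]
    · rw [Function.update_of_ne hij.ne, Function.update_self]
      exact inv_eq_of_mul_eq_one_left hx
    · intro l h3 h4
      rw [Function.update_of_ne hij.ne, Function.update_of_ne h4]
      exact hne l h3 h4
    · rw [← hx, e]; ring
  | succ d ih =>
    obtain ⟨j, hj⟩ := j
    simp only at hd hs
    rw [Fin.mk_lt_mk] at hij
    have hk : j + 1 < 2 * n := by omega
    have hki : (⟨i, hi⟩ : Fin (2 * n)) ≠ ⟨j, hj⟩ := by simp only [ne_eq, Fin.mk.injEq]; omega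
    have hki' : (⟨i, hi⟩ : Fin (2 * n)) ≠ ⟨j + 1, hk⟩ := by simp only [ne_eq, Fin.mk.injEq]; omega
    have hfix : adj j hk ⟨i, hi⟩ = ⟨i, hi⟩ := Equiv.swap_apply_of_ne_of_ne hki hki'
    have hl : ∀ l, l ≠ ⟨i, hi⟩ → l ≠ ⟨j + 1, hk⟩ → adj j hk l ≠ ⟨i, hi⟩ ∧ adj j hk l ≠ ⟨j, hj⟩ := by
      intro l h3 h4
      refine ⟨fun e => h3 ?_, fun e => h4 ?_⟩
      · rw [← hfix] at e; exact (adj j hk).injective e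
      · rw [adj, Equiv.swap_apply_eq_iff, Equiv.swap_apply_left] at e; exact e
    refine h.exchange j hk x (by omega) (ih ⟨j + 1, hk⟩ _ ?_ ?_ ?_ ?_ ?_ ?_ ?_) fun e => ?_
    · simp only [Fin.mk_lt_mk]; omega
    · rwa [Function.comp, hfix]
    · simp only [Function.comp]
      rw [hfix, adj, Equiv.swap_apply_right, hx]
    · rwa [Function.comp, hfix]
    · intro l h3 h4
      simp only [Function.comp]
      rw [hfix]
      exact hne _ (hl l h3 h4).1 (hl l h3 h4).2
    · intro l h3 h4
      simp only [Function.comp]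
      rw [hfix]
      exact hne' _ (hl l h3 h4).1 (hl l h3 h4).2
    · simp only; omega
    · refine hne' ⟨j + 1, hk⟩ hki'.symm (by simp) ?_
      rw [← hx, ← e]; ring

/-- The inversion of the first coordinate turns `Q⁴ x_i x_j = 1` into the linear condition, for `i` the
first position; the exchange relations move `i`. -/
theorem mem_of_left_quadratic (h : ZeroRules n hn Q V Z) (i : Fin (2 * n)) {j : Fin (2 * n)} (hij : i < j)
    (hs : j.val < n) (x : Fin (2 * n) → F) (h0 : x i ≠ 0) (hx : Q ^ 4 * x i * x j = 1)
    (h1 : Q ^ 4 * x i ≠ 1) (hne : ∀ l, l ≠ i → l ≠ j → Q ^ 2 * x i * x l ≠ 1)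
    (hne' : ∀ l, l ≠ i → l ≠ j → Q ^ 2 * x i ≠ x l) : x ∈ Z := by
  obtain ⟨j, hj⟩ := j
  have hQ := h.ne_zero
  obtain ⟨d, hd⟩ : ∃ d, i.val = d := ⟨_, rfl⟩
  induction d generalizing i x with
  | zero =>
    obtain ⟨i, hi⟩ := i
    obtain rfl : i = 0 := hd
    have h2 : (Q ^ 6 * x ⟨0, two_mul_pos hn⟩)⁻¹ ≠ 0 := inv_ne_zero (mul_ne_zero (pow_ne_zero _ hQ) h0)
    refine h.affine x h0 (h.mem_of_linear (i := ⟨0, two_mul_pos hn⟩) ⟨j, hj⟩ hij ?_ _ ?_ ?_ ?_) h1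
    · simp only at hs ⊢; omega
    · rwa [Function.update_self]
    · rw [Function.update_of_ne hij.ne', Function.update_self]
      field_simp
      linear_combination hx
    · intro l h3 h4
      rw [Function.update_self, Function.update_of_ne h3]
      intro e
      refine hne l h3 h4 ?_
      rw [← e]
      field_simp
  | succ d ih =>
    obtain ⟨i, hi⟩ := i
    simp only at hd hs
    subst hd
    rw [Fin.mk_lt_mk] at hij
    have hk : d < 2 * n := by omega
    have hki : (⟨j, hj⟩ : Fin (2 * n)) ≠ ⟨d, hk⟩ := by simp only [ne_eq, Fin.mk.injEq]; omega
    have hki' : (⟨j, hj⟩ : Fin (2 * n)) ≠ ⟨d + 1, hi⟩ := by simp only [ne_eq, Fin.mk.injEq]; omega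
    have hfix : adj d hi ⟨j, hj⟩ = ⟨j, hj⟩ := Equiv.swap_apply_of_ne_of_ne hki hki'
    have hl : ∀ l, l ≠ ⟨d, hk⟩ → l ≠ ⟨j, hj⟩ → adj d hi l ≠ ⟨d + 1, hi⟩ ∧ adj d hi l ≠ ⟨j, hj⟩ := by
      intro l h3 h4
      refine ⟨fun e => h3 ?_, fun e => h4 ?_⟩
      · rw [adj, Equiv.swap_apply_eq_iff, Equiv.swap_apply_right] at e; exact e
      · rw [← hfix] at e; exact (adj d hi).injective e
    have hd' : (x ∘ adj d hi) ⟨d, hk⟩ = x ⟨d + 1, hi⟩ := by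
      rw [Function.comp, adj, Equiv.swap_apply_left]
    refine h.exchange d hi x (by omega) (ih ⟨d, hk⟩ _ ?_ ?_ ?_ ?_ ?_ ?_ rfl) fun e => ?_
    · rwa [hd']
    · rwa [hd']
    · simp only [Fin.mk_lt_mk]; omega
    · rw [hd', Function.comp, hfix, hx]
    · intro l h3 h4
      rw [hd']
      exact hne _ (hl l h3 h4).1 (hl l h3 h4).2
    · intro l h3 h4
      rw [hd']
      exact hne' _ (hl l h3 h4).1 (hl l h3 h4).2
    · exact hne' ⟨d, hk⟩ (by simp) hki.symm e

end ZeroRules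

end QKZ

/-! ### Minimality -/

namespace QKZ

variable {N : ℕ}

/-- A prime polynomial has a generic zero, with coordinates in the fraction field of the quotient. -/
theorem exists_generic_zero.{u} {K : Type u} [Field K] {g : MvPolynomial (Fin N) K} (hg : Irreducible g) :
    ∃ (F : Type u) (_ : Field F) (_ : Algebra K F) (x : Fin N → F), ∀ f, aeval x f = 0 ↔ g ∣ f := by
  have hp : (Ideal.span (Set.singleton g)).IsPrime := (Ideal.span_singleton_prime hg.ne_zero).2 hg.prime
  let A := MvPolynomial (Fin N) K ⧸ Ideal.span (Set.singleton g)
  refine ⟨FractionRing A, inferInstance, inferInstance,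
    fun j => algebraMap A _ (Ideal.Quotient.mk _ (X j)), fun f => ?_⟩
  have h1 : aeval (fun j => algebraMap A (FractionRing A) (Ideal.Quotient.mk _ (X j))) f =
      algebraMap A _ (Ideal.Quotient.mk _ f) := by
    have : aeval (fun j => algebraMap A (FractionRing A) (Ideal.Quotient.mk _ (X j))) =
        (IsScalarTower.toAlgHom K A (FractionRing A)).comp
          (Ideal.Quotient.mkₐ K (Ideal.span (Set.singleton g))) := by
      ext j; simp [A]
    rw [this]; rfl
  rw [h1, FaithfulSMul.algebraMap_eq_zero_iff, Ideal.Quotient.eq_zero_iff_mem]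
  exact Ideal.mem_span_singleton

variable {K : Type*} [Field K]

theorem irreducible_of_totalDegree_one {g : MvPolynomial (Fin N) K} (h : g.totalDegree = 1) :
    Irreducible g := by
  refine irreducible_of_totalDegree_eq_one h fun x hx => ?_
  obtain ⟨m, hm⟩ := ne_zero_iff.1 (ne_zero_of_totalDegree_ne_zero (by rw [h]; exact one_ne_zero))
  exact (ne_zero_of_dvd_ne_zero hm (hx m)).isUnit

theorem irreducible_quadratic {a b : K} (ha : a ≠ 0) (hb : b ≠ 0) {i k : Fin N} (hik : i ≠ k) :
    Irreducible (C a * X i * X k - C b : MvPolynomial (Fin N) K) := by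
  rw [sub_eq_add_neg, ← C_neg]
  refine irreducible_mul_X_add _ _ _ (mul_ne_zero (by rwa [ne_eq, C_eq_zero]) (X_ne_zero _)) ?_ (by simp)
    (IsUnit.isRelPrime_right ((neg_ne_zero.2 hb).isUnit.map C))
  intro h
  have h1 := vars_mul _ _ h
  rw [vars_C, vars_X] at h1
  simp at h1
  exact hik h1.symm

/-- A generic zero of a polynomial involving `w_j` is not a zero of a polynomial free of `w_j`. -/
theorem aeval_ne_zero_of_generic {F : Type*} [Field F] [Algebra K F] {g : MvPolynomial (Fin N) K}
    {x : Fin N → F} (hx : ∀ f, aeval x f = 0 ↔ g ∣ f) {j : Fin N} (hj : degreeOf j g ≠ 0)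
    {h : MvPolynomial (Fin N) K} (hh : degreeOf j h = 0) (h0 : h.totalDegree ≠ 0) : aeval x h ≠ 0 := by
  rw [ne_eq, hx]
  rintro ⟨k, rfl⟩
  have := ne_zero_of_totalDegree_ne_zero h0
  rw [degreeOf_mul_eq (left_ne_zero_of_mul this) (right_ne_zero_of_mul this)] at hh
  omega

/-- The prime factors of the base entry: one for each variable `i`, and a linear and a quadratic one for
each pair of variables of the same half. The quadratic factors of both halves are written in the form
`a w_i w_j - b`. -/
noncomputable def primeFactor (n : ℕ) (q : K) :
    Fin (2 * n) ⊕ (Fin (2 * n) × Fin (2 * n)) × Bool → MvPolynomial (Fin (2 * n)) K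
  | .inl i => C q * X i - C q⁻¹
  | .inr (p, false) => C q * X p.1 - C q⁻¹ * X p.2
  | .inr (p, true) => if p.2.val < n then C (-q ^ 2) * X p.1 * X p.2 - C (-(q ^ 2)⁻¹)
      else C q * X p.1 * X p.2 - C q⁻¹

/-- The pairs `i < j` of points of the same half. -/
def halfPairs (n : ℕ) : Finset (Fin (2 * n) × Fin (2 * n)) :=
  univ.filter fun p => p.1 < p.2 ∧ (p.1.val < n ↔ p.2.val < n)

section primeFactor

variable {n : ℕ} {q : K}

theorem mem_halfPairs {p : Fin (2 * n) × Fin (2 * n)} :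
    p ∈ halfPairs n ↔ p.1 < p.2 ∧ (p.1.val < n ↔ p.2.val < n) := by
  rw [halfPairs, mem_filter, and_iff_right (mem_univ _)]

theorem primeFactor_unary (hq : q ≠ 0) (i : Fin (2 * n)) :
    Irreducible (primeFactor n q (.inl i)) ∧ (primeFactor n q (.inl i)).totalDegree = 1 ∧
      ∀ j, degreeOf j (primeFactor n q (.inl i)) = if j = i then 1 else 0 :=
  ⟨irreducible_of_totalDegree_one (totalDegree_unary hq _ _), totalDegree_unary hq _ _,
    degreeOf_unary hq _ _⟩

theorem primeFactor_pair (hq : q ≠ 0) {p : Fin (2 * n) × Fin (2 * n)} (hp : p.1 < p.2) (b : Bool) :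
    Irreducible (primeFactor n q (.inr (p, b))) ∧
      (primeFactor n q (.inr (p, b))).totalDegree = (if b = true then 2 else 1) ∧
      ∀ j, degreeOf j (primeFactor n q (.inr (p, b))) = if j = p.1 ∨ j = p.2 then 1 else 0 := by
  have hi := inv_ne_zero hq
  cases b
  · exact ⟨irreducible_of_totalDegree_one (totalDegree_linear hq hi hp.ne),
      totalDegree_linear hq hi hp.ne, degreeOf_linear hq hi hp.ne⟩
  · have h2 : -q ^ 2 ≠ 0 := neg_ne_zero.2 (pow_ne_zero _ hq)
    have h3 : -(q ^ 2)⁻¹ ≠ 0 := neg_ne_zero.2 (inv_ne_zero (pow_ne_zero _ hq))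
    rw [primeFactor, if_pos rfl]
    by_cases hn : p.2.val < n
    · rw [if_pos hn]
      exact ⟨irreducible_quadratic h2 h3 hp.ne, totalDegree_quadratic h2 _ _ _,
        degreeOf_quadratic h2 _ hp.ne⟩
    · rw [if_neg hn]
      exact ⟨irreducible_quadratic hq hi hp.ne, totalDegree_quadratic hq _ _ _,
        degreeOf_quadratic hq _ hp.ne⟩

theorem degrees_le_of_dvd {f g : MvPolynomial (Fin N) K} (h : f ∣ g) (hg : g ≠ 0) :
    f.totalDegree ≤ g.totalDegree ∧ ∀ j, degreeOf j f ≤ degreeOf j g := by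
  obtain ⟨k, rfl⟩ := h
  have h1 := left_ne_zero_of_mul hg
  have h2 := right_ne_zero_of_mul hg
  refine ⟨?_, fun j => ?_⟩
  · rw [totalDegree_mul_of_isDomain h1 h2]; exact Nat.le_add_right _ _
  · rw [degreeOf_mul_eq h1 h2]; exact Nat.le_add_right _ _

/-- The prime factors are told apart by their degrees. -/
theorem isRelPrime_primeFactor (hq : q ≠ 0) :
    ((univ.disjSum (halfPairs n ×ˢ univ) : Finset (Fin (2 * n) ⊕ (Fin (2 * n) × Fin (2 * n)) × Bool)) :
      Set _).Pairwise (Function.onFun IsRelPrime (primeFactor n q)) := by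
  have hirr : ∀ s ∈ (univ.disjSum (halfPairs n ×ˢ univ) :
      Finset (Fin (2 * n) ⊕ (Fin (2 * n) × Fin (2 * n)) × Bool)), Irreducible (primeFactor n q s) := by
    rintro (i | ⟨p, b⟩) hs
    · exact (primeFactor_unary hq i).1
    · rw [Finset.inr_mem_disjSum, mem_product, mem_halfPairs] at hs
      exact (primeFactor_pair hq hs.1.1 b).1
  intro s hs t ht hst
  rw [mem_coe] at hs ht
  rw [Function.onFun, (hirr s hs).isRelPrime_iff_not_dvd]
  intro hdvd
  have h1 := degrees_le_of_dvd hdvd (hirr t ht).ne_zero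
  have h2 := degrees_le_of_dvd ((hirr s hs).dvd_symm (hirr t ht) hdvd) (hirr s hs).ne_zero
  have h3 : (primeFactor n q s).totalDegree = (primeFactor n q t).totalDegree := le_antisymm h1.1 h2.1
  have h4 : ∀ j, degreeOf j (primeFactor n q s) = degreeOf j (primeFactor n q t) :=
    fun j => le_antisymm (h1.2 j) (h2.2 j)
  clear h1 h2 hdvd hirr
  apply hst
  rcases s with i | ⟨p, b⟩ <;> rcases t with i' | ⟨p', b'⟩ <;>
    try simp only [Finset.inr_mem_disjSum, mem_product, mem_halfPairs] at hs ht
  · have := h4 i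
    rw [(primeFactor_unary hq i).2.2, (primeFactor_unary hq i').2.2, if_pos rfl] at this
    split_ifs at this with e
    rw [e]
  · have e1 := h4 p'.1
    have e2 := h4 p'.2
    rw [(primeFactor_unary hq i).2.2, (primeFactor_pair hq ht.1.1 b').2.2] at e1 e2
    have := ht.1.1
    grind
  · have e1 := h4 p.1
    have e2 := h4 p.2
    rw [(primeFactor_unary hq i').2.2, (primeFactor_pair hq hs.1.1 b).2.2] at e1 e2
    have := hs.1.1
    grind
  · have e1 := h4 p.1
    have e2 := h4 p.2
    have e3 := h4 p'.1
    have e4 := h4 p'.2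
    rw [(primeFactor_pair hq hs.1.1 b).2.2, (primeFactor_pair hq ht.1.1 b').2.2] at e1 e2 e3 e4
    rw [(primeFactor_pair hq hs.1.1 b).2.1, (primeFactor_pair hq ht.1.1 b').2.1] at h3
    have l1 := hs.1.1
    have l2 := ht.1.1
    obtain ⟨a, c⟩ := p
    obtain ⟨a', c'⟩ := p'
    have hb : b = b' := by cases b <;> cases b' <;> simp_all
    simp only at l1 l2 e1 e2 e3 e4
    have : a = a' ∧ c = c' := by
      clear h3 h4 hs ht hst
      simp only [true_or, or_true, if_true] at e1 e2 e3 e4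
      have f1 : a = a' ∨ a = c' := by by_contra h; rw [if_neg h] at e1; omega
      have f2 : c = a' ∨ c = c' := by by_contra h; rw [if_neg h] at e2; omega
      have f3 : a' = a ∨ a' = c := by by_contra h; rw [if_neg h] at e3; omega
      have f4 : c' = a ∨ c' = c := by by_contra h; rw [if_neg h] at e4; omega
      simp only [Fin.lt_def, Fin.ext_iff] at *
      omega
    rw [hb, this.1, this.2]

theorem baseEntry_eq_prod (q : K) : BqKZ.baseEntry n q =
    C (2 ^ n) * ∏ s ∈ univ.disjSum (halfPairs n ×ˢ univ), primeFactor n q s := by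
  have h1 : ∀ p, ∏ b : Bool, primeFactor n q (.inr (p, b)) =
      if p.2.val < n then (C q * X p.1 - C q⁻¹ * X p.2) * (C (q ^ 2)⁻¹ - C (q ^ 2) * X p.1 * X p.2)
      else (C q * X p.1 - C q⁻¹ * X p.2) * (C q * X p.1 * X p.2 - C q⁻¹) := by
    intro p
    rw [Fintype.prod_bool, primeFactor, primeFactor]
    split_ifs
    · rw [C_neg, C_neg]; ring
    · ring
  rw [Finset.prod_disjSum, Finset.prod_product, Finset.prod_congr rfl fun p _ => h1 p, Finset.prod_ite,
    BqKZ.baseEntry, commonFactor_eq, mul_assoc, mul_assoc]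
  refine congrArg₂ _ rfl (congrArg₂ _ rfl (congrArg₂ _ (Finset.prod_congr ?_ fun _ _ => rfl)
    (Finset.prod_congr ?_ fun _ _ => rfl)))
  · ext p
    simp only [mem_filter, mem_univ, mem_halfPairs, true_and, Fin.lt_def]
    omega
  · ext p
    simp only [mem_filter, mem_univ, mem_halfPairs, true_and, Fin.lt_def]
    omega

end primeFactor

/-- A generic zero of each prime factor is a zero of the first component of every solution. -/
theorem primeFactor_dvd.{u} {K : Type u} [Field K] [CharZero K] {n : ℕ} (hn : 0 < n) {q : Kˣ} (hq : (q : K) ^ 2 ≠ -1)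
    {Φ : LinkPattern (2 * n) → MvPolynomial (Fin (2 * n)) K}
    (h : BqKZ.IsSolution (two_mul_pos hn) (q : K) Φ)
    {s : Fin (2 * n) ⊕ (Fin (2 * n) × Fin (2 * n)) × Bool} (hs : s ∈ univ.disjSum (halfPairs n ×ˢ univ)) :
    primeFactor n (q : K) s ∣ Φ (LinkPattern.rainbow n) := by
  have q0 := q.ne_zero
  have q2 : (q : K) ^ 2 ≠ 0 := pow_ne_zero _ q0
  have q4 : (q : K) ^ 4 ≠ 0 := pow_ne_zero _ q0
  rcases s with j | ⟨⟨i, j⟩, b⟩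
  · obtain ⟨hirr, -, hdeg⟩ := primeFactor_unary q0 j
    obtain ⟨F, _, _, x, hx⟩ := exists_generic_zero hirr
    have hj : degreeOf j (primeFactor n (q : K) (.inl j)) ≠ 0 := by rw [hdeg]; simp
    have hg := (hx _).2 dvd_rfl
    have hQ : algebraMap K F q ≠ 0 := by rw [ne_eq, map_eq_zero]; exact q0
    rw [← hx]
    refine (zeroRules hn hq h F).subset ((zeroRules hn hq h F).mem_of_unary j x ?_ fun l hl => ?_)
    · simp only [primeFactor, map_sub, map_mul, aeval_X, algHom_C, map_inv₀] at hg
      field_simp at hg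
      linear_combination hg
    · have := aeval_ne_zero_of_generic hx hj (h := C ((q : K) ^ 4) * X l - C 1)
        (by rw [degreeOf_unary q4, if_neg hl.symm]) (by rw [totalDegree_unary q4]; simp)
      rw [map_sub, map_mul, aeval_X, algHom_C, algHom_C, map_one, map_pow] at this
      exact sub_ne_zero.1 this
  · rw [Finset.inr_mem_disjSum, mem_product, mem_halfPairs] at hs
    obtain ⟨hij, hh⟩ := hs.1
    simp only at hij hh
    obtain ⟨hirr, -, hdeg⟩ := primeFactor_pair (q := (q : K)) q0 (p := (i, j)) hij b
    obtain ⟨F, _, _, x, hx⟩ := exists_generic_zero hirr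
    have hj : degreeOf j (primeFactor n (q : K) (.inr ((i, j), b))) ≠ 0 := by rw [hdeg]; simp
    have hg := (hx _).2 dvd_rfl
    have hQ : algebraMap K F q ≠ 0 := by rw [ne_eq, map_eq_zero]; exact q0
    -- the coordinates other than the `j`-th one are in general position
    have g0 : x i ≠ 0 := by
      have := aeval_ne_zero_of_generic hx hj (h := X i) (by rw [degreeOf_X, if_neg hij.ne'])
        (by rw [totalDegree_X]; simp)
      rwa [aeval_X] at this
    have g1 : ∀ a : K, a ≠ 0 → algebraMap K F a * x i ≠ 1 := fun a ha => by
      have := aeval_ne_zero_of_generic hx hj (h := C a * X i - C 1)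
        (by rw [degreeOf_unary ha, if_neg hij.ne']) (by rw [totalDegree_unary ha]; simp)
      rw [map_sub, map_mul, aeval_X, algHom_C, algHom_C, map_one] at this
      exact sub_ne_zero.1 this
    have g2 : ∀ a : K, a ≠ 0 → ∀ l, l ≠ i → l ≠ j → algebraMap K F a * x i ≠ x l := fun a ha l li lj => by
      have := aeval_ne_zero_of_generic hx hj (h := C a * X i - C 1 * X l)
        (by rw [degreeOf_linear ha one_ne_zero li.symm, if_neg (not_or.2 ⟨hij.ne', lj.symm⟩)])
        (by rw [totalDegree_linear ha one_ne_zero li.symm]; simp)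
      rw [map_sub, map_mul, map_mul, aeval_X, aeval_X, algHom_C, algHom_C, map_one, one_mul] at this
      exact sub_ne_zero.1 this
    have g3 : ∀ a : K, a ≠ 0 → ∀ l, l ≠ i → l ≠ j → algebraMap K F a * x i * x l ≠ 1 := fun a ha l li lj => by
      have := aeval_ne_zero_of_generic hx hj (h := C a * X i * X l - C 1)
        (by rw [degreeOf_quadratic ha _ li.symm, if_neg (not_or.2 ⟨hij.ne', lj.symm⟩)])
        (by rw [totalDegree_quadratic ha]; simp)
      rw [map_sub, map_mul, map_mul, aeval_X, aeval_X, algHom_C, algHom_C, map_one] at this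
      exact sub_ne_zero.1 this
    rw [← hx]
    have rules := zeroRules hn hq h F
    cases b
    · refine rules.mem_of_linear j hij hh x g0 ?_ ?_
      · simp only [primeFactor, map_sub, map_mul, aeval_X, algHom_C, map_inv₀] at hg
        field_simp at hg
        linear_combination -hg
      · simpa only [map_pow] using g2 _ q4
    · by_cases hjn : j.val < n
      · refine rules.mem_of_left_quadratic i hij hjn x g0 ?_ ?_ ?_ ?_
        · simp only [primeFactor, if_pos hjn, map_sub, map_mul, aeval_X, algHom_C, map_inv₀, map_neg, map_pow] at hg
          field_simp at hg
          linear_combination -hg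
        · simpa only [map_pow] using g1 _ q4
        · simpa only [map_pow] using g3 _ q2
        · simpa only [map_pow] using g2 _ q2
      · refine rules.mem_of_right_quadratic j hij (by omega) x g0 ?_ ?_ ?_ ?_
        · simp only [primeFactor, if_neg hjn, map_sub, map_mul, aeval_X, algHom_C, map_inv₀] at hg
          field_simp at hg
          linear_combination hg
        · simpa only [map_pow] using g1 _ q4
        · simpa only [map_pow] using g2 _ q4
        · simpa only [map_pow] using g3 _ q4

theorem baseEntry_dvd [CharZero K] {n : ℕ} (hn : 0 < n) {q : Kˣ} (hq : (q : K) ^ 2 ≠ -1)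
    {Φ : LinkPattern (2 * n) → MvPolynomial (Fin (2 * n)) K}
    (h : BqKZ.IsSolution (two_mul_pos hn) (q : K) Φ) :
    BqKZ.baseEntry n (q : K) ∣ Φ (LinkPattern.rainbow n) := by
  rw [baseEntry_eq_prod]
  exact (((pow_ne_zero n (two_ne_zero (α := K))).isUnit.map C).mul_left_dvd).2
    (Finset.prod_dvd_of_isRelPrime (isRelPrime_primeFactor q.ne_zero) fun s hs => primeFactor_dvd hn hq h hs)

theorem eq_C_of_degreeOf_eq_zero {f : MvPolynomial (Fin N) K} (h : ∀ j, degreeOf j f = 0) :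
    ∃ c, f = C c := by
  refine ⟨_, totalDegree_eq_zero_iff_eq_C.1 (Nat.le_zero.1 ((totalDegree_le_degrees_card f).trans ?_))⟩
  rw [Multiset.card_eq_zero.2 (Multiset.eq_zero_of_forall_notMem fun j hj => ?_)]
  have := h j
  rw [degreeOf_def, Multiset.count_eq_zero] at this
  exact this hj

theorem IsLoop.sub_smul {q : Kˣ} {Φ Ψ : LinkPattern N → MvPolynomial (Fin N) K} (h : IsLoop q Φ)
    (h' : IsLoop q Ψ) (c : K) : IsLoop q (Φ - c • Ψ) := by
  intro i hi σ
  have e1 := h i hi σ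
  have e2 := h' i hi σ
  simp only [Pi.sub_apply, Pi.smul_apply, smul_sub, Finset.sum_sub_distrib, map_sub, map_smul,
    smul_comm _ c, ← Finset.smul_sum]
  rw [smul_eq_C_mul, smul_eq_C_mul, smul_eq_C_mul]
  linear_combination e1 - C c * e2

/-- The base entry divides the first component of every solution; the quotient is symmetric in the
variables of each half, hence constant if one of the degrees is minimal. -/
theorem minimality [CharZero K] {n : ℕ} (hn : 0 < n) {q : Kˣ} (hq : (q : K) ^ 2 ≠ -1)
    {Ψ Φ : LinkPattern (2 * n) → MvPolynomial (Fin (2 * n)) K}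
    (hl : IsLoop q Ψ) (hΨ : Ψ (LinkPattern.rainbow n) = BqKZ.baseEntry n (q : K))
    (h : BqKZ.IsSolution (two_mul_pos hn) (q : K) Φ) (hΦ : Φ ≠ 0) :
    (∀ j, 2 * n - 1 ≤ BqKZ.degreeIn Φ j) ∧ n * (3 * n - 1) ≤ BqKZ.totalDegree Φ ∧
      (((BqKZ.degreeIn Φ ⟨0, two_mul_pos hn⟩ = 2 * n - 1 ∧
          BqKZ.degreeIn Φ ⟨2 * n - 1, two_mul_sub_one_lt hn⟩ = 2 * n - 1) ∨
        BqKZ.totalDegree Φ = n * (3 * n - 1)) → ∃ c : K, Φ = c • Ψ) := by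
  have hlΦ : IsLoop q Φ := (isLoop_iff q Φ).2 h.bulk
  obtain ⟨b0, b1, b2⟩ := baseEntry_degrees q hn
  obtain ⟨P, hP⟩ := baseEntry_dvd hn hq h
  have hP0 : P ≠ 0 := by
    rintro rfl
    rw [mul_zero] at hP
    exact hΦ (eq_zero_of_isTriangular hlΦ.isTriangular hP)
  have d1 : ∀ j, 2 * n - 1 + degreeOf j P ≤ BqKZ.degreeIn Φ j := fun j => by
    rw [← b1 j, ← degreeOf_mul_eq b0 hP0, ← hP]
    exact degreeOf_le_degreeIn Φ j _
  have d2 : n * (3 * n - 1) + P.totalDegree ≤ BqKZ.totalDegree Φ := by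
    rw [← b2, ← totalDegree_mul_of_isDomain b0 hP0, ← hP]
    exact Finset.le_sup (f := fun π => (Φ π).totalDegree) (mem_univ _)
  refine ⟨fun j => (Nat.le_add_right _ _).trans (d1 j), (Nat.le_add_right _ _).trans d2, fun hmin => ?_⟩
  -- both `Φ` and `Ψ` satisfy the exchange relations at the rainbow pattern, so `P` is symmetric
  have hsymm : ∀ (i : ℕ) (hi : i + 1 < 2 * n), i + 1 ≠ n → rename (adj i hi) P = P := by
    intro i hi hin
    have e1 := hlΦ.rainbow i hi hin
    have e2 := hl.rainbow i hi hin
    rw [hΨ] at e2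
    rw [hP, map_mul, ← mul_assoc, e2] at e1
    refine mul_left_cancel₀ (mul_ne_zero (ne_zero_of_totalDegree_ne_zero ?_) b0)
      (e1.trans (mul_assoc _ _ _).symm)
    rw [totalDegree_linear q.ne_zero (inv_ne_zero q.ne_zero) (by simp)]
    exact one_ne_zero
  have hdeg : ∀ (i : ℕ) (hi : i + 1 < 2 * n), i + 1 ≠ n →
      degreeOf ⟨i + 1, hi⟩ P = degreeOf ⟨i, by omega⟩ P := by
    intro i hi hin
    have := degreeOf_rename_of_injective (p := P) (adj i hi).injective ⟨i, by omega⟩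
    rwa [hsymm i hi hin, adj, Equiv.swap_apply_left] at this
  obtain ⟨c, rfl⟩ : ∃ c, P = C c := by
    rcases hmin with ⟨m0, m1⟩ | m
    · have z0 : degreeOf ⟨0, two_mul_pos hn⟩ P = 0 := by
        have := d1 ⟨0, two_mul_pos hn⟩
        rw [m0] at this; omega
      have z1 : degreeOf ⟨2 * n - 1, two_mul_sub_one_lt hn⟩ P = 0 := by
        have := d1 ⟨2 * n - 1, two_mul_sub_one_lt hn⟩
        rw [m1] at this; omega
      have l0 : ∀ (k : ℕ) (hk : k < n), degreeOf ⟨k, by omega⟩ P = 0 := by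
        intro k
        induction k with
        | zero => exact fun _ => z0
        | succ k ih => exact fun hk => (hdeg k (by omega) (by omega)).trans (ih (by omega))
      have l1 : ∀ (k : ℕ) (hk : k < n), degreeOf ⟨2 * n - 1 - k, by omega⟩ P = 0 := by
        intro k
        induction k with
        | zero => exact fun _ => z1
        | succ k ih =>
          intro hk
          rw [← hdeg (2 * n - 1 - (k + 1)) (by omega) (by omega), ← ih (by omega)]
          congr 2
          omega
      refine eq_C_of_degreeOf_eq_zero fun ⟨j, hj⟩ => ?_
      by_cases hjn : j < n
      · exact l0 j hjn
      · rw [← l1 (2 * n - 1 - j) (by omega)]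
        congr 2
        omega
    · exact ⟨_, totalDegree_eq_zero_iff_eq_C.1 (by omega)⟩
  refine ⟨c, sub_eq_zero.1 (eq_zero_of_isTriangular (hlΦ.sub_smul hl c).isTriangular ?_)⟩
  rw [Pi.sub_apply, Pi.smul_apply, hP, hΨ, smul_eq_C_mul]
  ring

end QKZ

theorem mainTheorem2 {K : Type*} [Field K] [CharZero K] (q : K) (hq : q ≠ 0)
    (n : ℕ) (hn : 0 < n) :
    ∃ Ψ : LinkPattern (2 * n) → BqKZ.Poly K (2 * n),
      BqKZ.IsSolution (by omega : 0 < 2 * n) q Ψ ∧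
      (∀ j, BqKZ.degreeIn Ψ j = 2 * n - 1) ∧
      BqKZ.totalDegree Ψ = n * (3 * n - 1) ∧
      Ψ (LinkPattern.rainbow n) = BqKZ.baseEntry n q ∧
      (∀ π, BqKZ.commonFactor n q ∣ Ψ π) ∧
      BqKZ.IsTriangular q Ψ ∧
      (q ^ 2 ≠ -1 → ∀ Φ : LinkPattern (2 * n) → BqKZ.Poly K (2 * n),
        BqKZ.IsSolution (by omega : 0 < 2 * n) q Φ → Φ ≠ 0 →
          (∀ j, 2 * n - 1 ≤ BqKZ.degreeIn Φ j) ∧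
          n * (3 * n - 1) ≤ BqKZ.totalDegree Φ ∧
          (((BqKZ.degreeIn Φ ⟨0, by omega⟩ = 2 * n - 1 ∧
                BqKZ.degreeIn Φ ⟨2 * n - 1, by omega⟩ = 2 * n - 1) ∨
              BqKZ.totalDegree Φ = n * (3 * n - 1)) →
            ∃ c : K, Φ = c • Ψ)) := by
  lift q to Kˣ using hq.isUnit
  obtain ⟨c, hc, hbase, hdeg, htot, h0, h1⟩ := QKZ.exists_isLoop (BqKZ.RatFun K (2 * n)) q hn
  obtain ⟨a0, a1, a2⟩ := QKZ.commonFactor_degrees (n := n) q.ne_zero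
  obtain ⟨b0, b1, b2⟩ := QKZ.baseEntry_degrees q hn
  have hΨ : BqKZ.commonFactor n (q : K) * c (LinkPattern.rainbow n) = BqKZ.baseEntry n (q : K) := by
    rw [hbase, QKZ.baseEntry_eq]
  have hd : ∀ j, BqKZ.degreeIn (fun p => BqKZ.commonFactor n (q : K) * c p) j = 2 * n - 1 := by
    refine fun j => le_antisymm (Finset.sup_le fun p _ => ?_) ?_
    · refine (degreeOf_mul_le _ _ _).trans ?_
      have := hdeg p j
      rw [a1]; omega
    · rw [← b1 j, ← hΨ]
      exact QKZ.degreeOf_le_degreeIn (fun p => BqKZ.commonFactor n (q : K) * c p) j _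
  have hl : QKZ.IsLoop q fun p => BqKZ.commonFactor n (q : K) * c p :=
    hc.mul_left _ (QKZ.rename_commonFactor _)
  refine ⟨fun p => BqKZ.commonFactor n (q : K) * c p, QKZ.isSolution_of_isLoop hn hc h0 h1 hd, hd,
    le_antisymm (Finset.sup_le fun p _ => ?_) ?_, hΨ, fun p => dvd_mul_right _ _, hl.isTriangular,
    fun hq2 Φ hΦ hΦ0 => QKZ.minimality hn hq2 hl hΨ hΦ hΦ0⟩
  · refine (totalDegree_mul _ _).trans ?_
    rw [a2]
    refine (Nat.add_le_add_left (htot p) _).trans (le_of_eq ?_)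
    obtain ⟨m, rfl⟩ : ∃ m, n = m + 1 := ⟨n - 1, by omega⟩
    rw [Nat.add_sub_cancel, show 3 * (m + 1) - 1 = 3 * m + 2 by omega]
    ring
  · rw [← b2, ← hΨ]
    exact Finset.le_sup (f := fun p => (BqKZ.commonFactor n (q : K) * c p).totalDegree)
      (Finset.mem_univ _)
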